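/- **Instances.** An instance $\mathcal I$ of $mRmD$ consists of finite sets $D$ (demands) and $R$ (resource types, indexed $1,\dots,|R|$); for each $r\in R$ a finite set $S^r$ of starting locations, with $l^r_s\in\mathbb Z_{\ge 0}$ resources of type $r$ at $s\in S^r$; for each $d\in D$ a nonempty set $M_d\subseteq R$ of required types, a start time $\tau_d\in\mathbb Z$, a duration $\Delta_d\in\mathbb Z_{\ge0}$ and a reward $w_d\in\mathbb Z$; and travel times $f_{sd},f_{ij}\in\mathbb Z_{\ge 0}$ from starting locations to demands and between demands, satisfying the triangle inequality ($f_{ik}\le f_{ij}+f_{jk}$ and $f_{sk}\le f_{sj}+f_{jk}$). A path of a resource of type $r$ from $s\in S^r$ is a finite sequence of distinct demands $d_1,d_2,\dots$, all with $r\in M_{d_i}$, such that $f_{sd_1}\le\tau_{d_1}$ and $\tau_{d_i}+\Delta_{d_i}+f_{d_id_{i+1}}\le\tau_{d_{i+1}}$ for all $i$. A feasible solution is a collection, for each $r\in R$ and $s\in S^r$, of at most $l^r_s$ paths of resources of type $r$ from $s$. A demand $d$ is met if for every $r\in M_d$ some path of type $r$ visits $d$. The objective value is the sum of $w_d$ over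 the demands met, and $OPT(\mathcal I)$ is its maximum over feasible solutions. **Conflict graph and coloring.** The conflict graph $G=(V,E)$ has as nodes the distinct sets among the $M_d$, $d\in D$; two distinct nodes $u,v$ are adjacent iff $u\cap v\neq\emptyset$. For integers $a\ge 0$ and $b\ge1$, an $a:b$-coloring assigns to each node a set of $b$ of the colors $1,\dots,a$ so that adjacent nodes receive disjoint sets; $S_i$ is the set of nodes whose set contains $i$. **Algorithm $\mathcal C$.** For $v\in V$ let $1R1\bar D^v$ be the single-type instance formed by the demands $d$ with $M_d=v$ and all resources of the type in $v$ that has the fewest resources (ties broken by smallest index). Start with value $0$ and the empty solution. For $i=1,\dots,a$: solve $1R1\bar D^v$ to optimality for every $v\in S_i$, with optimal value $\mathcal C_v$; if $\sum_{v\in S_i}\mathcal C_v$ is at least the current value, replace the current value by this sum and the current solution by the one in which, for each $v\in S_i$, every type in $v$ follows the paths found for $1R1\bar D^v$. Output the final value $\mathcal C(\mathcal I)$ and solution. **Theorem.** Let $\mathcal I$ be an instance in which all resources have the same starting location $s$ ($S^r=\{s\}$ for all $r$), and let an $a:b$-coloring of its conflict graph be given. Then Algorithm $\mathcal C$ is an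 $\frac ab$-approximation algorithm: 1. whichever optimal solutions of the subproblems are used, its output is a feasible solution of $\mathcal I$, whose objective value is $\mathcal C(\mathcal I)$, and $OPT(\mathcal I)\le\frac ab\,\mathcal C(\mathcal I)$; 2. it can be carried out in polynomial time: there are a single program and a single polynomial $p$ such that for every such instance and coloring the program halts with an output of Algorithm $\mathcal C$ within $p(N)$ steps, where $N$ is the length of the binary encoding of the input, i.e. of the instance together with the list $S_1,\dots,S_a$. (The program is in a WHILE language on trees with integer leaves, in which each basic operation costs the bit size of the data it acts on.) -/

import Mathlib

namespace MRMD

/-! ### Instances, schedules, feasible solutions -/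

/-- An instance of the heterogeneous multi-resource allocation problem, with demands `D`, resource
types `R` and starting locations `L`. -/
structure Instance (D R L : Type) where
  /-- the starting locations of each resource type -/
  S : R → Finset L
  /-- the number of resources of type `r` that start at location `s` -/
  l : L → R → ℕ
  /-- the resource types required by each demand -/
  M : D → Finset R
  M_nonempty : ∀ d, (M d).Nonempty
  /-- service start time -/
  τ : D → ℤ
  /-- service duration -/
  Δ : D → ℕ
  /-- reward -/
  w : D → ℤ
  /-- travel time from a starting location to a demand -/
  fStart : L → D → ℕ
  /-- travel time from a demand to a demand -/
  fDem : D → D → ℕ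

/-- A candidate solution: for each resource type `r` and each starting location `s`, the multiset of
the paths (given by the successive demands visited) of the resources of type `r` that leave `s`.
Resources that are not listed stay idle. -/
structure Solution (D R L : Type) where
  paths : R → L → Multiset (List D)

/-- The solution in which no resource is used. -/
def Solution.empty (D R L : Type) : Solution D R L := ⟨fun _ _ => 0⟩

namespace Instance

variable {D R L : Type}

/-- `A i j`: demand `j` can be served immediately after demand `i`, and their requirements meet. -/
def A (I : Instance D R L) (i j : D) : Prop :=
  I.τ i + I.Δ i + I.fDem i j ≤ I.τ j ∧ ∃ r, r ∈ I.M i ∧ r ∈ I.M j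

/-- `B s d`: a resource that starts at `s` and is required by `d` can serve `d` first. -/
def B (I : Instance D R L) (s : L) (d : D) : Prop :=
  (I.fStart s d : ℤ) ≤ I.τ d ∧ ∃ r, r ∈ I.M d ∧ s ∈ I.S r

/-- `p` lists the demands visited, in this order, by a path of a resource of type `r` from `s`. -/
def IsPath (I : Instance D R L) (r : R) (s : L) (p : List D) : Prop :=
  p.Nodup ∧ (∀ d ∈ p, r ∈ I.M d) ∧ (∀ d ∈ p.head?, I.B s d) ∧ p.IsChain I.A

/-- Feasibility: resources leave only from starting locations of their type, at most as many as
there are, and each one follows a path. -/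
def Feasible (I : Instance D R L) (σ : Solution D R L) : Prop :=
  (∀ r s, s ∉ I.S r → σ.paths r s = 0) ∧
  (∀ r s, (σ.paths r s).card ≤ I.l s r) ∧
  (∀ r s, ∀ p ∈ σ.paths r s, I.IsPath r s p)

/-- A demand is met if it is visited by a resource of each type that it requires. -/
def Met (I : Instance D R L) (σ : Solution D R L) (d : D) : Prop :=
  ∀ r ∈ I.M d, ∃ s, ∃ p ∈ σ.paths r s, d ∈ p

open Classical in
/-- The total reward of the demands that are met. -/
noncomputable def objective [Fintype D] (I : Instance D R L) (σ : Solution D R L) : ℤ :=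
  ∑ d with I.Met σ d, I.w d

/-- `v` is the optimal objective value of the instance. -/
def IsOptValue [Fintype D] (I : Instance D R L) (v : ℤ) : Prop :=
  IsGreatest {x | ∃ σ, I.Feasible σ ∧ I.objective σ = x} v

/-- `σ` is an optimal solution. -/
def IsOptimal [Fintype D] (I : Instance D R L) (σ : Solution D R L) : Prop :=
  I.Feasible σ ∧ ∀ σ', I.Feasible σ' → I.objective σ' ≤ I.objective σ

/-- Every resource (of every type) starts at `s`. -/
def SameStart (I : Instance D R L) (s : L) : Prop := ∀ r, I.S r = {s}

/-- Travel times satisfy the triangle inequality. -/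
def TriangleInequality (I : Instance D R L) : Prop :=
  (∀ i j k, I.fDem i k ≤ I.fDem i j + I.fDem j k) ∧
  (∀ s j k, I.fStart s k ≤ I.fStart s j + I.fDem j k)

/-! ### The conflict graph and the subproblems -/

/-- The nodes of the conflict graph: the distinct sets `M d`. -/
def Node (I : Instance D R L) : Type := {v : Finset R // ∃ d, I.M d = v}

/-- The node of a demand. -/
def node (I : Instance D R L) (d : D) : I.Node := ⟨I.M d, d, rfl⟩

/-- The conflict graph: distinct nodes are adjacent when the sets intersect. -/
def conflictGraph (I : Instance D R L) : SimpleGraph I.Node where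
  Adj u v := u ≠ v ∧ ¬ Disjoint u.1 v.1
  symm := ⟨fun _ _ h => ⟨h.1.symm, fun h' => h.2 h'.symm⟩⟩
  loopless := ⟨fun _ h => h.1 rfl⟩

theorem Node.nonempty {I : Instance D R L} (v : I.Node) : v.1.Nonempty := by
  obtain ⟨_, d, rfl⟩ := v
  exact I.M_nonempty d

/-- The number of resources of type `r`. -/
def numRes (I : Instance D R L) (r : R) : ℕ := ∑ s ∈ I.S r, I.l s r

/-- The type in `v` with the fewest resources, ties being broken by the smaller index. This is the
smallest index in `v` once the types are labelled so that `numRes` is nondecreasing. -/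
def scarcest [LinearOrder R] (I : Instance D R L) (v : I.Node) : R :=
  (ofLex ((v.1.image fun r => toLex (I.numRes r, r)).min' (v.nonempty.image _))).2

/-- The demands whose requirement is exactly `v`. -/
abbrev DBar (I : Instance D R L) (v : I.Node) : Type := {d : D // I.M d = v.1}

/-- The single-resource-type subproblem of `v`: the resources of the scarcest type of `v`, and the
demands whose requirement is exactly `v`. -/
def subproblem [LinearOrder R] (I : Instance D R L) (v : I.Node) :
    Instance (I.DBar v) Unit L where
  S _ := I.S (I.scarcest v)
  l s _ := I.l s (I.scarcest v)
  M _ := {()}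
  M_nonempty _ := Finset.singleton_nonempty _
  τ d := I.τ d.1
  Δ d := I.Δ d.1
  w d := I.w d.1
  fStart s d := I.fStart s d.1
  fDem d e := I.fDem d.1 e.1

end Instance

/-- An `a:b`-coloring: `b` out of `a` colors for each vertex, disjoint sets for adjacent ones. -/
structure ABColoring {V : Type} (G : SimpleGraph V) (a b : ℕ) where
  colors : V → Finset (Fin a)
  card_colors : ∀ v, (colors v).card = b
  disjoint_of_adj : ∀ u v, G.Adj u v → Disjoint (colors u) (colors v)

/-! ### Algorithm C -/

section AlgorithmC

variable {D R L : Type} [Fintype D] [Fintype R] [LinearOrder R]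

open Classical in
noncomputable instance (I : Instance D R L) : Fintype I.Node :=
  inferInstanceAs (Fintype {v : Finset R // ∃ d, I.M d = v})

/-- The set `S_i` of the nodes that have color `i` among their colors. -/
noncomputable def colorClass {I : Instance D R L} {a b : ℕ} (c : ABColoring I.conflictGraph a b)
    (i : Fin a) : Finset I.Node :=
  {v | i ∈ c.colors v}

/-- The solution for color `i`: for each node `v` of color `i`, every type in `v` follows the paths
of the given solution of the subproblem of `v`. -/
noncomputable def colorSolution {I : Instance D R L} {a b : ℕ}
    (c : ABColoring I.conflictGraph a b) (sub : ∀ v : I.Node, Solution (I.DBar v) Unit L)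
    (i : Fin a) : Solution D R L where
  paths r s := ∑ v ∈ colorClass c i with r ∈ v.1,
    ((sub v).paths () s).map (List.map Subtype.val)

/-- The value of color `i`: the sum of the values of the subproblems of its nodes. -/
noncomputable def colorValue {I : Instance D R L} {a b : ℕ}
    (c : ABColoring I.conflictGraph a b) (sub : ∀ v : I.Node, Solution (I.DBar v) Unit L)
    (i : Fin a) : ℤ :=
  ∑ v ∈ colorClass c i, (I.subproblem v).objective (sub v)

/-- Algorithm C, where `sub v` is the solution found for the subproblem of `v`: the colors are
scanned in order, and the current best value and solution are replaced whenever the value of the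
color is at least the current one. -/
noncomputable def algorithmC {I : Instance D R L} {a b : ℕ}
    (c : ABColoring I.conflictGraph a b) (sub : ∀ v : I.Node, Solution (I.DBar v) Unit L) :
    ℤ × Solution D R L :=
  (List.finRange a).foldl
    (fun cur i =>
      if cur.1 ≤ colorValue c sub i then (colorValue c sub i, colorSolution c sub i) else cur)
    (0, Solution.empty D R L)

end AlgorithmC

/-! ### A model of computation with a step count -/

/-- The data that programs work on: binary trees with integer leaves. -/
inductive Datum where
  | num (z : ℤ)
  | pair (x y : Datum)

namespace Datum

/-- The number of bits (up to a constant factor) of a datum, integers being written in binary. -/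
def size : Datum → ℕ
  | num z => z.natAbs.size + 1
  | pair x y => x.size + y.size + 1

def fst : Datum → Datum
  | pair x _ => x
  | num _ => num 0

def snd : Datum → Datum
  | pair _ y => y
  | num _ => num 0

/-- `1` on pairs and `0` on integers. -/
def isPair : Datum → Datum
  | pair _ _ => num 1
  | num _ => num 0

def add : Datum → Datum
  | pair (num x) (num y) => num (x + y)
  | _ => num 0

def sub : Datum → Datum
  | pair (num x) (num y) => num (x - y)
  | _ => num 0

def le : Datum → Datum
  | pair (num x) (num y) => num (if x ≤ y then 1 else 0)
  | _ => num 0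

/-- Lists are coded by nested pairs, with the integer `0` at the end. -/
def ofList : List Datum → Datum
  | [] => num 0
  | x :: xs => pair x (ofList xs)

/-- A finite table, as a list. -/
def ofTable {n : ℕ} (f : Fin n → Datum) : Datum := ofList (List.ofFn f)

def ofNat (n : ℕ) : Datum := num n

open Classical in
noncomputable def ofProp (p : Prop) : Datum := num (if p then 1 else 0)

end Datum

/-- Programs: a WHILE language on a single store that holds one datum. -/
inductive Prog where
  | id
  | const (z : ℤ)
  | fst
  | snd
  | isPair
  | add
  | sub
  | le
  | pair (f g : Prog)
  | seq (f g : Prog)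
  | ite (c f g : Prog)
  | while (c f : Prog)

/-- `P.Runs x y t`: started on `x`, the program `P` halts with output `y` after `t` steps. A basic
operation, and each copy of the store that is made, costs the size of the store. -/
inductive Prog.Runs : Prog → Datum → Datum → ℕ → Prop
  | id (x) : Runs .id x x x.size
  | const (z x) : Runs (.const z) x (.num z) (x.size + (Datum.num z).size)
  | fst (x) : Runs .fst x x.fst x.size
  | snd (x) : Runs .snd x x.snd x.size
  | isPair (x) : Runs .isPair x x.isPair x.size
  | add (x) : Runs .add x x.add x.size
  | sub (x) : Runs .sub x x.sub x.size
  | le (x) : Runs .le x x.le x.size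
  | pair {f g x y z t u} : Runs f x y t → Runs g x z u →
      Runs (.pair f g) x (.pair y z) (t + u + x.size)
  | seq {f g x y z t u} : Runs f x y t → Runs g y z u → Runs (.seq f g) x z (t + u + 1)
  | ite_true {c f g x y z t u} : Runs c x y t → y ≠ .num 0 → Runs f x z u →
      Runs (.ite c f g) x z (t + u + x.size)
  | ite_false {c f g x z t u} : Runs c x (.num 0) t → Runs g x z u →
      Runs (.ite c f g) x z (t + u + x.size)
  | while_true {c f x y x' z t u v} : Runs c x y t → y ≠ .num 0 → Runs f x x' u →
      Runs (.while c f) x' z v → Runs (.while c f) x z (t + u + v + x.size)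
  | while_false {c f x t} : Runs c x (.num 0) t → Runs (.while c f) x x (t + x.size)

/-! ### Coding of inputs and outputs -/

/-- The code of an instance: all of its parameters, as tables. -/
noncomputable def encodeInstance {n k q : ℕ} (I : Instance (Fin n) (Fin k) (Fin q)) : Datum :=
  .ofList [.ofNat n, .ofNat k, .ofNat q,
    .ofTable fun r => .ofTable fun s => .ofProp (s ∈ I.S r),
    .ofTable fun s => .ofTable fun r => .ofNat (I.l s r),
    .ofTable fun d => .ofTable fun r => .ofProp (r ∈ I.M d),
    .ofTable fun d => .num (I.τ d),
    .ofTable fun d => .ofNat (I.Δ d),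
    .ofTable fun d => .num (I.w d),
    .ofTable fun s => .ofTable fun d => .ofNat (I.fStart s d),
    .ofTable fun i => .ofTable fun j => .ofNat (I.fDem i j)]

/-- The code of an instance with the color classes of a coloring of its conflict graph; a node is
represented by the demands that have it as their requirement. -/
noncomputable def encodeInput {n k q : ℕ} (I : Instance (Fin n) (Fin k) (Fin q)) {a b : ℕ}
    (c : ABColoring I.conflictGraph a b) : Datum :=
  .ofList [encodeInstance I, .ofNat a,
    .ofTable fun i : Fin a => .ofTable fun d => .ofProp (I.node d ∈ colorClass c i)]

/-- The code of an output: a value, and for each type and starting location a list of paths. -/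
def encodeOutput {n k q : ℕ} (val : ℤ) (paths : Fin k → Fin q → List (List (Fin n))) : Datum :=
  .pair (.num val)
    (.ofTable fun r => .ofTable fun s =>
      .ofList ((paths r s).map fun p => .ofList (p.map fun d => .ofNat d.1)))

/-- `P` outputs, on input `x` and in at most `T` steps, the value `out.1` and the solution `out.2`,
the paths of each type from each location being listed in some order. -/
def OutputsWithin {n k q : ℕ} (P : Prog) (x : Datum)
    (out : ℤ × Solution (Fin n) (Fin k) (Fin q)) (T : ℕ) : Prop :=
  ∃ paths : Fin k → Fin q → List (List (Fin n)),
    (∀ r s, (paths r s : Multiset (List (Fin n))) = out.2.paths r s) ∧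
    ∃ t ≤ T, P.Runs x (encodeOutput out.1 paths) t

end MRMD

/-!
Fix a feasible solution of value `OPT`. By the triangle inequality, a path restricted to the demands
`d` with `M d = v` is still a path, so the paths of the scarcest type in `v` become a feasible
solution of the subproblem of `v`, and `OPT` is at most the sum of the optimal values of all
subproblems. As every node has `b` of the `a` colors, the values of the colors add up to `b` times
this sum, so that the best of them is at least `b / a` times `OPT`. Conversely, nodes of the same
color are disjoint sets of types, and every type in `v` has as many resources as the scarcest one,
so the solutions of the subproblems of one color combine to a feasible solution.

The demands of a subproblem that can be reached from the start are partially ordered by the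
relation that one resource can serve both in turn, again by the triangle inequality, and a solution
is a covering by a bounded number of chains. A chain cover amounts to an injective choice of a
predecessor for each demand: the previous demand of its chain, the label of the chain that it
starts, or itself if it is not covered. This turns the subproblem into an assignment problem, which
the Hungarian method solves with potentials whose size stays polynomial.

No program is written out: the families of functions computed by a single program in polynomial
time are closed under composition, case distinctions, quantification over and tables indexed by
`Fin n`, and loops with an invariant that bounds the size of the state.
-/

namespace MRMD

/-! ### Sizes of data -/

namespace Datum

theorem one_le_size (x : Datum) : 1 ≤ x.size := by
  cases x <;> simp [size]

theorem size_fst_le (x : Datum) : x.fst.size ≤ x.size := by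
  cases x with
  | num z => simp [fst, size]
  | pair x y => simp only [fst, size]; omega

theorem size_snd_le (x : Datum) : x.snd.size ≤ x.size := by
  cases x with
  | num z => simp [snd, size]
  | pair x y => simp only [snd, size]; omega

theorem size_isPair_le (x : Datum) : x.isPair.size ≤ x.size := by
  cases x with
  | num z => simp [isPair, size]
  | pair x y =>
    have := x.one_le_size
    simp only [isPair, size, Int.natAbs_one, Nat.size_one]
    omega

theorem size_natAbs_add_le (x y : ℤ) :
    (x + y).natAbs.size ≤ x.natAbs.size + y.natAbs.size + 1 := by
  rw [Nat.size_le]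
  calc (x + y).natAbs ≤ x.natAbs + y.natAbs := Int.natAbs_add_le x y
    _ < 2 ^ x.natAbs.size + 2 ^ y.natAbs.size :=
        Nat.add_lt_add (Nat.lt_size_self _) (Nat.lt_size_self _)
    _ ≤ 2 ^ (x.natAbs.size + y.natAbs.size) + 2 ^ (x.natAbs.size + y.natAbs.size) := by
        gcongr <;> omega
    _ = 2 ^ (x.natAbs.size + y.natAbs.size + 1) := by ring

theorem size_add_le (x : Datum) : x.add.size ≤ x.size := by
  rcases x with _ | ⟨x | _, y | _⟩
  case pair.num.num =>
    have := size_natAbs_add_le x y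
    simp only [add, size]
    omega
  all_goals simp [add, size]

theorem size_sub_le (x : Datum) : x.sub.size ≤ x.size := by
  rcases x with _ | ⟨x | _, y | _⟩
  case pair.num.num =>
    have := size_natAbs_add_le x (-y)
    rw [Int.natAbs_neg, ← sub_eq_add_neg] at this
    simp only [sub, size]
    omega
  all_goals simp [sub, size]

theorem size_le_le (x : Datum) : x.le.size ≤ x.size := by
  rcases x with _ | ⟨x | _, y | _⟩
  case pair.num.num =>
    have : (if x ≤ y then (1 : ℤ) else 0).natAbs.size ≤ 1 := by split_ifs <;> simp
    simp only [le, size]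
    omega
  all_goals simp [le, size]

theorem size_num_le {z : ℤ} {b : ℕ} (h : z.natAbs ≤ 2 ^ b) : (num z).size ≤ b + 2 :=
  Nat.succ_le_succ (Nat.size_le.2 (h.trans_lt (Nat.pow_lt_pow_right one_lt_two (by omega))))

theorem natAbs_lt_two_pow_size (z : ℤ) : z.natAbs < 2 ^ (num z).size :=
  (Nat.lt_size_self _).trans_le (Nat.pow_le_pow_right two_pos (Nat.le_succ _))

theorem size_num_natCast_le (n : ℕ) : (num (n : ℤ)).size ≤ n + 2 :=
  size_num_le Nat.lt_two_pow_self.le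

theorem size_ofList (l : List Datum) : (ofList l).size = (l.map fun x => x.size + 1).sum + 1 := by
  induction l with
  | nil => rfl
  | cons a l ih => simp only [ofList, size, ih, List.map_cons, List.sum_cons]; omega

theorem length_le_size_ofList (l : List Datum) : l.length ≤ (ofList l).size := by
  induction l with
  | nil => exact Nat.zero_le _
  | cons a l ih => simp only [ofList, size, List.length_cons]; omega

theorem size_ofList_le {l : List Datum} {B : ℕ} (h : ∀ x ∈ l, x.size ≤ B) :
    (ofList l).size ≤ l.length * (B + 1) + 1 := by
  have hsum := List.sum_le_card_nsmul (l.map fun x => x.size + 1) (B + 1)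
    (List.forall_mem_map.2 fun x hx => Nat.succ_le_succ (h x hx))
  rw [List.length_map, smul_eq_mul] at hsum
  rw [size_ofList]
  omega

theorem size_ofTable_le {n : ℕ} {f : Fin n → Datum} {B : ℕ} (h : ∀ j, (f j).size ≤ B) :
    (ofTable f).size ≤ n * (B + 1) + 1 := by
  simpa only [ofTable, List.length_ofFn] using
    size_ofList_le ((List.forall_mem_ofFn_iff (P := fun x : Datum => x.size ≤ B)).2 h)

theorem size_le_size_ofList {l : List Datum} {x : Datum} (h : x ∈ l) :
    x.size ≤ (ofList l).size := by
  have := List.le_sum_of_mem (List.mem_map_of_mem (f := fun x : Datum => x.size + 1) h)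
  rw [size_ofList]
  omega

theorem size_ofList_drop_le (l : List Datum) (t : ℕ) :
    (ofList (l.drop t)).size ≤ (ofList l).size := by
  rw [size_ofList, size_ofList]
  exact Nat.succ_le_succ
    (((l.drop_sublist t).map _).sum_le_sum fun _ _ => Nat.zero_le _)

theorem ofList_drop {l : List Datum} {t : ℕ} (h : t < l.length) :
    ofList (l.drop t) = pair l[t] (ofList (l.drop (t + 1))) := by
  rw [List.drop_eq_getElem_cons h, ofList]

theorem isPair_ofList_drop (l : List Datum) (t : ℕ) :
    (ofList (l.drop t)).isPair = ofProp (t < l.length) := by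
  by_cases h : t < l.length
  · simp only [ofList_drop h, isPair, ofProp, h, if_true]
  · simp only [List.drop_eq_nil_of_le (not_lt.1 h), ofList, isPair, ofProp, h, if_false]

end Datum

/-! ### Time bounds -/

theorem Prog.Runs.size_le {P : Prog} {x y : Datum} {t : ℕ} (h : P.Runs x y t) : y.size ≤ t := by
  induction h with
  | id x => exact le_rfl
  | const z x => exact Nat.le_add_left _ _
  | fst x => exact x.size_fst_le
  | snd x => exact x.size_snd_le
  | isPair x => exact x.size_isPair_le
  | add x => exact x.size_add_le
  | sub x => exact x.size_sub_le
  | le x => exact x.size_le_le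
  | @pair _ _ x =>
    have := x.one_le_size
    simp only [Datum.size]
    omega
  | seq => omega
  | ite_true => omega
  | ite_false => omega
  | while_true => omega
  | while_false => omega

/-- `P.RunsWithin x y T`: started on `x`, the program `P` halts with output `y` after at most `T`
steps. -/
def Prog.RunsWithin (P : Prog) (x y : Datum) (T : ℕ) : Prop := ∃ t ≤ T, P.Runs x y t

namespace Prog.RunsWithin

variable {P Q C : Prog} {x y z : Datum} {T U V : ℕ}

theorem mono (h : P.RunsWithin x y T) (hTU : T ≤ U) : P.RunsWithin x y U :=
  h.imp fun _ ht => ⟨ht.1.trans hTU, ht.2⟩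

theorem size_le (h : P.RunsWithin x y T) : y.size ≤ T :=
  let ⟨_, ht, hP⟩ := h
  hP.size_le.trans ht

theorem pair (hP : P.RunsWithin x y T) (hQ : Q.RunsWithin x z U) :
    (Prog.pair P Q).RunsWithin x (.pair y z) (T + U + x.size) :=
  let ⟨_, ht, hP⟩ := hP
  let ⟨_, hu, hQ⟩ := hQ
  ⟨_, by gcongr, hP.pair hQ⟩

theorem seq (hP : P.RunsWithin x y T) (hQ : Q.RunsWithin y z U) :
    (Prog.seq P Q).RunsWithin x z (T + U + 1) :=
  let ⟨_, ht, hP⟩ := hP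
  let ⟨_, hu, hQ⟩ := hQ
  ⟨_, by gcongr, hP.seq hQ⟩

theorem ite_true (hC : C.RunsWithin x y T) (hy : y ≠ .num 0) (hP : P.RunsWithin x z U) :
    (Prog.ite C P Q).RunsWithin x z (T + U + x.size) :=
  let ⟨_, ht, hC⟩ := hC
  let ⟨_, hu, hP⟩ := hP
  ⟨_, by gcongr, hC.ite_true hy hP⟩

theorem ite_false (hC : C.RunsWithin x (.num 0) T) (hQ : Q.RunsWithin x z U) :
    (Prog.ite C P Q).RunsWithin x z (T + U + x.size) :=
  let ⟨_, ht, hC⟩ := hC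
  let ⟨_, hu, hQ⟩ := hQ
  ⟨_, by gcongr, hC.ite_false hQ⟩

theorem while_true {x' : Datum} (hC : C.RunsWithin x y T) (hy : y ≠ .num 0)
    (hP : P.RunsWithin x x' U) (hw : (Prog.while C P).RunsWithin x' z V) :
    (Prog.while C P).RunsWithin x z (T + U + V + x.size) :=
  let ⟨_, ht, hC⟩ := hC
  let ⟨_, hu, hP⟩ := hP
  let ⟨_, hv, hw⟩ := hw
  ⟨_, by gcongr, hC.while_true hy hP hw⟩

theorem while_false (hC : C.RunsWithin x (.num 0) T) :
    (Prog.while C P).RunsWithin x x (T + x.size) :=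
  let ⟨_, ht, hC⟩ := hC
  ⟨_, by gcongr, hC.while_false⟩

theorem while_loop {s : ℕ → Datum} {N B : ℕ}
    (hC : ∀ j ≤ N, C.RunsWithin (s j) (.ofProp (j < N)) T)
    (hP : ∀ j < N, P.RunsWithin (s j) (s (j + 1)) U) (hs : ∀ j ≤ N, (s j).size ≤ B) :
    (Prog.while C P).RunsWithin (s 0) (s N) ((N + 1) * (T + U + B)) := by
  suffices ∀ m j, j + m = N →
      (Prog.while C P).RunsWithin (s j) (s N) ((m + 1) * (T + U + B)) from this N 0 (zero_add N)
  intro m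
  induction m with
  | zero =>
    rintro j rfl
    have hCj := hC j le_rfl
    simp only [add_zero, lt_irrefl, Datum.ofProp, if_false] at hCj
    exact hCj.while_false.mono (by have := hs j le_rfl; simp only [add_zero] at *; linarith)
  | succ m ih =>
    rintro j hj
    have hlt : j < N := by omega
    have hCj := hC j hlt.le
    simp only [hlt, Datum.ofProp, if_true] at hCj
    exact (hCj.while_true (by simp) (hP j hlt) (ih (j + 1) (by omega))).mono
      (by have := hs j hlt.le; linarith)

end Prog.RunsWithin

/-- `f` is bounded by a polynomial in the size of `x`. The base `size + 2` makes every constant at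
most a power of it. -/
def PolyBdd {ι : Type} (x : ι → Datum) (f : ι → ℕ) : Prop :=
  ∃ k, ∀ i, f i ≤ ((x i).size + 2) ^ k

namespace PolyBdd

variable {ι : Type} {x : ι → Datum} {f g : ι → ℕ}

theorem mono (hg : PolyBdd x g) (h : ∀ i, f i ≤ g i) : PolyBdd x f :=
  hg.imp fun _ hk i => (h i).trans (hk i)

theorem size (x : ι → Datum) : PolyBdd x fun i => (x i).size := ⟨1, fun i => by simp⟩

theorem size_pow (x : ι → Datum) (k : ℕ) : PolyBdd x fun i => ((x i).size + 2) ^ k :=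
  ⟨k, fun _ => le_rfl⟩

theorem const (x : ι → Datum) (c : ℕ) : PolyBdd x fun _ => c :=
  ⟨c, fun i => Nat.lt_two_pow_self.le.trans (Nat.pow_le_pow_left (by omega) _)⟩

theorem mul (hf : PolyBdd x f) (hg : PolyBdd x g) : PolyBdd x fun i => f i * g i := by
  obtain ⟨k, hk⟩ := hf
  obtain ⟨l, hl⟩ := hg
  exact ⟨k + l, fun i => by rw [pow_add]; exact Nat.mul_le_mul (hk i) (hl i)⟩

theorem add (hf : PolyBdd x f) (hg : PolyBdd x g) : PolyBdd x fun i => f i + g i := by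
  obtain ⟨k, hk⟩ := hf
  obtain ⟨l, hl⟩ := hg
  refine (((size_pow x k).mul (size_pow x l)).mul (const x 2)).mono fun i => ?_
  have hpos (m : ℕ) : 0 < ((x i).size + 2) ^ m := by positivity
  have hkl := Nat.le_mul_of_pos_right (((x i).size + 2) ^ k) (hpos l)
  have hlk := Nat.le_mul_of_pos_left (((x i).size + 2) ^ l) (hpos k)
  linarith [hk i, hl i]

theorem succ (hf : PolyBdd x f) : PolyBdd x fun i => f i + 1 := hf.add (const x 1)

theorem pow (hf : PolyBdd x f) (l : ℕ) : PolyBdd x fun i => f i ^ l := by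
  obtain ⟨k, hk⟩ := hf
  exact ⟨k * l, fun i => by rw [pow_mul]; exact Nat.pow_le_pow_left (hk i) l⟩

theorem reindex {κ : Type} (hf : PolyBdd x f) (σ : κ → ι) :
    PolyBdd (fun j => x (σ j)) fun j => f (σ j) :=
  hf.imp fun _ hk j => hk (σ j)

theorem comp {y : ι → Datum} (hf : PolyBdd y f) (hy : PolyBdd x fun i => (y i).size) :
    PolyBdd x f :=
  let ⟨k, hk⟩ := hf
  ((hy.add (const x 2)).pow k).mono hk

end PolyBdd

/-! ### Polynomial-time computability -/

/-- Types whose elements are coded by data, so that programs can work on them. -/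
class Enc (α : Type) where
  /-- the code of an element -/
  enc : α → Datum

/-- Types whose elements are coded by distinct integers, so that programs can decide equality. -/
class IntCode (α : Type) where
  /-- the integer that codes an element -/
  toInt : α → ℤ
  toInt_injective : Function.Injective toInt

open Enc
open IntCode (toInt toInt_injective)

instance : Enc Datum := ⟨fun x => x⟩

instance {α : Type} [IntCode α] : Enc α := ⟨fun a => .num (toInt a)⟩

instance : IntCode ℤ := ⟨fun z => z, Function.injective_id⟩

instance : IntCode ℕ := ⟨fun n => n, Nat.cast_injective⟩

instance {n : ℕ} : IntCode (Fin n) :=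
  ⟨fun j => ((j : ℕ) : ℤ), Nat.cast_injective.comp Fin.val_injective⟩

instance {n : ℕ} : IntCode (Option (Fin n)) where
  toInt o := o.elim (-1) fun j => ((j : ℕ) : ℤ)
  toInt_injective
    | none, none, _ => rfl
    | none, some _, h => by simp only [Option.elim_none, Option.elim_some] at h; omega
    | some _, none, h => by simp only [Option.elim_none, Option.elim_some] at h; omega
    | some _, some _, h => congrArg some (Fin.ext (Int.ofNat.inj h))

noncomputable instance : Enc Prop := ⟨Datum.ofProp⟩

instance : Enc Unit := ⟨fun _ => .num 0⟩

instance {α β : Type} [Enc α] [Enc β] : Enc (α × β) := ⟨fun p => .pair (enc p.1) (enc p.2)⟩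

instance {α : Type} [Enc α] : Enc (List α) := ⟨fun l => .ofList (l.map enc)⟩

instance {n : ℕ} {α : Type} [Enc α] : Enc (Fin n → α) := ⟨fun f => .ofTable fun j => enc (f j)⟩

theorem enc_prop_of {p : Prop} (h : p) : enc p = Datum.num 1 := by simp [enc, Datum.ofProp, h]

theorem enc_prop_eq_zero {p : Prop} : enc p = Datum.num 0 ↔ ¬p := by
  by_cases h : p <;> simp [h, enc, Datum.ofProp]

theorem size_enc_prop_le (p : Prop) : (enc p).size ≤ 2 := by
  by_cases h : p <;> simp [h, enc, Datum.ofProp, Datum.size]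

theorem size_enc_option_fin_le {n : ℕ} (o : Option (Fin n)) : (enc o).size ≤ n + 2 := by
  refine Datum.size_num_le ?_
  cases o with
  | none => simpa [toInt] using Nat.one_le_two_pow
  | some j => simpa [toInt] using (j.2.trans Nat.lt_two_pow_self).le

theorem size_enc_apply_le {n : ℕ} {α : Type} [Enc α] (f : Fin n → α) (j : Fin n) :
    (enc (f j)).size ≤ (enc f).size :=
  Datum.size_le_size_ofList (List.mem_ofFn.2 ⟨j, rfl⟩)

/-- A single program computes `y i` from `x i`, for all `i`, in polynomial time. The family
`x` plays the role of a context: computability of a term with free variables is stated with the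
values of these variables as the index `i`. -/
def PolyTime {ι : Type} (x : ι → Datum) {α : ι → Type} [∀ i, Enc (α i)] (y : ∀ i, α i) : Prop :=
  ∃ (P : Prog) (k : ℕ), ∀ i, P.RunsWithin (x i) (enc (y i)) (((x i).size + 2) ^ k)

namespace PolyTime

variable {ι κ : Type} {x : ι → Datum} {α β : ι → Type} [∀ i, Enc (α i)] [∀ i, Enc (β i)]

theorem of_polyBdd {y : ∀ i, α i} {P : Prog} {T : ι → ℕ} (hT : PolyBdd x T)
    (hP : ∀ i, P.RunsWithin (x i) (enc (y i)) (T i)) : PolyTime x y :=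
  let ⟨k, hk⟩ := hT
  ⟨P, k, fun i => (hP i).mono (hk i)⟩

theorem of_runs {y : ∀ i, α i} {P : Prog} (hP : ∀ i, P.Runs (x i) (enc (y i)) (x i).size) :
    PolyTime x y :=
  of_polyBdd (PolyBdd.size x) fun i => ⟨_, le_rfl, hP i⟩

theorem polyBdd_size {y : ∀ i, α i} (hy : PolyTime x y) : PolyBdd x fun i => (enc (y i)).size :=
  let ⟨_, k, hP⟩ := hy
  ⟨k, fun i => (hP i).size_le⟩

theorem congr_enc {y : ∀ i, α i} {z : ∀ i, β i} (hz : PolyTime x z)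
    (h : ∀ i, enc (y i) = enc (z i)) : PolyTime x y :=
  let ⟨P, k, hP⟩ := hz
  ⟨P, k, fun i => h i ▸ hP i⟩

theorem congr_prop {p q : ι → Prop} (hp : PolyTime x p) (h : ∀ i, q i ↔ p i) : PolyTime x q :=
  hp.congr_enc fun i => congrArg enc (propext (h i))

theorem reindex {y : ∀ i, α i} (hy : PolyTime x y) (σ : κ → ι) :
    PolyTime (fun j => x (σ j)) fun j => y (σ j) :=
  let ⟨P, k, hP⟩ := hy
  ⟨P, k, fun j => hP (σ j)⟩

theorem restrict {y : ∀ i, α i} (hy : PolyTime x y) (p : ι → Prop) :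
    PolyTime (fun i : {i // p i} => x i.1) fun i => y i.1 := hy.reindex Subtype.val

theorem id (x : ι → Datum) : PolyTime x x := of_runs fun i => .id (x i)

theorem const_num (x : ι → Datum) (z : ℤ) : PolyTime x fun _ => Datum.num z :=
  of_polyBdd ((PolyBdd.size x).add (PolyBdd.const x _)) fun i => ⟨_, le_rfl, .const z (x i)⟩

theorem const_int (x : ι → Datum) (z : ℤ) : PolyTime x fun _ => z := const_num x z

theorem const_prop (x : ι → Datum) (p : Prop) : PolyTime x fun _ => p := by
  by_cases hp : p
  · exact (const_num x 1).congr_enc fun _ => enc_prop_of hp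
  · exact (const_num x 0).congr_enc fun _ => enc_prop_eq_zero.2 hp

theorem comp {y : ∀ i, α i} {z : ∀ i, β i} (hy : PolyTime x y)
    (hz : PolyTime (fun i => enc (y i)) z) : PolyTime x z :=
  have hsize := hy.polyBdd_size
  let ⟨_, k, hP⟩ := hy
  let ⟨_, l, hQ⟩ := hz
  of_polyBdd (((PolyBdd.size_pow x k).add ((PolyBdd.size_pow _ l).comp hsize)).add
    (PolyBdd.const x 1)) fun i => (hP i).seq (hQ i)

theorem trans {y : ι → Datum} {z : ∀ i, β i} (hy : PolyTime x y) (hz : PolyTime y z) :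
    PolyTime x z := hy.comp hz

theorem prodMk {y : ∀ i, α i} {z : ∀ i, β i} (hy : PolyTime x y) (hz : PolyTime x z) :
    PolyTime x fun i => (y i, z i) :=
  let ⟨_, k, hP⟩ := hy
  let ⟨_, l, hQ⟩ := hz
  of_polyBdd (((PolyBdd.size_pow x k).add (PolyBdd.size_pow x l)).add (PolyBdd.size x))
    fun i => (hP i).pair (hQ i)

theorem datum_pair {y z : ι → Datum} (hy : PolyTime x y) (hz : PolyTime x z) :
    PolyTime x fun i => Datum.pair (y i) (z i) := hy.prodMk hz

theorem datum_fst {y : ι → Datum} (hy : PolyTime x y) : PolyTime x fun i => (y i).fst :=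
  hy.comp (of_runs fun i => .fst (y i))

theorem datum_snd {y : ι → Datum} (hy : PolyTime x y) : PolyTime x fun i => (y i).snd :=
  hy.comp (of_runs fun i => .snd (y i))

theorem datum_isPair {y : ι → Datum} (hy : PolyTime x y) : PolyTime x fun i => (y i).isPair :=
  hy.comp (of_runs fun i => .isPair (y i))

theorem fst {y : ∀ i, α i × β i} (hy : PolyTime x y) : PolyTime x fun i => (y i).1 :=
  datum_fst (y := fun i => enc (y i)) hy

theorem snd {y : ∀ i, α i × β i} (hy : PolyTime x y) : PolyTime x fun i => (y i).2 :=
  datum_snd (y := fun i => enc (y i)) hy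

theorem toInt {γ : ι → Type} [∀ i, IntCode (γ i)] {f : ∀ i, γ i} (hf : PolyTime x f) :
    PolyTime x fun i => IntCode.toInt (f i) := hf

theorem fin_val {n : ι → ℕ} {f : ∀ i, Fin (n i)} (hf : PolyTime x f) :
    PolyTime x fun i => ((f i : ℕ) : ℤ) := hf

theorem natCast {f : ι → ℕ} (hf : PolyTime x f) : PolyTime x fun i => (f i : ℤ) := hf

section Arithmetic

variable {f g : ι → ℤ}

theorem add (hf : PolyTime x f) (hg : PolyTime x g) : PolyTime x fun i => f i + g i :=
  (hf.prodMk hg).comp (of_runs fun _ => .add _)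

theorem sub (hf : PolyTime x f) (hg : PolyTime x g) : PolyTime x fun i => f i - g i :=
  (hf.prodMk hg).comp (of_runs fun _ => .sub _)

theorem int_le (hf : PolyTime x f) (hg : PolyTime x g) : PolyTime x fun i => f i ≤ g i :=
  (hf.prodMk hg).comp <| (of_runs (y := fun i => (enc (f i, g i)).le) fun _ => .le _).congr_enc
    fun i => by by_cases h : f i ≤ g i <;> simp [enc, Datum.le, Datum.ofProp, IntCode.toInt, h]

end Arithmetic

section Logic

variable {p q : ι → Prop}

open Classical in
theorem indicator (hp : PolyTime x p) : PolyTime x fun i => if p i then (1 : ℤ) else 0 := hp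

theorem not (hp : PolyTime x p) : PolyTime x fun i => ¬p i :=
  (hp.indicator.int_le (const_int x 0)).congr_prop fun i => by by_cases h : p i <;> simp [h]

theorem and (hp : PolyTime x p) (hq : PolyTime x q) : PolyTime x fun i => p i ∧ q i :=
  ((const_int x 2).int_le (hp.indicator.add hq.indicator)).congr_prop fun i => by
    by_cases h : p i <;> by_cases h' : q i <;> simp [h, h']

theorem or (hp : PolyTime x p) (hq : PolyTime x q) : PolyTime x fun i => p i ∨ q i :=
  (hp.not.and hq.not).not.congr_prop fun _ => by tauto

theorem imp (hp : PolyTime x p) (hq : PolyTime x q) : PolyTime x fun i => p i → q i :=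
  (hp.and hq.not).not.congr_prop fun _ => by tauto

theorem iff (hp : PolyTime x p) (hq : PolyTime x q) : PolyTime x fun i => (p i ↔ q i) :=
  ((hp.imp hq).and (hq.imp hp)).congr_prop fun _ => iff_def

theorem int_lt {f g : ι → ℤ} (hf : PolyTime x f) (hg : PolyTime x g) :
    PolyTime x fun i => f i < g i :=
  (hg.int_le hf).not.congr_prop fun _ => not_le.symm

theorem eq {γ : ι → Type} [∀ i, IntCode (γ i)] {f g : ∀ i, γ i} (hf : PolyTime x f)
    (hg : PolyTime x g) : PolyTime x fun i => f i = g i :=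
  ((hf.toInt.int_le hg.toInt).and (hg.toInt.int_le hf.toInt)).congr_prop fun _ => by
    rw [← le_antisymm_iff, toInt_injective.eq_iff]

theorem cases {y : ∀ i, α i} (hp : PolyTime x p)
    (hpos : PolyTime (fun i : {i // p i} => x i.1) fun i => y i.1)
    (hneg : PolyTime (fun i : {i // ¬p i} => x i.1) fun i => y i.1) : PolyTime x y := by
  obtain ⟨P, k, hP⟩ := hp
  obtain ⟨Q, l, hQ⟩ := hpos
  obtain ⟨R, m, hR⟩ := hneg
  refine of_polyBdd (P := .ite P Q R) (((PolyBdd.size_pow x k).add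
    ((PolyBdd.size_pow x l).add (PolyBdd.size_pow x m))).add (PolyBdd.size x)) fun i => ?_
  by_cases h : p i
  · refine (Prog.RunsWithin.ite_true (hP i) ?_ (hQ ⟨i, h⟩)).mono (by
      gcongr; exact Nat.le_add_right _ _)
    exact fun h0 => enc_prop_eq_zero.1 h0 h
  · have hPi := hP i
    rw [enc_prop_eq_zero.2 h] at hPi
    exact (hPi.ite_false (hR ⟨i, h⟩)).mono (by gcongr; exact Nat.le_add_left _ _)

theorem ite {y z : ∀ i, α i} [∀ i, Decidable (p i)] (hp : PolyTime x p)
    (hy : PolyTime x y) (hz : PolyTime x z) : PolyTime x fun i => if p i then y i else z i :=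
  cases hp ((hy.restrict p).congr_enc fun i => by rw [if_pos i.2])
    ((hz.restrict fun i => ¬p i).congr_enc fun i => by rw [if_neg i.2])

theorem exists_cases {R : ∀ i, α i → Prop} (hp : PolyTime x p)
    (hpos : ∃ y : ∀ i : {i // p i}, α i.1, (∀ i, R i.1 (y i)) ∧
      PolyTime (fun i : {i // p i} => x i.1) y)
    (hneg : ∃ y : ∀ i : {i // ¬p i}, α i.1, (∀ i, R i.1 (y i)) ∧
      PolyTime (fun i : {i // ¬p i} => x i.1) y) :
    ∃ y : ∀ i, α i, (∀ i, R i (y i)) ∧ PolyTime x y := by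
  classical
  obtain ⟨y, hRy, hy⟩ := hpos
  obtain ⟨z, hRz, hz⟩ := hneg
  refine ⟨fun i => if h : p i then y ⟨i, h⟩ else z ⟨i, h⟩, fun i => ?_, cases hp ?_ ?_⟩
  · by_cases h : p i
    · simpa only [h, dite_true] using hRy ⟨i, h⟩
    · simpa only [h, dite_false] using hRz ⟨i, h⟩
  · exact hy.congr_enc fun i => by rw [dif_pos i.2]
  · exact hz.congr_enc fun i => by rw [dif_neg i.2]

end Logic

/-! ### Loops -/

theorem while_loop {s : ι → ℕ → Datum} {N : ι → ℕ} (hN : PolyBdd x N)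
    (hs : PolyBdd (fun p : Σ i, Fin (N i + 1) => x p.1) fun p => (s p.1 p.2).size)
    (hinit : PolyTime x fun i => s i 0)
    (hcond : PolyTime (fun p : Σ i, Fin (N i + 1) => s p.1 p.2) fun p => (p.2 : ℕ) < N p.1)
    (hbody : PolyTime (fun p : Σ i, Fin (N i) => s p.1 p.2) fun p => s p.1 (p.2 + 1)) :
    PolyTime x fun i => s i (N i) := by
  obtain ⟨k, hk⟩ := hs
  obtain ⟨I, l, hI⟩ := hinit
  obtain ⟨C, m, hC⟩ := hcond
  obtain ⟨P, r, hP⟩ := hbody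
  have hsize (i : ι) (j : ℕ) (hj : j ≤ N i) : (s i j).size ≤ ((x i).size + 2) ^ k :=
    hk ⟨i, j, Nat.lt_succ_of_le hj⟩
  have hS := PolyBdd.size_pow x k
  have hpow (e : ℕ) := (hS.add (PolyBdd.const x 2)).pow e
  refine of_polyBdd (P := .seq I (.while C P))
    (((PolyBdd.size_pow x l).add ((hN.add (PolyBdd.const x 1)).mul
      (((hpow m).add (hpow r)).add hS))).add (PolyBdd.const x 1)) fun i =>
    (hI i).seq (Prog.RunsWithin.while_loop (fun j hj => ?_) (fun j hj => ?_) (hsize i))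
  · exact (hC ⟨i, j, Nat.lt_succ_of_le hj⟩).mono (by gcongr; exact hsize i j hj)
  · exact (hP ⟨i, j, hj⟩).mono (by gcongr; exact hsize i j hj.le)

/-- The state after `t` elements of the list `e i` is `s i t`. -/
theorem fold {e : ι → List Datum} (he : PolyTime x fun i => Datum.ofList (e i))
    {s : ι → ℕ → Datum} (hinit : PolyTime x fun i => s i 0)
    (hs : PolyBdd (fun p : Σ i, Fin ((e i).length + 1) => x p.1) fun p => (s p.1 p.2).size)
    (hstep : PolyTime
      (fun p : Σ i, Fin (e i).length => Datum.pair (x p.1) (.pair ((e p.1)[p.2]) (s p.1 p.2)))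
      fun p => s p.1 (p.2 + 1)) :
    PolyTime x fun i => s i (e i).length := by
  let S : ι → ℕ → Datum := fun i t => .pair (x i) (.pair (.ofList ((e i).drop t)) (s i t))
  have rest {κ : Type} (σ : κ → ι) (t : κ → ℕ) :
      PolyTime (fun j => S (σ j) (t j)) fun j => Datum.ofList ((e (σ j)).drop (t j)) :=
    (id _).datum_snd.datum_fst
  refine (while_loop (s := S) (N := fun i => (e i).length) ?_ ?_ ((id x).datum_pair
    (he.datum_pair hinit)) ?_ ?_).datum_snd.datum_snd
  · exact he.polyBdd_size.mono fun i => Datum.length_le_size_ofList _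
  · let σ : (Σ i, Fin ((e i).length + 1)) → ι := Sigma.fst
    refine ((((PolyBdd.size _).add ((he.reindex σ).polyBdd_size.add hs)).add
      (PolyBdd.const _ 2))).mono fun p => ?_
    have := Datum.size_ofList_drop_le (e p.1) p.2
    simp only [S, Datum.size]
    change _ ≤ (x p.1).size + ((Datum.ofList (e p.1)).size + _) + 2
    omega
  · exact (rest Sigma.fst fun p => p.2).datum_isPair.congr_enc
      (y := fun p : Σ i, Fin ((e i).length + 1) => (p.2 : ℕ) < (e p.1).length)
      fun p => (Datum.isPair_ofList_drop (e p.1) p.2).symm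
  · have hcons (p : Σ i, Fin (e i).length) := Datum.ofList_drop p.2.2
    have head := (rest _ _).datum_fst.congr_enc
      (y := fun p : Σ i, Fin (e i).length => (e p.1)[p.2])
      fun p => (congrArg Datum.fst (hcons p)).symm
    have tail := (rest _ _).datum_snd.congr_enc
      (y := fun p : Σ i, Fin (e i).length => Datum.ofList ((e p.1).drop (p.2 + 1)))
      fun p => (congrArg Datum.snd (hcons p)).symm
    exact (id _).datum_fst.datum_pair (tail.datum_pair
      (((id _).datum_fst.datum_pair (head.datum_pair (id _).datum_snd.datum_snd)).trans hstep))

end PolyTime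

namespace PolyTime

variable {ι κ : Type} {x : ι → Datum} {α β : ι → Type} [∀ i, Enc (α i)] [∀ i, Enc (β i)]

section Lists

variable {e e' : ι → List Datum}

theorem reverse_append_ofList (he : PolyTime x fun i => Datum.ofList (e i))
    (he' : PolyTime x fun i => Datum.ofList (e' i)) :
    PolyTime x fun i => Datum.ofList ((e i).reverse ++ e' i) := by
  have loop := fold (s := fun i t => .ofList (((e i).take t).reverse ++ e' i)) he he' ?_ ?_
  · simpa only [List.take_length] using loop
  · refine ((he.polyBdd_size.add he'.polyBdd_size).reindex Sigma.fst).mono fun p => ?_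
    change _ ≤ (Datum.ofList (e p.1)).size + (Datum.ofList (e' p.1)).size
    have := (((e p.1).take_sublist p.2).map fun x => x.size + 1).sum_le_sum
      fun _ _ => Nat.zero_le _
    simp only [Datum.size_ofList, List.map_append, List.map_reverse, List.sum_append,
      List.sum_reverse]
    omega
  · refine ((id _).datum_snd.datum_fst.datum_pair (id _).datum_snd.datum_snd).congr_enc
      fun p => ?_
    change Datum.ofList (((e p.1).take (p.2 + 1)).reverse ++ e' p.1) = Datum.ofList (_ :: _)
    rw [List.take_succ_eq_append_getElem p.2.2, List.reverse_append]
    rfl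

theorem reverse_ofList (he : PolyTime x fun i => Datum.ofList (e i)) :
    PolyTime x fun i => Datum.ofList (e i).reverse := by
  simpa only [List.append_nil] using reverse_append_ofList (e' := fun _ => []) he (const_num x 0)

theorem append_ofList (he : PolyTime x fun i => Datum.ofList (e i))
    (he' : PolyTime x fun i => Datum.ofList (e' i)) :
    PolyTime x fun i => Datum.ofList (e i ++ e' i) := by
  simpa only [List.reverse_reverse] using reverse_append_ofList (reverse_ofList he) he'

theorem list_nil : PolyTime x fun i => ([] : List (α i)) := const_num x 0

theorem list_cons {a : ∀ i, α i} {l : ∀ i, List (α i)} (ha : PolyTime x a) (hl : PolyTime x l) :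
    PolyTime x fun i => a i :: l i := ha.prodMk hl

theorem list_reverse {l : ∀ i, List (α i)} (hl : PolyTime x l) :
    PolyTime x fun i => (l i).reverse :=
  (reverse_ofList (e := fun i => (l i).map enc) hl).congr_enc fun i => by
    rw [← List.map_reverse]
    rfl

end Lists

/-! ### Tables -/

/-- The programs working in the context `x` know the number `n i`, in unary: as the table of the
indices below it. -/
abbrev Index (x : ι → Datum) (n : ι → ℕ) : Prop := PolyTime x fun i => fun j : Fin (n i) => j

/-- The context `x`, extended by a variable that ranges over the indices below `n i`. -/
abbrev Ext (x : ι → Datum) (n : ι → ℕ) : (Σ i, Fin (n i)) → Datum :=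
  fun p => .pair (x p.1) (enc p.2)

section Context

variable {n : ι → ℕ} {a b : ι → Datum} {y : ∀ i, α i}

theorem of_left (h : PolyTime a y) : PolyTime (fun i => .pair (a i) (b i)) y :=
  (id _).datum_fst.trans h

theorem right (a : ι → Datum) (y : ∀ i, α i) : PolyTime (fun i => .pair (a i) (enc (y i))) y :=
  (id _).datum_snd

theorem weaken (h : PolyTime x y) (n : ι → ℕ) : PolyTime (Ext x n) fun p => y p.1 :=
  (h.reindex Sigma.fst).of_left

theorem variable_index (x : ι → Datum) (n : ι → ℕ) : PolyTime (Ext x n) fun p => p.2 :=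
  right _ _

end Context

theorem Index.polyBdd {n : ι → ℕ} (hn : Index x n) : PolyBdd x n :=
  hn.polyBdd_size.mono fun i =>
    (List.length_ofFn (f := fun j : Fin (n i) => enc j)).symm.le.trans
      (Datum.length_le_size_ofList _)

theorem Index.polyBdd_ext {n : ι → ℕ} (hn : Index x n) {f : (Σ i, Fin (n i)) → ℕ}
    (hf : PolyBdd (Ext x n) f) : PolyBdd (fun q : Σ i, Fin (n i) => x q.1) f := by
  refine hf.comp (((((PolyBdd.size x).add hn.polyBdd_size).add (PolyBdd.const x 1)).reindex
    Sigma.fst).mono fun q => ?_)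
  have := size_enc_apply_le (fun j : Fin (n q.1) => j) q.2
  simp only [Datum.size]
  omega

theorem index_length {e : ι → List Datum} (he : PolyTime x fun i => Datum.ofList (e i)) :
    Index x fun i => (e i).length := by
  let r : ℕ → List Datum := fun t => (List.range t).map fun j : ℕ => Datum.num (j : ℤ)
  let s : ι → ℕ → Datum := fun _ t => .pair (.num t) (.ofList (r t).reverse)
  have hlen : PolyBdd x fun i => (e i).length :=
    he.polyBdd_size.mono fun i => Datum.length_le_size_ofList _
  have loop := fold (s := s) he ((const_num x 0).datum_pair (const_num x 0)) ?_ ?_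
  · refine (reverse_ofList (e := fun i => (r (e i).length).reverse)
      loop.datum_snd).congr_enc fun i => ?_
    rw [List.reverse_reverse]
    refine congrArg Datum.ofList (List.ext_getElem (by simp [r]) fun t _ _ => ?_)
    simp only [r, List.getElem_ofFn, List.getElem_map, List.getElem_range]
    rfl
  · refine ((((hlen.mul (hlen.add (PolyBdd.const x 3))).add hlen).add
      (PolyBdd.const x 4)).reindex Sigma.fst).mono fun p => ?_
    have hp : (p.2 : ℕ) ≤ (e p.1).length := Nat.lt_succ_iff.1 p.2.2
    have counter := Datum.size_num_natCast_le p.2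
    have entries := Datum.size_ofList_le (l := (r p.2).reverse) (B := p.2 + 2) fun d hd => by
      obtain ⟨j, hj, rfl⟩ := List.mem_map.1 (List.mem_reverse.1 hd)
      exact (Datum.size_num_natCast_le j).trans (by have := List.mem_range.1 hj; omega)
    have : (r p.2).reverse.length * ((p.2 : ℕ) + 2 + 1) ≤
        (e p.1).length * ((e p.1).length + 3) :=
      Nat.mul_le_mul (by simpa [r] using hp) (by omega)
    change (Datum.num (p.2 : ℕ)).size + (Datum.ofList (r p.2).reverse).size + 1 ≤ _
    omega
  · have ht : PolyTime (fun p : Σ i, Fin (e i).length =>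
        Datum.pair (x p.1) (.pair ((e p.1)[p.2]) (s p.1 p.2))) fun p => ((p.2 : ℕ) : ℤ) :=
      (id _).datum_snd.datum_snd.datum_fst
    refine ((ht.add (const_int _ 1)).prodMk
      (ht.datum_pair (id _).datum_snd.datum_snd.datum_snd)).congr_enc fun p => ?_
    change Datum.pair _ (Datum.ofList (r (p.2 + 1)).reverse) =
      Datum.pair (.num (p.2 + 1)) (Datum.ofList (Datum.num (p.2 : ℕ) :: (r p.2).reverse))
    simp [r, List.range_succ]

theorem index {n : ι → ℕ} {f : ∀ i, Fin (n i) → α i} (hf : PolyTime x f) : Index x n := by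
  simpa only [List.length_ofFn] using
    index_length (e := fun i => List.ofFn fun j => enc (f i j)) hf

section Table

variable {n : ι → ℕ} {p : ∀ i, Fin (n i) → Prop}

/-- The state after `t` indices is `s i t`. -/
theorem fold_index (hn : Index x n) {s : ∀ i, ℕ → α i}
    (hinit : PolyTime x fun i => s i 0)
    (hs : PolyBdd (fun p : Σ i, Fin (n i + 1) => x p.1) fun p => (enc (s p.1 p.2)).size)
    (hstep : PolyTime (fun q : Σ i, Fin (n i) => .pair (Ext x n q) (enc (s q.1 q.2)))
      fun q => s q.1 (q.2 + 1)) :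
    PolyTime x fun i => s i (n i) := by
  let e : ι → List Datum := fun i => List.ofFn fun j : Fin (n i) => enc j
  have hlen (i : ι) : (e i).length = n i := List.length_ofFn
  have loop := fold (e := e) (s := fun i t => enc (s i t)) hn hinit ?_ ?_
  · exact loop.congr_enc fun i => by rw [hlen]; rfl
  · exact hs.reindex fun p : Σ i, Fin ((e i).length + 1) =>
      (⟨p.1, p.2.cast (by rw [hlen])⟩ : Σ i, Fin (n i + 1))
  · let σ : (Σ i, Fin (e i).length) → Σ i, Fin (n i) := fun q => ⟨q.1, q.2.cast (hlen q.1)⟩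
    refine trans ((((id _).datum_fst.datum_pair (id _).datum_snd.datum_fst).datum_pair
      (id _).datum_snd.datum_snd).congr_enc fun q => ?_)
      ((hstep.reindex σ).congr_enc (y := fun q => enc (s q.1 (q.2 + 1))) fun _ => rfl)
    change Datum.pair (.pair _ _) _ = Datum.pair (.pair (x q.1) ((e q.1)[q.2])) (enc (s q.1 q.2))
    simp only [e, Fin.getElem_fin, List.getElem_ofFn]
    rfl

theorem filter_map (hn : Index x n) [∀ i, DecidablePred (p i)]
    (hp : PolyTime (Ext x n) fun q => p q.1 q.2)
    {f : ∀ i, Fin (n i) → α i} (hf : PolyTime (Ext x n) fun q => f q.1 q.2) :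
    PolyTime x fun i => ((List.finRange (n i)).filter (p i)).map (f i) := by
  let s : ∀ i, ℕ → List (α i) := fun i t =>
    ((((List.finRange (n i)).take t).filter (p i)).map (f i)).reverse
  have loop := fold_index hn (s := s) list_nil ?_ ?_
  · refine (list_reverse loop).congr_enc fun i => ?_
    rw [List.reverse_reverse, List.take_of_length_le (List.length_finRange.le)]
  · obtain ⟨k, hk⟩ := hn.polyBdd_ext hf.polyBdd_size
    refine (((hn.polyBdd.mul ((PolyBdd.size_pow x k).add (PolyBdd.const x 1))).add
      (PolyBdd.const x 1)).reindex Sigma.fst).mono fun q => ?_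
    have hlen : (s q.1 q.2).length ≤ n q.1 := by
      rw [List.length_reverse, List.length_map]
      exact (List.length_filter_le _ _).trans
        ((List.length_take_le' _ _).trans List.length_finRange.le)
    refine (Datum.size_ofList_le (B := ((x q.1).size + 2) ^ k) fun d hd => ?_).trans
      (by rw [List.length_map]; gcongr)
    obtain ⟨a, ha, rfl⟩ := List.mem_map.1 hd
    obtain ⟨j, -, rfl⟩ := List.mem_map.1 (List.mem_reverse.1 ha)
    exact hk ⟨q.1, j⟩
  · refine (ite hp.of_left (list_cons hf.of_left (right _ _)) (right _ _)).congr_enc fun q => ?_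
    have hq : (q.2 : ℕ) < (List.finRange (n q.1)).length := by simp
    simp only [s]
    rw [List.take_succ_eq_append_getElem hq, List.filter_append, List.map_append,
      List.reverse_append, List.getElem_finRange]
    by_cases h : p q.1 q.2
    · simp [h]
    · simp [h]

theorem table (hn : Index x n) {f : ∀ i, Fin (n i) → α i}
    (hf : PolyTime (Ext x n) fun q => f q.1 q.2) : PolyTime x f := by
  refine (filter_map hn (p := fun _ _ => True) (const_prop _ True) hf).congr_enc fun i => ?_
  simp [enc, Datum.ofTable, List.ofFn_eq_map, Function.comp_def]

theorem apply {f : ∀ i, Fin (n i) → α i} {j : ∀ i, Fin (n i)} (hf : PolyTime x f)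
    (hj : PolyTime x j) : PolyTime x fun i => f i (j i) := by
  let e : ι → List Datum := fun i => List.ofFn fun j => enc (f i j)
  have hlen (i : ι) : (e i).length = n i := List.length_ofFn
  let s : ι → ℕ → Datum := fun i t => .ofList ((e i).drop (min t (j i)))
  have loop := fold_index (α := fun _ => Datum) hf.index (s := s) hf ?_ ?_
  · refine loop.datum_fst.congr_enc fun i => ?_
    simp only [s, min_eq_right (j i).2.le]
    rw [Datum.ofList_drop ((j i).2.trans_eq (hlen i).symm)]
    simp [e, enc, Datum.fst]
  · exact (hf.polyBdd_size.reindex Sigma.fst).mono fun q => Datum.size_ofList_drop_le _ _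
  · have index_lt : PolyTime (fun q : Σ i, Fin (n i) => .pair (Ext x n q) (enc (s q.1 q.2)))
        fun q => ((q.2 : ℕ) : ℤ) < ((j q.1 : ℕ) : ℤ) :=
      int_lt (variable_index x n).of_left.fin_val (hj.weaken n).of_left.fin_val
    classical
    refine (index_lt.ite (right _ _).datum_snd (right _ _)).congr_enc fun q => ?_
    by_cases h : (q.2 : ℕ) < j q.1
    · have hq : (q.2 : ℕ) < (e q.1).length := q.2.2.trans_eq (hlen q.1).symm
      simp only [s, Nat.cast_lt, h, if_true, min_eq_left h.le, min_eq_left (Nat.succ_le_of_lt h),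
        Datum.ofList_drop hq]
      rfl
    · have hle := not_lt.1 h
      simp only [s, Nat.cast_lt, h, if_false, min_eq_right hle,
        min_eq_right (hle.trans (Nat.le_succ _))]

theorem uncurry {f : ∀ i, Fin (n i) → α i} (hf : PolyTime x f) :
    PolyTime (Ext x n) fun q => f q.1 q.2 :=
  (hf.weaken n).apply (variable_index x n)

theorem sum (hn : Index x n) {f : ∀ i, Fin (n i) → ℤ}
    (hf : PolyTime (Ext x n) fun q => f q.1 q.2) : PolyTime x fun i => ∑ j, f i j := by
  refine (fold_index hn
    (s := fun i t => ∑ j : Fin (n i), if (j : ℕ) < t then f i j else 0)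
    ((const_int x 0).congr_enc fun i => by simp) ?_ ?_).congr_enc fun i => by simp
  · obtain ⟨k, hk⟩ := hn.polyBdd_ext hf.polyBdd_size
    refine (((hn.polyBdd.add (PolyBdd.size_pow x k)).add (PolyBdd.const x 2)).reindex
      Sigma.fst).mono fun q => Datum.size_num_le ?_
    calc Int.natAbs (∑ j : Fin (n q.1), if (j : ℕ) < q.2 then f q.1 j else 0)
        ≤ ∑ j : Fin (n q.1), (if (j : ℕ) < q.2 then f q.1 j else 0).natAbs :=
          Int.natAbs_sum_le _ _
      _ ≤ ∑ _j : Fin (n q.1), 2 ^ ((x q.1).size + 2) ^ k := by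
          gcongr with j
          split_ifs
          · exact (Datum.natAbs_lt_two_pow_size _).le.trans
              (Nat.pow_le_pow_right two_pos (hk ⟨q.1, j⟩))
          · simp
      _ = n q.1 * 2 ^ ((x q.1).size + 2) ^ k := by simp
      _ ≤ 2 ^ n q.1 * 2 ^ ((x q.1).size + 2) ^ k := by gcongr; exact Nat.lt_two_pow_self.le
      _ = 2 ^ (n q.1 + ((x q.1).size + 2) ^ k) := (pow_add _ _ _).symm
  · refine ((right _ _).add hf.of_left).congr_enc fun q => congrArg enc ?_
    rw [show f q.1 q.2 = ∑ j, if j = q.2 then f q.1 j else 0 by simp, ← Finset.sum_add_distrib]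
    refine Finset.sum_congr rfl fun j _ => ?_
    rcases lt_trichotomy (j : ℕ) q.2 with h | h | h
    · rw [if_pos (by omega), if_pos h, if_neg (by omega), add_zero]
    · rw [if_pos (by omega), if_neg (by omega), if_pos (by omega), zero_add]
    · rw [if_neg (by omega), if_neg (by omega), if_neg (by omega), add_zero]

theorem exists_index (hn : Index x n) (hp : PolyTime (Ext x n) fun q => p q.1 q.2) :
    PolyTime x fun i => ∃ j, p i j := by
  classical
  have hl := filter_map hn hp (f := fun _ j => j) (variable_index x n)
  refine (hl.datum_isPair (y := fun i => enc (_ : List (Fin (n i))))).congr_enc fun i => ?_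
  rcases hfilter : (List.finRange (n i)).filter (p i) with _ | ⟨j, l⟩
  · have hnot : ¬∃ j, p i j := fun ⟨j, hj⟩ => by
      simpa using List.filter_eq_nil_iff.1 hfilter j (List.mem_finRange j) (decide_eq_true hj)
    rw [hfilter]
    exact enc_prop_eq_zero.2 hnot
  · have hj : j ∈ (List.finRange (n i)).filter (p i) := hfilter ▸ List.mem_cons_self
    rw [hfilter]
    exact enc_prop_of (p := ∃ j, p i j) ⟨j, of_decide_eq_true (List.mem_filter.1 hj).2⟩

theorem forall_index (hn : Index x n) (hp : PolyTime (Ext x n) fun q => p q.1 q.2) :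
    PolyTime x fun i => ∀ j, p i j :=
  (exists_index hn (p := fun i j => ¬p i j) hp.not).not.congr_prop fun _ => not_exists_not.symm

theorem exists_find (hn : Index x n) (hp : PolyTime (Ext x n) fun q => p q.1 q.2)
    (hex : ∀ i, ∃ j, p i j) : ∃ j : ∀ i, Fin (n i), (∀ i, p i (j i)) ∧ PolyTime x j := by
  classical
  let l (i : ι) := (List.finRange (n i)).filter (p i)
  have hne (i : ι) : l i ≠ [] :=
    (hex i).elim fun j hj => List.ne_nil_of_mem (List.mem_filter.2 ⟨List.mem_finRange j, by simpa⟩)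
  have hl := filter_map hn hp (f := fun _ j => j) (variable_index x n)
  refine ⟨fun i => (l i).head (hne i), fun i => ?_,
    (hl.datum_fst (y := fun i => enc (_ : List (Fin (n i))))).congr_enc fun i => ?_⟩
  · exact of_decide_eq_true (List.mem_filter.1 (List.head_mem (hne i))).2
  · obtain ⟨j, t, h⟩ := List.exists_cons_of_ne_nil (hne i)
    simp only [h, List.head_cons]
    change enc j = (enc ((l i).map fun j => j)).fst
    rw [h]
    rfl

theorem of_graph {y : ∀ i, Fin (n i)} (hn : Index x n)
    (hy : PolyTime (Ext x n) fun q => y q.1 = q.2) : PolyTime x y := by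
  obtain ⟨j, hj, hjP⟩ := exists_find hn hy fun i => ⟨y i, rfl⟩
  rwa [funext hj]

end Table

theorem fin_append {n m : ι → ℕ} {f : ∀ i, Fin (n i) → α i} {g : ∀ i, Fin (m i) → α i}
    (hf : PolyTime x f) (hg : PolyTime x g) : PolyTime x fun i => Fin.append (f i) (g i) :=
  (append_ofList (e := fun i => List.ofFn fun j => enc (f i j))
    (e' := fun i => List.ofFn fun j => enc (g i j)) hf hg).congr_enc fun i => by
      change Datum.ofList (List.ofFn fun j => enc (Fin.append (f i) (g i) j)) = Datum.ofList _
      rw [← List.ofFn_fin_append]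
      refine congrArg (fun h => Datum.ofList (List.ofFn h)) (funext fun j => ?_)
      refine Fin.addCases (fun j => ?_) (fun j => ?_) j <;>
        simp only [Fin.append_left, Fin.append_right]

theorem option_none (n : ι → ℕ) : PolyTime x fun i => (none : Option (Fin (n i))) :=
  (const_num x (-1)).congr_enc fun _ => rfl

theorem option_some {n : ι → ℕ} {j : ∀ i, Fin (n i)} (hj : PolyTime x j) :
    PolyTime x fun i => some (j i) := hj

/-! ### Loops with an invariant -/

/-- A step of a loop: its number `t` and a state `s` that satisfies the invariant. -/
structure LoopState (n : ι → ℕ) (Inv : ∀ i, ℕ → α i → Prop) where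
  i : ι
  t : Fin (n i)
  s : α i
  inv : Inv i t s

/-- The context in which the body of a loop works: the context of the loop, the number of the step
and the state. -/
abbrev LoopState.data (x : ι → Datum) {n : ι → ℕ} {Inv : ∀ i, ℕ → α i → Prop}
    (q : LoopState n Inv) : Datum := .pair (Ext x n ⟨q.i, q.t⟩) (enc q.s)

section Loop

variable {n : ι → ℕ} {Inv : ∀ i, ℕ → α i → Prop}

/-- The invariant also bounds the size of the state, without which a loop of polynomially many
steps need not run in polynomial time. -/
theorem exists_loop (hn : Index x n) (Inv : ∀ i, ℕ → α i → Prop) {s₀ : ∀ i, α i}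
    (hs₀ : PolyTime x s₀) (hInit : ∀ i, Inv i 0 (s₀ i)) {B : ι → ℕ} (hB : PolyBdd x B)
    (hsize : ∀ i t s, t ≤ n i → Inv i t s → (enc s).size ≤ B i)
    (hstep : ∃ s' : ∀ q : LoopState n Inv, α q.i,
      (∀ q, Inv q.i (q.t + 1) (s' q)) ∧ PolyTime (LoopState.data x) s') :
    ∃ s : ∀ i, α i, (∀ i, Inv i (n i) (s i)) ∧ PolyTime x s := by
  classical
  obtain ⟨s', hs', hP⟩ := hstep
  let S : ∀ i, ℕ → α i := fun i t => Nat.rec (s₀ i)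
    (fun t r => if h : ∃ _ : t < n i, Inv i t r then s' ⟨i, ⟨t, h.1⟩, r, h.2⟩ else r) t
  have hS (i t) (ht : t < n i) (h : Inv i t (S i t)) : S i (t + 1) = s' ⟨i, ⟨t, ht⟩, S i t, h⟩ :=
    dif_pos ⟨ht, h⟩
  have hInv : ∀ i t, t ≤ n i → Inv i t (S i t) := by
    intro i t
    induction t with
    | zero => exact fun _ => hInit i
    | succ t ih =>
      intro ht
      rw [hS i t ht (ih (Nat.le_of_succ_le ht))]
      exact hs' ⟨i, ⟨t, ht⟩, S i t, _⟩
  refine ⟨fun i => S i (n i), fun i => hInv i _ le_rfl, fold_index hn hs₀ ?_ ?_⟩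
  · exact (hB.reindex Sigma.fst).mono fun p =>
      hsize p.1 p.2 _ (Nat.lt_succ_iff.1 p.2.2) (hInv p.1 p.2 (Nat.lt_succ_iff.1 p.2.2))
  · exact (hP.reindex fun q : Σ i, Fin (n i) =>
      (⟨q.1, q.2, S q.1 q.2, hInv q.1 q.2 q.2.2.le⟩ : LoopState n Inv)).congr_enc fun q =>
        congrArg enc (hS _ _ _ _)

theorem loop_polyBdd {f : ι → ℕ} (hf : PolyBdd x f) :
    PolyBdd (LoopState.data x : LoopState n Inv → Datum) fun q => f q.i :=
  (hf.reindex fun q : LoopState n Inv => q.i).comp ((id _).datum_fst.datum_fst).polyBdd_size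

theorem loop_context {y : ∀ i, β i} (hy : PolyTime x y) :
    PolyTime (LoopState.data x : LoopState n Inv → Datum) fun q => y q.i :=
  ((hy.weaken n).reindex fun q : LoopState n Inv => (⟨q.i, q.t⟩ : Σ i, Fin (n i))).of_left

theorem loop_index : PolyTime (LoopState.data x : LoopState n Inv → Datum) fun q => q.t :=
  ((variable_index x n).reindex
    fun q : LoopState n Inv => (⟨q.i, q.t⟩ : Σ i, Fin (n i))).of_left

theorem loop_state : PolyTime (LoopState.data x : LoopState n Inv → Datum) fun q => q.s :=
  right _ _

end Loop

end PolyTime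

/-! ### The Hungarian method -/

section Hungarian

variable {I J K : Type*}

/-- The matching obtained from `a` by moving the column `j` from the row `i'` to the row `i`. -/
def reroute [DecidableEq I] (a : I → Option J) (i i' : I) (j : J) : I → Option J :=
  Function.update (Function.update a i (some j)) i' none

theorem reroute_apply [DecidableEq I] (a : I → Option J) (i i' : I) (j : J) (k : I) :
    reroute a i i' j k = if k = i' then none else if k = i then some j else a k := by
  rw [reroute, Function.update_apply, Function.update_apply]

/-- The data of a search for an augmenting path: potentials `u` and `v`, the rows in `S` and the
columns in `T` reached by an alternating path from the root, and for each reached row `k` the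
matching `H k` obtained by shifting along the path to `k`, which leaves `k` unmatched. -/
structure SearchState (I J K : Type*) where
  u : I → K
  v : J → K
  S : I → Prop
  T : J → Prop
  H : I → I → Option J

namespace SearchState

/-- The search state that has reached only the unmatched row `r`. -/
def init (u : I → K) (v : J → K) (a : I → Option J) (r : I) : SearchState I J K where
  u := u
  v := v
  S k := k = r
  T _ := False
  H _ := a

variable (s : SearchState I J K)

/-- The tree grown by the tight edge from the row `i` to the column `j`, which is matched to the row
`i'`. -/
def grow [DecidableEq I] (i i' : I) (j : J) : SearchState I J K where
  u := s.u
  v := s.v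
  S k := s.S k ∨ k = i'
  T l := s.T l ∨ l = j
  H := Function.update s.H i' (reroute (s.H i) i i' j)

theorem ncard_grow [Finite I] [DecidableEq I] {i i' : I} {j : J}
    (hi' : ¬s.S i') : {k | (s.grow i i' j).S k}.ncard = {k | s.S k}.ncard + 1 := by
  rw [← Set.ncard_insert_of_notMem (s := {k | s.S k}) hi']
  congr 1
  ext k
  exact or_comm

end SearchState

variable [AddCommGroup K] [LinearOrder K]

/-- A partial matching `a` of rows to columns, each pair of which is tight for the potentials `u`
and `v`. The conditions on `u` and `v` are dual feasibility and complementary slackness for the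
assignment problem with cost `c` in which all rows, but not all columns, have to be matched. -/
structure PartialAssignment (c : I → J → K) (u : I → K) (v : J → K) (a : I → Option J) :
    Prop where
  feasible : ∀ i j, u i + v j ≤ c i j
  nonpos : ∀ j, v j ≤ 0
  support : ∀ j, v j < 0 → ∃ i, a i = some j
  inj : ∀ i i' j, a i = some j → a i' = some j → i = i'
  tight : ∀ i j, a i = some j → u i + v j = c i j

namespace PartialAssignment

variable {c : I → J → K} {u : I → K} {v : J → K} {a : I → Option J}

theorem extend [DecidableEq I] (h : PartialAssignment c u v a) {i : I} {j : J} (hi : a i = none)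
    (hij : u i + v j = c i j) (hj : ∀ i', a i' ≠ some j) :
    PartialAssignment c u v (Function.update a i (some j)) where
  feasible := h.feasible
  nonpos := h.nonpos
  support j' hj' := by
    obtain ⟨i', hi'⟩ := h.support j' hj'
    exact ⟨i', by grind [Function.update_apply]⟩
  inj k k' j' := by
    have := h.inj k k' j'
    grind [Function.update_apply]
  tight k j' := by
    have := h.tight k j'
    grind [Function.update_apply]

theorem exists_reroute_eq_some_iff [DecidableEq I] (h : PartialAssignment c u v a) {i i' : I}
    {j : J} (hi : a i = none) (hi' : a i' = some j) (j' : J) :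
    (∃ k, reroute a i i' j k = some j') ↔ ∃ k, a k = some j' := by
  constructor
  · rintro ⟨k, hk⟩
    grind [reroute_apply]
  · rintro ⟨k, hk⟩
    have := h.inj k i' j
    by_cases hj : j' = j
    · exact ⟨i, by grind [reroute_apply]⟩
    · exact ⟨k, by grind [reroute_apply]⟩

theorem reroute [DecidableEq I] (h : PartialAssignment c u v a) {i i' : I} {j : J}
    (hi : a i = none) (hij : u i + v j = c i j) (hi' : a i' = some j) :
    PartialAssignment c u v (reroute a i i' j) where
  feasible := h.feasible
  nonpos := h.nonpos
  support j' hj' := (h.exists_reroute_eq_some_iff hi hi' j').2 (h.support j' hj')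
  inj k k' j' := by
    have := h.inj k k' j'
    have := h.inj k i' j
    have := h.inj k' i' j
    grind [reroute_apply]
  tight k j' := by
    have := h.tight k j'
    grind [reroute_apply]

theorem sum_le [IsOrderedAddMonoid K] [Fintype I] {π : I → J}
    (h : PartialAssignment c u v fun i => some (π i)) {π' : I → J}
    (hπ' : Function.Injective π') : ∑ i, c i (π i) ≤ ∑ i, c i (π' i) := by
  classical
  have hπ : Function.Injective π := fun i i' hii => h.inj i i' (π i') (congrArg some hii) rfl
  have hv : ∑ i, v (π i) ≤ ∑ i, v (π' i) := by
    rw [← Finset.sum_image (f := v) (g := π) hπ.injOn,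
      ← Finset.sum_image (f := v) (g := π') hπ'.injOn]
    calc ∑ j ∈ Finset.univ.image π, v j = ∑ j ∈ Finset.univ.image π ∪ Finset.univ.image π', v j :=
          Finset.sum_subset Finset.subset_union_left fun j _ hj => by
            refine (h.nonpos j).antisymm (not_lt.1 fun hlt => hj ?_)
            obtain ⟨i, hi⟩ := h.support j hlt
            exact Finset.mem_image.2 ⟨i, Finset.mem_univ _, Option.some.inj hi⟩
      _ ≤ ∑ j ∈ Finset.univ.image π', v j :=
          Finset.sum_le_sum_of_subset_of_nonpos' Finset.subset_union_right fun j _ _ => h.nonpos j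
  calc ∑ i, c i (π i) = ∑ i, u i + ∑ i, v (π i) := by
        rw [← Finset.sum_add_distrib]
        exact Finset.sum_congr rfl fun i _ => (h.tight i (π i) rfl).symm
    _ ≤ ∑ i, u i + ∑ i, v (π' i) := by gcongr
    _ = ∑ i, (u i + v (π' i)) := Finset.sum_add_distrib.symm
    _ ≤ ∑ i, c i (π' i) := Finset.sum_le_sum fun i _ => h.feasible i (π' i)

end PartialAssignment

namespace SearchState

/-- The matching `b` is obtained from the partial assignment `a` by shifting along an alternating
path in `s` from the unmatched row `r` to the row `k`. -/
structure IsShifted (c : I → J → K) (a : I → Option J) (r : I) (s : SearchState I J K) (k : I)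
    (b : I → Option J) : Prop where
  assignment : PartialAssignment c s.u s.v b
  eq_none : ∀ i, b i = none ↔ i = k ∨ (a i = none ∧ i ≠ r)
  image : ∀ j, (∃ i, b i = some j) ↔ ∃ i, a i = some j
  closed : ∀ i j, b i = some j → (s.S i ↔ s.T j)
  agree : ∀ i, ¬s.S i → b i = a i

/-- The search state `s` is a tree of tight alternating paths with root `r`, an unmatched row of the
partial assignment `a`. -/
structure IsAlternatingTree (c : I → J → K) (a : I → Option J) (r : I) (s : SearchState I J K) :
    Prop where
  root_eq_none : a r = none
  root_mem : s.S r
  eq_root : ∀ k, s.S k → a k = none → k = r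
  isShifted : ∀ k, s.S k → s.IsShifted c a r k (s.H k)
  covered : ∀ j, s.T j → ∃ i, a i = some j

variable {c : I → J → K} {a : I → Option J} {r : I}

theorem isAlternatingTree_init {u : I → K} {v : J → K} (h : PartialAssignment c u v a)
    (hr : a r = none) : (init u v a r).IsAlternatingTree c a r where
  root_eq_none := hr
  root_mem := rfl
  eq_root k hk _ := hk
  isShifted := by
    rintro k rfl
    refine ⟨h, fun i => ?_, fun _ => Iff.rfl, fun i j hij => ?_, fun _ _ => rfl⟩
    · simp only [init]
      grind
    · simp only [init, iff_false]
      rintro rfl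
      exact Option.some_ne_none j (hij.symm.trans hr)
  covered _ hj := hj.elim

variable (s : SearchState I J K)

/-- The reduced cost of the edge between the row `i` and the column `j`. -/
def slack (c : I → J → K) (i : I) (j : J) : K := c i j - s.u i - s.v j

/-- The edge between the row `i` and the column `j` leaves the tree, with least reduced cost. -/
def IsMinSlack (c : I → J → K) (i : I) (j : J) : Prop :=
  s.S i ∧ ¬s.T j ∧ ∀ i' j', s.S i' → ¬s.T j' → s.slack c i j ≤ s.slack c i' j'

open Classical in
/-- The dual change by `δ`: it lowers the reduced cost of the edges that leave the tree by `δ`, and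
preserves that of the edges in the tree. -/
noncomputable def shift (δ : K) : SearchState I J K where
  u i := if s.S i then s.u i + δ else s.u i
  v j := if s.T j then s.v j - δ else s.v j
  S := s.S
  T := s.T
  H := s.H

/-- The tight edge between the row `i` and the unmatched column `j` completes an augmenting path. -/
def Augments (c : I → J → K) (i : I) (j : J) : Prop :=
  s.S i ∧ s.u i + s.v j = c i j ∧ ∀ k, s.H i k ≠ some j

namespace IsShifted

variable {s} {k : I} {b : I → Option J} (h : s.IsShifted c a r k b)
include h

theorem apply_eq_none : b k = none := (h.eq_none k).2 (.inl rfl)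

theorem grow [DecidableEq I] {i i' : I} {j : J} (ha : a i' = some j) (hi' : ¬s.S i') :
    (s.grow i i' j).IsShifted c a r k b where
  assignment := h.assignment
  eq_none := h.eq_none
  image := h.image
  closed l j' hl := by
    have hb : b i' = some j := (h.agree i' hi').trans ha
    have := h.closed l j' hl
    have := h.assignment.inj l i' j
    simp only [SearchState.grow]
    grind
  agree l hl := h.agree l fun hl' => hl (.inl hl')

theorem reroute [DecidableEq I] {i' : I} {j : J} (hk : s.S k)
    (hroot : a k = none → k = r) (hkj : s.u k + s.v j = c k j) (hb : b i' = some j) :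
    (s.grow k i' j).IsShifted c a r i' (reroute b k i' j) where
  assignment := h.assignment.reroute h.apply_eq_none hkj hb
  eq_none l := by
    have := h.eq_none l
    grind [reroute_apply]
  image l := (h.assignment.exists_reroute_eq_some_iff h.apply_eq_none hb l).trans
    (h.image l)
  closed l j' hl := by
    have := h.closed l j'
    have := h.assignment.inj l i' j
    simp only [SearchState.grow]
    grind [reroute_apply]
  agree l hl := by
    simp only [SearchState.grow] at hl
    have := h.agree l
    grind [reroute_apply]

theorem assignment_shift [IsOrderedAddMonoid K] {δ : K} (hcov : ∀ j, s.T j → ∃ i, a i = some j)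
    (hδ : 0 ≤ δ) (hmin : ∀ i j, s.S i → ¬s.T j → δ ≤ s.slack c i j) :
    PartialAssignment c (s.shift δ).u (s.shift δ).v b where
  feasible i j := by
    have := h.assignment.feasible i j
    have := hmin i j
    simp only [shift, slack] at *
    grind
  nonpos j := by
    have := h.assignment.nonpos j
    simp only [shift]
    grind
  support j hj := by
    by_cases hT : s.T j
    · exact (h.image j).2 (hcov j hT)
    · exact h.assignment.support j (by simpa only [shift, hT, if_false] using hj)
  inj := h.assignment.inj
  tight i j hij := by
    have := h.assignment.tight i j hij
    have := h.closed i j hij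
    simp only [shift]
    grind

end IsShifted

namespace IsAlternatingTree

variable {s} (h : s.IsAlternatingTree c a r)
include h

theorem exists_not_mem [Fintype I] [Fintype J] (hIJ : Fintype.card I ≤ Fintype.card J) :
    ∃ j, ¬s.T j := by
  by_contra! hT
  choose f hf using fun j => h.covered j (hT j)
  have hinj : Function.Injective f := fun j j' hjj =>
    Option.some.inj ((hf j).symm.trans (hjj ▸ hf j'))
  have hcard := hIJ.antisymm (Fintype.card_le_of_injective f hinj)
  obtain ⟨j, rfl⟩ := ((Fintype.bijective_iff_injective_and_card f).2 ⟨hinj, hcard.symm⟩).2 r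
  exact Option.some_ne_none j ((hf j).symm.trans h.root_eq_none)

theorem exists_isMinSlack [Fintype I] [Fintype J] (hIJ : Fintype.card I ≤ Fintype.card J) :
    ∃ i j, s.IsMinSlack c i j := by
  classical
  obtain ⟨j₀, hj₀⟩ := h.exists_not_mem hIJ
  obtain ⟨⟨i, j⟩, hij, hmin⟩ := Finset.exists_min_image
    (Finset.univ.filter fun p : I × J => s.S p.1 ∧ ¬s.T p.2) (fun p => s.slack c p.1 p.2)
    ⟨(r, j₀), by simpa using ⟨h.root_mem, hj₀⟩⟩
  simp only [Finset.mem_filter, Finset.mem_univ, true_and] at hij hmin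
  exact ⟨i, j, hij.1, hij.2, fun i' j' hi' hj' => hmin (i', j') ⟨hi', hj'⟩⟩

theorem augment [DecidableEq I] {i : I} {j : J} (hij : s.Augments c i j) :
    PartialAssignment c s.u s.v (Function.update (s.H i) i (some j)) ∧
      ∀ k, Function.update (s.H i) i (some j) k = none ↔ a k = none ∧ k ≠ r := by
  obtain ⟨hi, htight, hfree⟩ := hij
  have hHi := h.isShifted i hi
  refine ⟨hHi.assignment.extend hHi.apply_eq_none htight hfree, fun k => ?_⟩
  have := hHi.eq_none k
  have := h.eq_root i hi
  grind [Function.update_apply]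

theorem not_mem_of_eq_some {i i' : I} {j : J} (hi : s.S i) (hT : ¬s.T j)
    (hi' : s.H i i' = some j) : ¬s.S i' := fun hS =>
  hT (((h.isShifted i hi).closed i' j hi').1 hS)

theorem grow [DecidableEq I] {i i' : I} {j : J} (hi : s.S i) (hT : ¬s.T j)
    (hij : s.u i + s.v j = c i j) (hi' : s.H i i' = some j) :
    (s.grow i i' j).IsAlternatingTree c a r := by
  have hHi := h.isShifted i hi
  have hS : ¬s.S i' := h.not_mem_of_eq_some hi hT hi'
  have ha : a i' = some j := (hHi.agree i' hS).symm.trans hi'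
  refine ⟨h.root_eq_none, .inl h.root_mem, ?_, ?_, ?_⟩
  · rintro k (hk | rfl) hak
    · exact h.eq_root k hk hak
    · exact absurd (ha.symm.trans hak) (Option.some_ne_none j)
  · intro k hk
    by_cases hki : k = i'
    · subst hki
      simpa only [SearchState.grow, Function.update_self] using
        hHi.reroute hi (h.eq_root i hi) hij hi'
    · simpa only [SearchState.grow, Function.update_of_ne hki] using
        (h.isShifted k (hk.resolve_right hki)).grow ha hS
  · rintro l (hl | rfl)
    · exact h.covered l hl
    · exact ⟨i', ha⟩

variable [IsOrderedAddMonoid K]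

theorem shift {δ : K} (hδ : 0 ≤ δ) (hmin : ∀ i j, s.S i → ¬s.T j → δ ≤ s.slack c i j) :
    (s.shift δ).IsAlternatingTree c a r where
  root_eq_none := h.root_eq_none
  root_mem := h.root_mem
  eq_root := h.eq_root
  isShifted k hk :=
    let hHk := h.isShifted k hk
    ⟨hHk.assignment_shift h.covered hδ hmin, hHk.eq_none, hHk.image, hHk.closed, hHk.agree⟩
  covered := h.covered

theorem shift_slack {i : I} {j : J} (hij : s.IsMinSlack c i j) :
    (s.shift (s.slack c i j)).IsAlternatingTree c a r :=
  h.shift (sub_nonneg.2 (le_sub_iff_add_le'.2 ((h.isShifted i hij.1).assignment.feasible i j)))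
    hij.2.2

end IsAlternatingTree

theorem IsMinSlack.tight_shift {s : SearchState I J K} {i : I} {j : J} (h : s.IsMinSlack c i j) :
    (s.shift (s.slack c i j)).u i + (s.shift (s.slack c i j)).v j = c i j := by
  simp only [shift, slack, h.1, h.2.1, if_true, if_false]
  abel

end SearchState

end Hungarian

/-! ### The Hungarian method in polynomial time -/

section Bounded

variable {I J : Type*} {u : I → ℤ} {v : J → ℤ} {B : ℕ}

/-- The potentials `u` and `v` have absolute value at most `B`. -/
def Bounded (u : I → ℤ) (v : J → ℤ) (B : ℕ) : Prop :=
  (∀ i, (u i).natAbs ≤ B) ∧ ∀ j, (v j).natAbs ≤ B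

theorem Bounded.mono (h : Bounded u v B) {B' : ℕ} (hB : B ≤ B') : Bounded u v B' :=
  ⟨fun i => (h.1 i).trans hB, fun j => (h.2 j).trans hB⟩

theorem SearchState.bounded_shift {s : SearchState I J ℤ} {c : I → J → ℤ}
    (hs : Bounded s.u s.v B) (hc : ∀ i j, (c i j).natAbs ≤ B) (i : I) (j : J) :
    Bounded (s.shift (s.slack c i j)).u (s.shift (s.slack c i j)).v (4 * B) := by
  have hcij := hc i j
  have hui := hs.1 i
  have hvj := hs.2 j
  constructor
  · intro k
    have huk := hs.1 k
    simp only [shift, slack]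
    split_ifs <;> omega
  · intro k
    have hvk := hs.2 k
    simp only [shift, slack]
    split_ifs <;> omega

end Bounded

section Size

variable {n m : ℕ}

theorem size_enc_int_table_le {f : Fin n → ℤ} {b : ℕ} (h : ∀ j, (f j).natAbs ≤ 2 ^ b) :
    (enc f).size ≤ n * (b + 3) + 1 :=
  Datum.size_ofTable_le fun j => Datum.size_num_le (h j)

theorem size_enc_prop_table_le (f : Fin n → Prop) : (enc f).size ≤ n * 3 + 1 :=
  Datum.size_ofTable_le fun j => size_enc_prop_le (f j)

theorem size_enc_option_fin_table_le (f : Fin n → Option (Fin m)) :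
    (enc f).size ≤ n * (m + 3) + 1 :=
  Datum.size_ofTable_le fun j => size_enc_option_fin_le (f j)

noncomputable instance : Enc (SearchState (Fin n) (Fin m) ℤ) :=
  ⟨fun s => enc (s.u, s.v, s.S, s.T, s.H)⟩

theorem SearchState.size_enc_le {s : SearchState (Fin n) (Fin m) ℤ} {b : ℕ}
    (h : Bounded s.u s.v (2 ^ b)) :
    (enc s).size ≤ (n * (b + 3) + 1) + ((m * (b + 3) + 1) + ((n * 3 + 1) + ((m * 3 + 1) +
      (n * (n * (m + 3) + 1 + 1) + 1) + 1) + 1) + 1) + 1 := by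
  change (enc s.u).size + ((enc s.v).size + ((enc s.S).size + ((enc s.T).size +
    (enc s.H).size + 1) + 1) + 1) + 1 ≤ _
  gcongr
  · exact size_enc_int_table_le h.1
  · exact size_enc_int_table_le h.2
  · exact size_enc_prop_table_le s.S
  · exact size_enc_prop_table_le s.T
  · exact Datum.size_ofTable_le fun k => size_enc_option_fin_table_le (s.H k)

theorem size_enc_potentials_le {u : Fin n → ℤ} {v : Fin m → ℤ} {a : Fin n → Option (Fin m)} {b : ℕ}
    (h : Bounded u v (2 ^ b)) :
    (enc (u, v, a)).size ≤
      (n * (b + 3) + 1) + ((m * (b + 3) + 1) + (n * (m + 3) + 1) + 1) + 1 := by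
  change (enc u).size + ((enc v).size + (enc a).size + 1) + 1 ≤ _
  gcongr
  · exact size_enc_int_table_le h.1
  · exact size_enc_int_table_le h.2
  · exact size_enc_option_fin_table_le a

end Size

namespace PolyTime

variable {ι : Type} {x : ι → Datum} {n m : ι → ℕ}

theorem update {α : ι → Type} [∀ i, Enc (α i)] {f : ∀ i, Fin (n i) → α i} {j : ∀ i, Fin (n i)}
    {a : ∀ i, α i} (hf : PolyTime x f) (hj : PolyTime x j) (ha : PolyTime x a) :
    PolyTime x fun i => Function.update (f i) (j i) (a i) := by
  refine table hf.index ?_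
  simpa only [Function.update_apply] using ite ((variable_index x n).eq (hj.weaken n))
    (ha.weaken n) ((hf.weaken n).apply (variable_index x n))

theorem exists_find_pair {p : ∀ i, Fin (n i) → Fin (m i) → Prop} (hn : Index x n)
    (hm : Index x m) (hp : PolyTime (Ext (Ext x n) fun q => m q.1) fun q => p q.1.1 q.1.2 q.2)
    (hex : ∀ i, ∃ k l, p i k l) :
    ∃ (k : ∀ i, Fin (n i)) (l : ∀ i, Fin (m i)), (∀ i, p i (k i) (l i)) ∧ PolyTime x k ∧
      PolyTime x l := by
  obtain ⟨k, hk, hkP⟩ := exists_find hn (exists_index (hm.weaken n) hp) hex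
  obtain ⟨l, hl, hlP⟩ := exists_find hm (p := fun i l => p i (k i) l)
    ((((id x).weaken m).datum_pair (hkP.weaken m)).datum_pair (variable_index x m) |>.trans
      (hp.reindex fun q : Σ i, Fin (m i) => ⟨⟨q.1, k q.1⟩, q.2⟩)) hk
  exact ⟨k, l, hl, hkP, hlP⟩

section Search

variable {c : ∀ i, Fin (n i) → Fin (m i) → ℤ} {s : ∀ i, SearchState (Fin (n i)) (Fin (m i)) ℤ}
  {k k' : ∀ i, Fin (n i)} {l : ∀ i, Fin (m i)}

section Components

variable (hs : PolyTime x s)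
include hs

theorem search_fields : PolyTime x fun i => ((s i).u, (s i).v, (s i).S, (s i).T, (s i).H) := hs

theorem search_u : PolyTime x fun i => (s i).u := hs.search_fields.fst

theorem search_v : PolyTime x fun i => (s i).v := hs.search_fields.snd.fst

theorem search_S : PolyTime x fun i => (s i).S := hs.search_fields.snd.snd.fst

theorem search_T : PolyTime x fun i => (s i).T := hs.search_fields.snd.snd.snd.fst

theorem search_H : PolyTime x fun i => (s i).H := hs.search_fields.snd.snd.snd.snd

end Components

theorem search_mk (hu : PolyTime x fun i => (s i).u) (hv : PolyTime x fun i => (s i).v)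
    (hS : PolyTime x fun i => (s i).S) (hT : PolyTime x fun i => (s i).T)
    (hH : PolyTime x fun i => (s i).H) : PolyTime x s :=
  hu.prodMk (hv.prodMk (hS.prodMk (hT.prodMk hH)))

theorem search_polyBdd {b : ι → ℕ} (hn : PolyBdd x n) (hm : PolyBdd x m) (hb : PolyBdd x b) :
    PolyBdd x fun i => (n i * (b i + 3) + 1) + ((m i * (b i + 3) + 1) + ((n i * 3 + 1) +
      ((m i * 3 + 1) + (n i * (n i * (m i + 3) + 1 + 1) + 1) + 1) + 1) + 1) + 1 := by
  have h3 := PolyBdd.const x 3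
  exact ((hn.mul (hb.add h3)).succ.add (((hm.mul (hb.add h3)).succ.add ((hn.mul h3).succ.add
    ((hm.mul h3).succ.add (hn.mul (hn.mul (hm.add h3)).succ.succ).succ).succ).succ).succ)).succ

theorem slack (hc : PolyTime x c) (hs : PolyTime x s) (hk : PolyTime x k) (hl : PolyTime x l) :
    PolyTime x fun i => (s i).slack (c i) (k i) (l i) :=
  (((hc.apply hk).apply hl).sub (hs.search_u.apply hk)).sub (hs.search_v.apply hl)

theorem isMinSlack (hn : Index x n) (hm : Index x m) (hc : PolyTime x c) (hs : PolyTime x s)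
    (hk : PolyTime x k) (hl : PolyTime x l) :
    PolyTime x fun i => (s i).IsMinSlack (c i) (k i) (l i) := by
  refine (hs.search_S.apply hk).and ((hs.search_T.apply hl).not.and
    (forall_index hn (forall_index (hm.weaken n) (imp ?_ (imp ?_ (int_le ?_ ?_))))))
  · exact ((hs.search_S.weaken _).weaken _).apply ((variable_index _ _).weaken _)
  · exact ((hs.search_T.weaken _).uncurry).not
  · exact ((slack hc hs hk hl).weaken _).weaken _
  · exact slack ((hc.weaken _).weaken _) ((hs.weaken _).weaken _) ((variable_index _ _).weaken _)
      (variable_index _ _)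

theorem augments (hn : Index x n) (hc : PolyTime x c) (hs : PolyTime x s) (hk : PolyTime x k)
    (hl : PolyTime x l) : PolyTime x fun i => (s i).Augments (c i) (k i) (l i) :=
  (hs.search_S.apply hk).and ((eq ((hs.search_u.apply hk).add (hs.search_v.apply hl))
    ((hc.apply hk).apply hl)).and (forall_index hn (eq
      ((hs.search_H.apply hk).uncurry)
      ((option_some hl).weaken _)).not))

theorem shift {δ : ι → ℤ} (hn : Index x n) (hm : Index x m) (hs : PolyTime x s)
    (hδ : PolyTime x δ) : PolyTime x fun i => (s i).shift (δ i) := by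
  classical
  refine search_mk (table hn ?_) (table hm ?_) hs.search_S hs.search_T hs.search_H
  · exact (ite hs.search_S.uncurry
      (hs.search_u.uncurry.add (hδ.weaken _))
      hs.search_u.uncurry)
  · exact (ite hs.search_T.uncurry
      (hs.search_v.uncurry.sub (hδ.weaken _))
      hs.search_v.uncurry)

theorem grow (hn : Index x n) (hm : Index x m) (hs : PolyTime x s) (hk : PolyTime x k)
    (hk' : PolyTime x k') (hl : PolyTime x l) :
    PolyTime x fun i => (s i).grow (k i) (k' i) (l i) := by
  refine search_mk hs.search_u hs.search_v (table hn ?_) (table hm ?_) (hs.search_H.update hk'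
    (((hs.search_H.apply hk).update hk (option_some hl)).update hk' (option_none m)))
  · exact hs.search_S.uncurry.or
      ((variable_index _ _).eq (hk'.weaken _))
  · exact hs.search_T.uncurry.or
      ((variable_index _ _).eq (hl.weaken _))

theorem exists_search_grow {a : ∀ i, Fin (n i) → Option (Fin (m i))} {r : ∀ i, Fin (n i)}
    (hn : Index x n) (hm : Index x m) (hs : PolyTime x s) (hk : PolyTime x k) (hl : PolyTime x l)
    (htree : ∀ i, (s i).IsAlternatingTree (c i) (a i) (r i)) (hkS : ∀ i, (s i).S (k i))
    (hlT : ∀ i, ¬(s i).T (l i)) (hkl : ∀ i, (s i).u (k i) + (s i).v (l i) = c i (k i) (l i)) :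
    ∃ s' : ∀ i, SearchState (Fin (n i)) (Fin (m i)) ℤ,
      (∀ i, (s' i).u = (s i).u ∧ (s' i).v = (s i).v ∧
        (s' i).IsAlternatingTree (c i) (a i) (r i) ∧ ((∃ j j', (s' i).Augments (c i) j j') ∨
          {j | (s' i).S j}.ncard = {j | (s i).S j}.ncard + 1)) ∧ PolyTime x s' := by
  let p (i : ι) (j : Fin (n i)) : Prop := (s i).H (k i) j = some (l i)
  have hp : PolyTime (Ext x n) fun q => p q.1 q.2 :=
    eq (((hs.search_H.apply hk).weaken n).apply (variable_index x n)) ((option_some hl).weaken n)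
  refine exists_cases (α := fun i => SearchState (Fin (n i)) (Fin (m i)) ℤ)
    (R := fun i s' => s'.u = (s i).u ∧ s'.v = (s i).v ∧
    s'.IsAlternatingTree (c i) (a i) (r i) ∧ ((∃ j j', s'.Augments (c i) j j') ∨
      {j | s'.S j}.ncard = {j | (s i).S j}.ncard + 1)) (exists_index hn hp) ?_ ?_
  · obtain ⟨k', hk', hk'P⟩ := exists_find (x := fun i : {i // ∃ j, p i j} => x i)
      (n := fun i => n i) (p := fun i => p i) (hn.restrict _)
      (hp.reindex fun q : (i : {i // ∃ j, p i j}) × Fin (n i) => ⟨q.1, q.2⟩) fun i => i.2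
    refine ⟨fun i => (s i).grow (k i) (k' i) (l i), fun i => ⟨rfl, rfl, ?_, .inr ?_⟩,
      grow (hn.restrict _) (hm.restrict _) (hs.restrict _) (hk.restrict _) hk'P (hl.restrict _)⟩
    · exact (htree i).grow (hkS i) (hlT i) (hkl i) (hk' i)
    · exact (s i).ncard_grow ((htree i).not_mem_of_eq_some (hkS i) (hlT i) (hk' i))
  · exact ⟨fun i => s i, fun i => ⟨rfl, rfl, htree i, .inl ⟨k i, l i, hkS i, hkl i,
      fun j hj => i.2 ⟨j, hj⟩⟩⟩, hs.restrict fun i => ¬∃ j, p i j⟩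

theorem exists_search_step {a : ∀ i, Fin (n i) → Option (Fin (m i))} {r : ∀ i, Fin (n i)}
    (hn : Index x n) (hm : Index x m) (hc : PolyTime x c) (hs : PolyTime x s)
    (hnm : ∀ i, n i ≤ m i) (htree : ∀ i, (s i).IsAlternatingTree (c i) (a i) (r i)) {B : ι → ℕ}
    (hB : ∀ i, Bounded (s i).u (s i).v (B i)) (hcB : ∀ i j j', (c i j j').natAbs ≤ B i) :
    ∃ s' : ∀ i, SearchState (Fin (n i)) (Fin (m i)) ℤ,
      (∀ i, Bounded (s' i).u (s' i).v (4 * B i) ∧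
        (s' i).IsAlternatingTree (c i) (a i) (r i) ∧ ((∃ j j', (s' i).Augments (c i) j j') ∨
          {j | (s' i).S j}.ncard = {j | (s i).S j}.ncard + 1)) ∧ PolyTime x s' := by
  obtain ⟨k, l, hkl, hk, hl⟩ := exists_find_pair hn hm
    (isMinSlack ((hn.weaken _).weaken _) ((hm.weaken _).weaken _) ((hc.weaken _).weaken _)
      ((hs.weaken _).weaken _) ((variable_index x n).weaken _) (variable_index _ _))
    fun i => (htree i).exists_isMinSlack (by simpa using hnm i)
  obtain ⟨s', hs', hs'P⟩ := exists_search_grow hn hm (shift hn hm hs (slack hc hs hk hl)) hk hl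
    (fun i => (htree i).shift_slack (hkl i)) (fun i => (hkl i).1) (fun i => (hkl i).2.1)
    fun i => (hkl i).tight_shift
  refine ⟨s', fun i => ?_, hs'P⟩
  obtain ⟨hu, hv, h⟩ := hs' i
  rw [hu, hv]
  exact ⟨SearchState.bounded_shift (hB i) (hcB i) (k i) (l i), h⟩

theorem exists_augmenting_search {a : ∀ i, Fin (n i) → Option (Fin (m i))} {r : ∀ i, Fin (n i)}
    (hm : Index x m) (hc : PolyTime x c) (hs : PolyTime x s) (hnm : ∀ i, n i ≤ m i)
    (htree : ∀ i, (s i).IsAlternatingTree (c i) (a i) (r i)) {b : ι → ℕ} (hb : PolyBdd x b)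
    (hB : ∀ i, Bounded (s i).u (s i).v (2 ^ b i))
    (hcB : ∀ i j j', (c i j j').natAbs ≤ 2 ^ b i) :
    ∃ s' : ∀ i, SearchState (Fin (n i)) (Fin (m i)) ℤ,
      (∀ i, Bounded (s' i).u (s' i).v (2 ^ (b i + 2 * n i)) ∧
        (s' i).IsAlternatingTree (c i) (a i) (r i) ∧ ∃ j j', (s' i).Augments (c i) j j') ∧
      PolyTime x s' := by
  have hn : Index x n := hc.index
  let Inv (i : ι) (t : ℕ) (s : SearchState (Fin (n i)) (Fin (m i)) ℤ) : Prop :=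
    Bounded s.u s.v (2 ^ (b i + 2 * t)) ∧ s.IsAlternatingTree (c i) (a i) (r i) ∧
      ((∃ j j', s.Augments (c i) j j') ∨ t < {j | s.S j}.ncard)
  have hstep : ∃ s' : ∀ q : LoopState n Inv, SearchState (Fin (n q.i)) (Fin (m q.i)) ℤ,
      (∀ q, Inv q.i (q.t + 1) (s' q)) ∧ PolyTime (LoopState.data x) s' := by
    let p (q : LoopState n Inv) : Prop := ∃ j j', q.s.Augments (c q.i) j j'
    have hp : PolyTime (LoopState.data x) p := exists_index (loop_context hn) (exists_index
      ((loop_context hm).weaken _) (augments (((loop_context hn).weaken _).weaken _)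
        (((loop_context hc).weaken _).weaken _) ((loop_state.weaken _).weaken _)
        ((variable_index _ _).weaken _) (variable_index _ _)))
    refine exists_cases (R := fun q => Inv q.i (q.t + 1)) hp
      ⟨fun q => q.1.s, fun q => ?_, loop_state.restrict p⟩ ?_
    · exact ⟨q.1.inv.1.mono (by gcongr <;> omega), q.1.inv.2.1, .inl q.2⟩
    · obtain ⟨s', hs', hs'P⟩ := exists_search_step ((loop_context hn).restrict fun q => ¬p q)
        ((loop_context hm).restrict _) ((loop_context hc).restrict _) (loop_state.restrict _)
        (fun q => hnm q.1.i) (fun q => q.1.inv.2.1) (fun q => q.1.inv.1)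
        fun q j j' => (hcB q.1.i j j').trans (by gcongr <;> omega)
      refine ⟨s', fun q => ⟨(hs' q).1.mono (by ring_nf; rfl), (hs' q).2.1, ?_⟩, hs'P⟩
      have := q.1.inv.2.2.resolve_left q.2
      exact (hs' q).2.2.imp_right fun h => by omega
  obtain ⟨s', hs', hs'P⟩ := exists_loop hn Inv hs
    (fun i => ⟨hB i, htree i, .inr ((Set.ncard_pos).2 ⟨r i, (htree i).root_mem⟩)⟩)
    (search_polyBdd hn.polyBdd hm.polyBdd (hb.add ((PolyBdd.const x 2).mul hn.polyBdd)))
    (fun i t s ht hs => SearchState.size_enc_le (hs.1.mono (by gcongr; exact one_le_two))) hstep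
  refine ⟨s', fun i => ⟨(hs' i).1, (hs' i).2.1, (hs' i).2.2.resolve_right (not_lt.2 ?_)⟩, hs'P⟩
  simpa using Set.ncard_le_card {j | (s' i).S j}

theorem exists_augment {a : ∀ i, Fin (n i) → Option (Fin (m i))} {r : ∀ i, Fin (n i)}
    {u : ∀ i, Fin (n i) → ℤ} {v : ∀ i, Fin (m i) → ℤ} (hm : Index x m) (hc : PolyTime x c)
    (hu : PolyTime x u) (hv : PolyTime x v) (ha : PolyTime x a) (hr : PolyTime x r)
    (hnm : ∀ i, n i ≤ m i) (hpart : ∀ i, PartialAssignment (c i) (u i) (v i) (a i))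
    (har : ∀ i, a i (r i) = none) {b : ι → ℕ} (hb : PolyBdd x b)
    (hB : ∀ i, Bounded (u i) (v i) (2 ^ b i)) (hcB : ∀ i j j', (c i j j').natAbs ≤ 2 ^ b i) :
    ∃ y : ∀ i, (Fin (n i) → ℤ) × (Fin (m i) → ℤ) × (Fin (n i) → Option (Fin (m i))),
      (∀ i, Bounded (y i).1 (y i).2.1 (2 ^ (b i + 2 * n i)) ∧
        PartialAssignment (c i) (y i).1 (y i).2.1 (y i).2.2 ∧
        ∀ j, (y i).2.2 j = none ↔ a i j = none ∧ j ≠ r i) ∧ PolyTime x y := by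
  have hn : Index x n := hc.index
  have hinit : PolyTime x fun i => SearchState.init (u i) (v i) (a i) (r i) :=
    search_mk hu hv (table hn ((variable_index x n).eq (hr.weaken n)))
      (table hm (const_prop _ False)) (table hn (ha.weaken n))
  obtain ⟨s, hs, hsP⟩ := exists_augmenting_search hm hc hinit hnm
    (fun i => SearchState.isAlternatingTree_init (hpart i) (har i)) hb hB hcB
  obtain ⟨k, l, hkl, hk, hl⟩ := exists_find_pair hn hm
    (augments ((hn.weaken _).weaken _) ((hc.weaken _).weaken _) ((hsP.weaken _).weaken _)
      ((variable_index x n).weaken _) (variable_index _ _)) fun i => (hs i).2.2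
  exact ⟨fun i => ((s i).u, (s i).v, Function.update ((s i).H (k i)) (k i) (some (l i))),
    fun i => ⟨(hs i).1, (hs i).2.1.augment (hkl i)⟩,
    hsP.search_u.prodMk (hsP.search_v.prodMk ((hsP.search_H.apply hk).update hk (option_some hl)))⟩

end Search

theorem exists_complete_assignment {c : ∀ i, Fin (n i) → Fin (m i) → ℤ} (hm : Index x m)
    (hc : PolyTime x c) (hnm : ∀ i, n i ≤ m i) {l : ι → ℤ} (hl : PolyTime x l)
    (hlc : ∀ i j j', l i ≤ c i j j') {b : ι → ℕ} (hb : PolyBdd x b)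
    (hcB : ∀ i j j', (c i j j').natAbs ≤ 2 ^ b i) (hlB : ∀ i, (l i).natAbs ≤ 2 ^ b i) :
    ∃ y : ∀ i, (Fin (n i) → ℤ) × (Fin (m i) → ℤ) × (Fin (n i) → Option (Fin (m i))),
      (∀ i, PartialAssignment (c i) (y i).1 (y i).2.1 (y i).2.2 ∧ ∀ j, (y i).2.2 j ≠ none) ∧
      PolyTime x y := by
  have hn : Index x n := hc.index
  have hbn := hb.add (((PolyBdd.const x 2).mul hn.polyBdd).mul hn.polyBdd)
  have h3 := PolyBdd.const x 3
  let Inv (i : ι) (t : ℕ)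
      (y : (Fin (n i) → ℤ) × (Fin (m i) → ℤ) × (Fin (n i) → Option (Fin (m i)))) : Prop :=
    Bounded y.1 y.2.1 (2 ^ (b i + 2 * n i * t)) ∧ PartialAssignment (c i) y.1 y.2.1 y.2.2 ∧
      ∀ j, y.2.2 j = none ↔ t ≤ j
  have hstep : ∃ y : ∀ q : LoopState n Inv,
      (Fin (n q.i) → ℤ) × (Fin (m q.i) → ℤ) × (Fin (n q.i) → Option (Fin (m q.i))),
      (∀ q, Inv q.i (q.t + 1) (y q)) ∧ PolyTime (LoopState.data x) y := by
    have hstate : PolyTime (LoopState.data x : LoopState n Inv → Datum) fun q => q.s := loop_state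
    obtain ⟨y, hy, hyP⟩ := exists_augment (loop_context hm) (loop_context hc) hstate.fst
      hstate.snd.fst hstate.snd.snd loop_index (fun q => hnm q.i) (fun q => q.inv.2.1)
      (fun q => (q.inv.2.2 _).2 le_rfl) (b := fun q => b q.i + 2 * n q.i * q.t)
      ((loop_polyBdd hbn).mono fun q => by gcongr; exact q.t.2.le) (fun q => q.inv.1)
      (fun q j j' => (hcB q.i j j').trans (by gcongr <;> omega))
    refine ⟨y, fun q => ⟨(hy q).1.mono (by ring_nf; rfl), (hy q).2.1, fun j => ?_⟩, hyP⟩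
    have := q.inv.2.2 j
    rw [(hy q).2.2 j, this, ne_eq, Fin.ext_iff]
    omega
  obtain ⟨y, hy, hyP⟩ := exists_loop hn Inv
    (s₀ := fun i => (fun _ => l i, fun _ => 0, fun _ => none))
    ((table hn (hl.weaken n)).prodMk ((table hm (const_int _ 0)).prodMk
      (table hn (option_none fun q => m q.1)))) (fun i => ⟨⟨fun _ => by simpa using hlB i, by simp⟩,
        ⟨fun j j' => by simpa using hlc i j j', by simp, by simp, by simp, by simp⟩, by simp⟩)
    ((hn.polyBdd.mul (hbn.add h3)).succ.add ((hm.polyBdd.mul (hbn.add h3)).succ.add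
      (hn.polyBdd.mul (hm.polyBdd.add h3)).succ).succ).succ
    (fun i t y ht hy => size_enc_potentials_le (hy.1.mono (by gcongr; exact one_le_two))) hstep
  exact ⟨y, fun i => ⟨(hy i).2.1, fun j => ((hy i).2.2 j).not.2 (by omega)⟩, hyP⟩

/-- All costs are bounded below by `l`, which serves as the initial potential of the rows. -/
theorem exists_minimum_assignment {c : ∀ i, Fin (n i) → Fin (m i) → ℤ} (hm : Index x m)
    (hc : PolyTime x c) (hnm : ∀ i, n i ≤ m i) {l : ι → ℤ} (hl : PolyTime x l)
    (hlc : ∀ i j j', l i ≤ c i j j') :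
    ∃ π : ∀ i, Fin (n i) → Fin (m i), (∀ i, Function.Injective (π i) ∧
      ∀ π' : Fin (n i) → Fin (m i), Function.Injective π' →
        ∑ j, c i j (π i j) ≤ ∑ j, c i j (π' j)) ∧ PolyTime x π := by
  obtain ⟨y, hy, hyP⟩ := exists_complete_assignment hm hc hnm hl hlc
    (hc.polyBdd_size.add hl.polyBdd_size)
    (fun i j j' => (Datum.natAbs_lt_two_pow_size _).le.trans (Nat.pow_le_pow_right two_pos
      (((size_enc_apply_le (c i j) j').trans (size_enc_apply_le (c i) j)).trans
        (Nat.le_add_right _ _))))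
    (fun i => (Datum.natAbs_lt_two_pow_size _).le.trans
      (Nat.pow_le_pow_right two_pos (Nat.le_add_left _ _)))
  choose π hπ using fun i j => Option.ne_none_iff_exists'.1 ((hy i).2 j)
  have hyπ (i) : (y i).2.2 = fun j => some (π i j) := funext (hπ i)
  have hπpart (i) := hyπ i ▸ (hy i).1
  refine ⟨π, fun i => ⟨fun j j' h => (hπpart i).inj j j' _ rfl (congrArg some h.symm),
    fun π' => (hπpart i).sum_le⟩, ?_⟩
  have hπP : PolyTime x fun i => fun j => some (π i j) := by simpa only [hyπ] using hyP.snd.snd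
  exact hπP

end PolyTime

/-! ### Covering by chains, as an assignment problem -/

section ChainCover

open Sum (inl inr)

variable {I S : Type}

/-- A set `X` of elements covered by disjoint chains, `t d` being the label of the chain of `d`.
Only elements with the property `E` can be covered, and only labels with the property `A` can be
used. -/
structure IsChainCover (E : I → Prop) (lt : I → I → Prop) (A : S → Prop) (X : Finset I)
    (t : I → S) : Prop where
  mem : ∀ d ∈ X, E d
  label : ∀ d ∈ X, A (t d)
  comparable : ∀ d ∈ X, ∀ d' ∈ X, t d = t d' → d ≠ d' → lt d d' ∨ lt d' d

/-- The last element of the chain of `j` before `j`, or the label of this chain if `j` is its first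
element; `j` itself, if it is not covered. -/
def IsPredecessor (lt : I → I → Prop) (X : Finset I) (t : I → S) : I ⊕ S → I → Prop
  | inl i, j => j ∉ X ∧ i = j ∨
    j ∈ X ∧ i ∈ X ∧ t i = t j ∧ lt i j ∧ ∀ k ∈ X, t k = t j → lt k j → k = i ∨ lt k i
  | inr s, j => j ∈ X ∧ t j = s ∧ ∀ k ∈ X, t k = t j → ¬lt k j

/-- The chain of `j` may start with `j` at the label `k`, or contain `j` right after the element
`k`. -/
def CanPrecede (E : I → Prop) (lt : I → I → Prop) (A : S → Prop) : I ⊕ S → I → Prop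
  | inl i, j => E i ∧ E j ∧ lt i j
  | inr s, j => E j ∧ A s

open Classical in
/-- The cost of assigning to `j` its predecessor in a chain or the label of a chain that it starts.
Assigning `j` to itself means that it is not covered, and `M` is a cost too high to be paid. -/
noncomputable def chainCost (E : I → Prop) (lt : I → I → Prop) (A : S → Prop) (w : I → ℤ) (M : ℤ)
    (j : I) (k : I ⊕ S) : ℤ :=
  if k = inl j then w j else if CanPrecede E lt A k j then 0 else M

/-- An assignment of predecessors that can be read as a covering by chains. -/
def IsChainAssignment (E : I → Prop) (lt : I → I → Prop) (A : S → Prop) (π : I → I ⊕ S) : Prop :=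
  ∀ j, π j ≠ inl j → CanPrecede E lt A (π j) j

variable {E : I → Prop} {lt : I → I → Prop} {A : S → Prop} {w : I → ℤ} {M : ℤ}

namespace IsPredecessor

variable {X : Finset I} {t : I → S} {k : I ⊕ S} {j j' : I}

theorem mem_of_mem (h : IsPredecessor lt X t k j) (h' : IsPredecessor lt X t k j') (hj : j ∈ X) :
    j' ∈ X := by
  rcases k with i | s
  · rcases h with h | h
    · exact (h.1 hj).elim
    · rcases h' with h' | h'
      · exact (h'.1 (h'.2 ▸ h.2.1)).elim
      · exact h'.1
  · exact h'.1

theorem label_eq (h : IsPredecessor lt X t k j) (h' : IsPredecessor lt X t k j') (hj : j ∈ X) :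
    t j = t j' := by
  have hj' := h.mem_of_mem h' hj
  rcases k with i | s
  · exact (h.resolve_left fun h => h.1 hj).2.2.1.symm.trans
      (h'.resolve_left fun h => h.1 hj').2.2.1
  · exact h.2.1.trans h'.2.1.symm

theorem not_lt [IsStrictOrder I lt] (h : IsPredecessor lt X t k j)
    (h' : IsPredecessor lt X t k j') (hj : j ∈ X) : ¬lt j j' := by
  intro hlt
  have ht := h.label_eq h' hj
  have hj' := h.mem_of_mem h' hj
  rcases k with i | s
  · have hij := (h.resolve_left fun h => h.1 hj).2.2.2.1
    rcases (h'.resolve_left fun h => h.1 hj').2.2.2.2 j hj ht hlt with rfl | hji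
    · exact irrefl_of lt j hij
    · exact asymm_of lt hij hji
  · exact h'.2.2 j hj ht hlt

theorem right_unique [IsStrictOrder I lt] (hX : IsChainCover E lt A X t)
    (h : IsPredecessor lt X t k j) (h' : IsPredecessor lt X t k j') : j = j' := by
  by_cases hj : j ∈ X
  · have hj' := h.mem_of_mem h' hj
    by_contra hne
    rcases hX.comparable j hj j' hj' (h.label_eq h' hj) hne with hlt | hlt
    · exact h.not_lt h' hj hlt
    · exact h'.not_lt h hj' hlt
  · have hj' : j' ∉ X := fun hj' => hj (h'.mem_of_mem h hj')
    rcases k with i | s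
    · exact (h.resolve_right fun h => hj h.1).2.symm.trans (h'.resolve_right fun h => hj' h.1).2
    · exact (hj h.1).elim

open Classical in
theorem chainCost_eq [IsStrictOrder I lt] (hX : IsChainCover E lt A X t)
    (h : IsPredecessor lt X t k j) : chainCost E lt A w M j k = if j ∈ X then 0 else w j := by
  by_cases hj : j ∈ X
  · rw [if_pos hj]
    rcases k with i | s
    · obtain ⟨-, hi, -, hij, -⟩ := h.resolve_left fun h => h.1 hj
      have hne : i ≠ j := fun he => irrefl_of lt j (he ▸ hij)
      rw [chainCost, if_neg fun he => hne (Sum.inl.inj he),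
        if_pos ⟨hX.mem i hi, hX.mem j hj, hij⟩]
    · rw [chainCost, if_neg Sum.inr_ne_inl, if_pos ⟨hX.mem j hj, h.2.1 ▸ hX.label j hj⟩]
  · rcases k with i | s
    · rw [if_neg hj, chainCost, if_pos (congrArg inl (h.resolve_right fun h => hj h.1).2)]
    · exact (hj h.1).elim

end IsPredecessor

namespace IsChainCover

variable {X : Finset I} {t : I → S}

theorem exists_isPredecessor [Finite I] [IsStrictOrder I lt] (h : IsChainCover E lt A X t)
    (j : I) : ∃ k, IsPredecessor lt X t k j := by
  by_cases hj : j ∈ X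
  · by_cases hex : {i | i ∈ X ∧ t i = t j ∧ lt i j}.Nonempty
    · obtain ⟨i, ⟨hi, hti, hij⟩, hmax⟩ :=
        (Finite.wellFounded_of_trans_of_irrefl (Function.swap lt)).has_min _ hex
      refine ⟨inl i, .inr ⟨hj, hi, hti, hij, fun k hk htk hkj =>
        or_iff_not_imp_left.2 fun hne => ?_⟩⟩
      exact (h.comparable k hk i hi (htk.trans hti.symm) hne).resolve_right
        (hmax k ⟨hk, htk, hkj⟩)
    · exact ⟨inr (t j), hj, rfl, fun k hk htk hkj => hex ⟨k, hk, htk, hkj⟩⟩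
  · exact ⟨inl j, .inl ⟨hj, rfl⟩⟩

open Classical in
theorem exists_assignment [Fintype I] [IsStrictOrder I lt] (h : IsChainCover E lt A X t) (w : I → ℤ)
    (M : ℤ) : ∃ π : I → I ⊕ S, Function.Injective π ∧
      ∑ j, chainCost E lt A w M j (π j) = ∑ j with j ∉ X, w j := by
  choose π hπ using h.exists_isPredecessor
  refine ⟨π, fun j j' hjj => (hπ j).right_unique h (hjj ▸ hπ j'), ?_⟩
  rw [Finset.sum_filter]
  exact Finset.sum_congr rfl fun j _ => by rw [(hπ j).chainCost_eq h, ite_not]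

theorem of_lists {L : ℕ} {ps : List (List I)} (hL : ps.length ≤ L) (hE : ∀ p ∈ ps, ∀ d ∈ p, E d)
    (hlt : ∀ p ∈ ps, ∀ d ∈ p, ∀ d' ∈ p, d ≠ d' → lt d d' ∨ lt d' d)
    (hX : ∀ d ∈ X, ∃ p ∈ ps, d ∈ p) : ∃ t : I → ℕ, IsChainCover E lt (· < L) X t := by
  classical
  let t (d : I) : ℕ := ps.findIdx (d ∈ ·)
  have ht (d) (hd : d ∈ X) : ∃ h : t d < ps.length, d ∈ ps[t d] := by
    obtain ⟨p, hp, hdp⟩ := hX d hd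
    have h : t d < ps.length := List.findIdx_lt_length_of_exists ⟨p, hp, decide_eq_true hdp⟩
    exact ⟨h, of_decide_eq_true (List.findIdx_getElem (w := h))⟩
  refine ⟨t, fun d hd => ?_, fun d hd => (ht d hd).1.trans_le hL, fun d hd d' hd' htt => ?_⟩
  · obtain ⟨h, hmem⟩ := ht d hd
    exact hE _ (List.getElem_mem h) d hmem
  · obtain ⟨h, hmem⟩ := ht d hd
    obtain ⟨h', hmem'⟩ := ht d' hd'
    simp only [← htt] at hmem'
    exact hlt _ (List.getElem_mem h) d hmem d' hmem'

/-- If there are more labels than elements, each element can form a chain of its own. -/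
theorem exists_fin_label {n L : ℕ} {E : Fin n → Prop} {lt : Fin n → Fin n → Prop}
    {X : Finset (Fin n)} {t : Fin n → ℕ} (h : IsChainCover E lt (· < L) X t) :
    ∃ t' : Fin n → Fin n, IsChainCover E lt (fun s : Fin n => (s : ℕ) < L) X t' := by
  classical
  by_cases hL : L ≤ n
  · have ht (d) (hd : d ∈ X) : t d < n := (h.label d hd).trans_le hL
    refine ⟨fun d => if hd : d ∈ X then ⟨t d, ht d hd⟩ else d, h.mem, fun d hd => ?_,
      fun d hd d' hd' htt => h.comparable d hd d' hd' ?_⟩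
    · simpa only [hd, dite_true] using h.label d hd
    · simpa only [hd, hd', dite_true, Fin.mk.injEq] using htt
  · exact ⟨id, h.mem, fun d _ => d.2.trans (not_le.1 hL), fun d _ d' _ htt hne => (hne htt).elim⟩

end IsChainCover

theorem neg_abs_le_chainCost (hM : 0 ≤ M) (j : I) (k : I ⊕ S) :
    -|w j| ≤ chainCost E lt A w M j k := by
  have := neg_abs_le (w j)
  have := abs_nonneg (w j)
  unfold chainCost
  split_ifs <;> linarith

/-- Leaving every element uncovered is cheaper than a single forbidden pair. -/
theorem isChainAssignment_of_forall_le [Fintype I] {π : I → I ⊕ S} (hM : 2 * ∑ j, |w j| < M)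
    (hopt : ∀ π' : I → I ⊕ S, Function.Injective π' →
      ∑ j, chainCost E lt A w M j (π j) ≤ ∑ j, chainCost E lt A w M j (π' j)) :
    IsChainAssignment E lt A π := by
  intro j hj
  by_contra hpre
  have hcost : chainCost E lt A w M j (π j) = M := by rw [chainCost, if_neg hj, if_neg hpre]
  have hw : 0 ≤ ∑ i, |w i| := Finset.sum_nonneg fun i _ => abs_nonneg (w i)
  have hupper : ∑ i, chainCost E lt A w M i (π i) ≤ ∑ i, |w i| :=
    (hopt inl Sum.inl_injective).trans (Finset.sum_le_sum fun i _ => by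
      simpa only [chainCost, if_true] using le_abs_self (w i))
  have hlower : chainCost E lt A w M j (π j) + |w j| ≤
      ∑ i, (chainCost E lt A w M i (π i) + |w i|) :=
    Finset.single_le_sum (f := fun i => chainCost E lt A w M i (π i) + |w i|) (fun i _ => by
      linarith [neg_abs_le_chainCost (E := E) (lt := lt) (A := A) (w := w) (M := M)
        (by linarith) i (π i)]) (Finset.mem_univ j)
  rw [Finset.sum_add_distrib] at hlower
  linarith [abs_nonneg (w j)]

/-- The chain that starts at the label `s` when the predecessors are given by `π`. -/
structure IsChainOf (lt : I → I → Prop) (π : I → I ⊕ S) (s : S) (p : List I) : Prop where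
  pairwise : p.Pairwise lt
  covered : ∀ d ∈ p, π d ≠ inl d
  closed : ∀ a ∈ p, ∀ b, π b = inl a → b ∈ p
  start : ∀ j, π j = inr s → j ∈ p

/-- An initial piece of a chain, in reverse order; `d` is its last element. -/
structure IsPartialChain (lt : I → I → Prop) (π : I → I ⊕ S) (d : I) (l : List I) : Prop where
  pairwise : (d :: l).Pairwise fun a b => lt b a
  covered : ∀ a ∈ d :: l, π a ≠ inl a
  closed : ∀ a ∈ l, ∀ b, π b = inl a → b ∈ d :: l

/-- A covering of maximal weight `V` by the chains in the list `l`, of which there are at most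
`L`. -/
structure IsOptimalChainCover [Fintype I] (E : I → Prop) (lt : I → I → Prop) (w : I → ℤ) (L : ℕ)
    (V : ℤ) (l : List (List I)) : Prop where
  value_eq : open Classical in V = ∑ d with ∃ p ∈ l, d ∈ p, w d
  length_le : l.length ≤ L
  pairwise : ∀ p ∈ l, p.Pairwise lt
  mem : ∀ p ∈ l, ∀ d ∈ p, E d
  sum_le : ∀ X (t : I → ℕ), IsChainCover E lt (· < L) X t → ∑ d ∈ X, w d ≤ V

namespace IsPartialChain

variable {π : I → I ⊕ S} {b d : I} {l : List I}

theorem length_lt {n : ℕ} {lt : Fin n → Fin n → Prop} [Std.Irrefl lt] {π : Fin n → Fin n ⊕ S}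
    {d : Fin n} {l : List (Fin n)} (h : IsPartialChain lt π d l) : l.length < n := by
  have hnodup : (d :: l).reverse.Nodup := (List.pairwise_reverse.2 h.pairwise).nodup
  simpa only [List.length_cons, Fintype.card_fin, Nat.succ_le_iff] using
    (List.nodup_reverse.1 hnodup).length_le_card

theorem cons [IsTrans I lt] (h : IsPartialChain lt π d l) (hinj : Function.Injective π)
    (hπ : IsChainAssignment E lt A π) (hb : π b = inl d) : IsPartialChain lt π b (d :: l) := by
  have hbd : π b ≠ inl b := fun hbb =>
    h.covered d List.mem_cons_self (by rw [← Sum.inl.inj (hbb.symm.trans hb), hbb])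
  have hlt : lt d b := by
    have := hπ b hbd
    rw [hb] at this
    exact this.2.2
  refine ⟨List.pairwise_cons.2 ⟨fun a ha => ?_, h.pairwise⟩, fun a ha => ?_, fun a ha c hc => ?_⟩
  · rcases List.mem_cons.1 ha with rfl | ha
    · exact hlt
    · exact trans_of lt (List.rel_of_pairwise_cons h.pairwise ha) hlt
  · rcases List.mem_cons.1 ha with rfl | ha
    · exact hbd
    · exact h.covered a ha
  · rcases List.mem_cons.1 ha with rfl | ha
    · exact List.mem_cons.2 (.inl (hinj (hc.trans hb.symm)))
    · exact List.mem_cons_of_mem _ (h.closed a ha c hc)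

theorem isChainOf_reverse {j : I} {s : S} (h : IsPartialChain lt π d l)
    (hd : ∀ b, π b ≠ inl d) (hj : j ∈ d :: l) (hinj : Function.Injective π) (hs : π j = inr s) :
    IsChainOf lt π s (d :: l).reverse where
  pairwise := List.pairwise_reverse.2 h.pairwise
  covered a ha := h.covered a (List.mem_reverse.1 ha)
  closed a ha b hb := by
    rcases List.mem_cons.1 (List.mem_reverse.1 ha) with rfl | ha
    · exact (hd b hb).elim
    · exact List.mem_reverse.2 (h.closed a ha b hb)
  start k hk := by rwa [hinj (hk.trans hs.symm), List.mem_reverse]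

end IsPartialChain

namespace IsChainAssignment

variable {π : I → I ⊕ S} (h : IsChainAssignment E lt A π)
include h

open Classical in
theorem sum_chainCost [Fintype I] (w : I → ℤ) (M : ℤ) :
    ∑ j, chainCost E lt A w M j (π j) = ∑ j with π j = inl j, w j := by
  rw [Finset.sum_filter]
  refine Finset.sum_congr rfl fun j _ => ?_
  by_cases hj : π j = inl j
  · rw [chainCost, if_pos hj, if_pos hj]
  · rw [chainCost, if_neg hj, if_neg hj, if_pos (h j hj)]

theorem eligible {j : I} (hj : π j ≠ inl j) : E j := by
  have hpre := h j hj
  rcases hk : π j with i | s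
  · rw [hk] at hpre
    exact hpre.2.1
  · rw [hk] at hpre
    exact hpre.1

theorem exists_mem_iff [Finite I] [IsStrictOrder I lt] (hinj : Function.Injective π)
    {l : List (List I)} (hl : ∀ p ∈ l, ∃ s, IsChainOf lt π s p)
    (hA : ∀ s, A s → ∃ p ∈ l, IsChainOf lt π s p) (d : I) : (∃ p ∈ l, d ∈ p) ↔ π d ≠ inl d := by
  refine ⟨fun ⟨p, hp, hd⟩ => (hl p hp).choose_spec.covered d hd, ?_⟩
  induction d using (Finite.wellFounded_of_trans_of_irrefl lt).induction with
  | _ j ih =>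
    intro hj
    have hpre := h j hj
    rcases hk : π j with i | s
    · rw [hk] at hpre
      have hi : π i ≠ inl i := fun hi => hj (by rw [hinj (hk.trans hi.symm), hi])
      obtain ⟨p, hp, hip⟩ := ih i hpre.2.2 hi
      exact ⟨p, hp, (hl p hp).choose_spec.closed i hip j hk⟩
    · rw [hk] at hpre
      obtain ⟨p, hp, hps⟩ := hA s hpre.2
      exact ⟨p, hp, hps.start j hk⟩

end IsChainAssignment

open Classical in
theorem isOptimalChainCover_of_forall_le {n : ℕ} {E : Fin n → Prop} {lt : Fin n → Fin n → Prop}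
    [IsStrictOrder (Fin n) lt] {w : Fin n → ℤ} {L : ℕ} {M : ℤ} (hM : 2 * ∑ j, |w j| < M)
    {π : Fin n → Fin n ⊕ Fin n} (hinj : Function.Injective π)
    (hopt : ∀ π' : Fin n → Fin n ⊕ Fin n, Function.Injective π' →
      ∑ j, chainCost E lt (fun s : Fin n => (s : ℕ) < L) w M j (π j) ≤
        ∑ j, chainCost E lt (fun s : Fin n => (s : ℕ) < L) w M j (π' j))
    {p : Fin n → List (Fin n)} (hp : ∀ s, IsChainOf lt π s (p s)) :
    IsOptimalChainCover E lt w L (∑ j with π j ≠ inl j, w j)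
      (((List.finRange n).filter fun s : Fin n => (s : ℕ) < L).map p) := by
  have hπ := isChainAssignment_of_forall_le hM hopt
  have hmem := hπ.exists_mem_iff hinj
    (l := ((List.finRange n).filter fun s : Fin n => (s : ℕ) < L).map p)
    (fun q hq => by
      obtain ⟨s, -, rfl⟩ := List.mem_map.1 hq
      exact ⟨s, hp s⟩)
    fun s hs => ⟨p s, List.mem_map_of_mem (by simpa using hs), hp s⟩
  refine ⟨?_, ?_, fun q hq => ?_, fun q hq d hd => hπ.eligible ((hmem d).1 ⟨q, hq, hd⟩),
    fun X t hX => ?_⟩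
  · simp only [hmem]
  · rw [List.length_map, ← List.toFinset_card_of_nodup ((List.nodup_finRange n).filter _),
      List.toFinset_filter, List.toFinset_finRange]
    simp only [decide_eq_true_eq, Fin.card_filter_val_lt, min_le_right]
  · obtain ⟨s, -, rfl⟩ := List.mem_map.1 hq
    exact (hp s).pairwise
  · obtain ⟨t', hX'⟩ := hX.exists_fin_label
    obtain ⟨π', hinj', hcost⟩ := hX'.exists_assignment w M
    have hle := hopt π' hinj'
    rw [hcost, hπ.sum_chainCost] at hle
    have hX_add := Finset.sum_filter_add_sum_filter_not Finset.univ (fun j => j ∉ X) w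
    have hπ_add : ∑ j with π j = inl j, w j + ∑ j with π j ≠ inl j, w j = ∑ j, w j := by
      convert Finset.sum_filter_add_sum_filter_not Finset.univ (fun j => π j = inl j) w
    simp only [not_not, Finset.filter_univ_mem] at hX_add
    have hle' : ∑ j with π j = inl j, w j ≤ ∑ j with j ∉ X, w j := by convert hle
    linarith

end ChainCover

instance {n m : ℕ} : IntCode (Fin n ⊕ Fin m) :=
  ⟨fun k => toInt (finSumFinEquiv k), toInt_injective.comp finSumFinEquiv.injective⟩

namespace PolyTime

variable {ι : Type} {x : ι → Datum} {n m : ι → ℕ}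

theorem card (hn : Index x n) : PolyTime x fun i => (n i : ℤ) :=
  (sum hn (f := fun _ _ => 1) (const_int _ 1)).congr_enc fun i => by
    simp only [Finset.sum_const, Finset.card_univ, Fintype.card_fin, nsmul_eq_mul, mul_one]

open Classical in
theorem abs {f : ι → ℤ} (hf : PolyTime x f) : PolyTime x fun i => |f i| :=
  (ite ((const_int x 0).int_le hf) hf ((const_int x 0).sub hf)).congr_enc fun i => by
    split_ifs with h
    · rw [abs_of_nonneg h]
    · rw [abs_of_neg (not_le.1 h), zero_sub]

theorem fin_lt_nat {j : ∀ i, Fin (n i)} {L : ι → ℕ} (hj : PolyTime x j) (hL : PolyTime x L) :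
    PolyTime x fun i => (j i : ℕ) < L i :=
  (hj.fin_val.int_lt hL.natCast).congr_prop fun _ => Nat.cast_lt.symm

theorem sum_inl {j : ∀ i, Fin (n i)} (hj : PolyTime x j) :
    PolyTime x fun i => (Sum.inl (j i) : Fin (n i) ⊕ Fin (m i)) := hj

theorem sum_inr {j : ∀ i, Fin (m i)} (hn : Index x n) (hj : PolyTime x j) :
    PolyTime x fun i => (Sum.inr (j i) : Fin (n i) ⊕ Fin (m i)) :=
  (hn.card.add hj.fin_val).congr_enc fun i => by
    simp only [enc, IntCode.toInt, finSumFinEquiv_apply_right, Fin.val_natAdd, Nat.cast_add]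

theorem sum_of_finSumFinEquiv {k : ∀ i, Fin (n i + m i)} (hk : PolyTime x k) :
    PolyTime x fun i => finSumFinEquiv.symm (k i) :=
  hk.congr_enc fun i => by
    simp only [enc, IntCode.toInt, Equiv.apply_symm_apply]

theorem sum_table {α : ι → Type} [∀ i, Enc (α i)] {f : ∀ i, Fin (n i) ⊕ Fin (m i) → α i}
    (hl : PolyTime x fun i j => f i (.inl j)) (hr : PolyTime x fun i j => f i (.inr j)) :
    PolyTime x fun i k => f i (finSumFinEquiv.symm k) :=
  (fin_append hl hr).congr_enc fun i => congrArg enc <| funext fun k => by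
    refine Fin.addCases (fun j => ?_) (fun j => ?_) k
    · rw [finSumFinEquiv_symm_apply_castAdd, Fin.append_left]
    · rw [finSumFinEquiv_symm_apply_natAdd, Fin.append_right]

variable {E : ∀ i, Fin (n i) → Prop} {lt : ∀ i, Fin (n i) → Fin (n i) → Prop}
  {w : ∀ i, Fin (n i) → ℤ} {L : ι → ℕ}

open Classical in
theorem chainCost_table {M : ι → ℤ} (hE : PolyTime x E) (hlt : PolyTime x lt) (hw : PolyTime x w)
    (hL : PolyTime x L) (hM : PolyTime x M) :
    PolyTime x fun i j k => chainCost (E i) (lt i) (fun s : Fin (n i) => (s : ℕ) < L i) (w i) (M i)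
      j (finSumFinEquiv.symm k) := by
  have hn : Index x n := hw.index
  have hEj : PolyTime (Ext (Ext x n) fun q => n q.1) fun p => E p.1.1 p.1.2 :=
    ((hE.weaken _).weaken _).apply ((variable_index _ _).weaken _)
  have hinl : PolyTime (Ext (Ext x n) fun q => n q.1) fun p => CanPrecede (E p.1.1) (lt p.1.1)
      (fun s : Fin (n p.1.1) => (s : ℕ) < L p.1.1) (.inl p.2) p.1.2 :=
    (hE.weaken _).uncurry.and (hEj.and
      ((hlt.weaken _).uncurry.apply ((variable_index _ _).weaken _)))
  have hinr : PolyTime (Ext (Ext x n) fun q => n q.1) fun p => CanPrecede (E p.1.1) (lt p.1.1)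
      (fun s : Fin (n p.1.1) => (s : ℕ) < L p.1.1) (.inr p.2) p.1.2 :=
    hEj.and ((variable_index _ _).fin_lt_nat ((hL.weaken _).weaken _))
  have hM' : PolyTime (Ext (Ext x n) fun q => n q.1) fun p => M p.1.1 := (hM.weaken _).weaken _
  refine table hn (sum_table (table (hn.weaken _) ?_) (table (hn.weaken _) ?_))
  · refine (ite ((variable_index _ _).eq ((variable_index _ _).weaken _))
      (((hw.weaken _).weaken _).apply ((variable_index _ _).weaken _))
      (ite hinl (const_int _ 0) hM')).congr_enc fun p => ?_
    simp only [chainCost, Sum.inl.injEq]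
  · refine (ite hinr (const_int _ 0) hM').congr_enc fun p => ?_
    simp only [chainCost, reduceCtorEq, if_false]

section Chain

variable {π : ∀ i, Fin (n i) → Fin (n i) ⊕ Fin (n i)} [∀ i, IsStrictOrder (Fin (n i)) (lt i)]

/-- The invariant of the loop that builds a chain: a partial chain through the element `j`, which
has at least `t` elements besides its last one unless it is complete. -/
def IsChainBuilder {n : ℕ} (lt : Fin n → Fin n → Prop) (π : Fin n → Fin n ⊕ Fin n) (j : Fin n)
    (t : ℕ) (s : Fin n × List (Fin n)) : Prop :=
  j ∈ s.1 :: s.2 ∧ IsPartialChain lt π s.1 s.2 ∧ (t ≤ s.2.length ∨ ∀ b, π b ≠ .inl s.1)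

theorem size_enc_fin_list_le {n : ℕ} (d : Fin n) {l : List (Fin n)} (hl : l.length ≤ n) :
    (enc (d, l)).size ≤ n * (n + 3) + n + 5 := by
  have hfin (d : Fin n) : (enc d).size ≤ n + 2 := (Datum.size_num_natCast_le d).trans (by omega)
  have hlist := Datum.size_ofList_le (l := l.map enc) (B := n + 2) fun a ha => by
    obtain ⟨d, -, rfl⟩ := List.mem_map.1 ha
    exact hfin d
  rw [List.length_map] at hlist
  have hmul := Nat.mul_le_mul_right (n + 3) hl
  have hd := hfin d
  change (enc d).size + (Datum.ofList (l.map enc)).size + 1 ≤ _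
  linarith

theorem exists_chainBuilder_step {j : ∀ i, Fin (n i)} (hπ : PolyTime x π)
    (hinj : ∀ i, Function.Injective (π i)) {A : ∀ i, Fin (n i) → Prop}
    (hch : ∀ i, IsChainAssignment (E i) (lt i) (A i) (π i)) :
    ∃ s' : ∀ q : LoopState n fun i => IsChainBuilder (lt i) (π i) (j i),
        Fin (n q.i) × List (Fin (n q.i)),
      (∀ q, IsChainBuilder (lt q.i) (π q.i) (j q.i) (q.t + 1) (s' q)) ∧
        PolyTime (LoopState.data x) s' := by
  let Inv (i) := IsChainBuilder (lt i) (π i) (j i)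
  have hn : Index (LoopState.data x : LoopState n Inv → Datum) fun q => n q.i :=
    loop_context hπ.index
  have hs : PolyTime (LoopState.data x : LoopState n Inv → Datum) fun q => q.s := loop_state
  have hnext : PolyTime (Ext (LoopState.data x : LoopState n Inv → Datum) fun q => n q.i)
      fun p => π p.1.i p.2 = .inl p.1.s.1 :=
    (loop_context hπ).uncurry.eq (hs.fst.weaken _).sum_inl
  refine exists_cases (p := fun q : LoopState n Inv => ∃ b, π q.i b = .inl q.s.1)
    (R := fun q => Inv q.i (q.t + 1)) (exists_index hn hnext) ?_
    ⟨fun q => q.1.s, fun q => ?_, hs.restrict _⟩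
  · obtain ⟨b, hb, hbP⟩ := exists_find
      (x := fun q : {q : LoopState n Inv // ∃ b, π q.i b = .inl q.s.1} => LoopState.data x q.1)
      (n := fun q => n q.1.i) (p := fun q b => π q.1.i b = .inl q.1.s.1) (hn.restrict _)
      (hnext.reindex fun p : (q : {q : LoopState n Inv // ∃ b, π q.i b = .inl q.s.1}) ×
        Fin (n q.1.i) => ⟨p.1.1, p.2⟩) fun q => q.2
    refine ⟨fun q => (b q, q.1.s.1 :: q.1.s.2), fun q => ?_,
      hbP.prodMk ((hs.fst.list_cons hs.snd).restrict _)⟩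
    obtain ⟨hj, hpart, hlen⟩ := q.1.inv
    exact ⟨List.mem_cons_of_mem _ hj, hpart.cons (hinj _) (hch _) (hb q),
      .inl (Nat.succ_le_succ (hlen.resolve_right fun h => h _ (hb q)))⟩
  · obtain ⟨hj, hpart, -⟩ := q.1.inv
    exact ⟨hj, hpart, .inr fun b hb => q.2 ⟨b, hb⟩⟩

theorem exists_chain {j s : ∀ i, Fin (n i)} (hπ : PolyTime x π) (hj : PolyTime x j)
    (hinj : ∀ i, Function.Injective (π i)) {A : ∀ i, Fin (n i) → Prop}
    (hch : ∀ i, IsChainAssignment (E i) (lt i) (A i) (π i)) (hs : ∀ i, π i (j i) = .inr (s i)) :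
    ∃ p : ∀ i, List (Fin (n i)), (∀ i, IsChainOf (lt i) (π i) (s i) (p i)) ∧ PolyTime x p := by
  have hn : Index x n := hπ.index
  have hconst (k : ℕ) := PolyBdd.const x k
  obtain ⟨r, hr, hrP⟩ := exists_loop hn (fun i => IsChainBuilder (lt i) (π i) (j i))
    (s₀ := fun i => (j i, [])) (hj.prodMk list_nil)
    (fun i => ⟨List.mem_singleton_self _, ⟨List.pairwise_singleton _ _, fun a ha => by
      rw [List.mem_singleton.1 ha, hs]
      exact Sum.inr_ne_inl, fun a ha => (List.not_mem_nil ha).elim⟩, .inl le_rfl⟩)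
    (((hn.polyBdd.mul (hn.polyBdd.add (hconst 3))).add hn.polyBdd).add (hconst 5))
    (fun i _ s _ hs => size_enc_fin_list_le s.1 hs.2.1.length_lt.le)
    (exists_chainBuilder_step hπ hinj hch)
  refine ⟨fun i => ((r i).1 :: (r i).2).reverse, fun i => ?_,
    (hrP.fst.list_cons hrP.snd).list_reverse⟩
  obtain ⟨hmem, hpart, hdone⟩ := hr i
  exact hpart.isChainOf_reverse (hdone.resolve_left hpart.length_lt.not_ge) hmem (hinj i) (hs i)

theorem exists_isChainOf {s : ∀ i, Fin (n i)} (hπ : PolyTime x π) (hs : PolyTime x s)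
    (hinj : ∀ i, Function.Injective (π i)) {A : ∀ i, Fin (n i) → Prop}
    (hch : ∀ i, IsChainAssignment (E i) (lt i) (A i) (π i)) :
    ∃ p : ∀ i, List (Fin (n i)), (∀ i, IsChainOf (lt i) (π i) (s i) (p i)) ∧ PolyTime x p := by
  have hn : Index x n := hπ.index
  have hfirst : PolyTime (Ext x n) fun q => π q.1 q.2 = .inr (s q.1) :=
    hπ.uncurry.eq (sum_inr (hn.weaken _) (hs.weaken _))
  refine exists_cases (α := fun i => List (Fin (n i))) (p := fun i => ∃ j, π i j = .inr (s i))
    (R := fun i => IsChainOf (lt i) (π i) (s i)) (exists_index hn hfirst) ?_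
    ⟨fun _ => [], fun i => ⟨List.Pairwise.nil, fun _ h => (List.not_mem_nil h).elim,
      fun _ h => (List.not_mem_nil h).elim, fun j hj => (i.2 ⟨j, hj⟩).elim⟩, list_nil⟩
  obtain ⟨j, hj, hjP⟩ := exists_find (x := fun i : {i // ∃ j, π i j = .inr (s i)} => x i)
    (n := fun i => n i) (p := fun i j => π i j = .inr (s i)) (hn.restrict _)
    (hfirst.reindex fun q : (i : {i // ∃ j, π i j = .inr (s i)}) × Fin (n i) => ⟨q.1, q.2⟩)
    fun i => i.2
  exact exists_chain (hπ.restrict _) hjP (fun i => hinj i) (fun i => hch i) hj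

end Chain

theorem exists_chainCost_minimum {M : ι → ℤ} (hM : ∀ i, 0 ≤ M i) (hE : PolyTime x E)
    (hlt : PolyTime x lt) (hw : PolyTime x w) (hL : PolyTime x L) (hMP : PolyTime x M) :
    ∃ π : ∀ i, Fin (n i) → Fin (n i) ⊕ Fin (n i), (∀ i, Function.Injective (π i) ∧
        ∀ π' : Fin (n i) → Fin (n i) ⊕ Fin (n i), Function.Injective π' →
          ∑ j, chainCost (E i) (lt i) (fun s : Fin (n i) => (s : ℕ) < L i) (w i) (M i) j (π i j) ≤
          ∑ j, chainCost (E i) (lt i) (fun s : Fin (n i) => (s : ℕ) < L i) (w i) (M i) j (π' j)) ∧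
      PolyTime x π := by
  have hn : Index x n := hw.index
  have habs := sum hn (f := fun i j => |w i j|) hw.uncurry.abs
  obtain ⟨π, hπ, hπP⟩ := exists_minimum_assignment (fin_append hn hn).index
    (chainCost_table hE hlt hw hL hMP) (fun i => Nat.le_add_left _ _)
    ((const_int x 0).sub habs) fun i j k =>
      (by linarith [Finset.single_le_sum (fun j _ => abs_nonneg (w i j)) (Finset.mem_univ j)] :
        0 - ∑ j, |w i j| ≤ -|w i j|).trans (neg_abs_le_chainCost (hM i) j _)
  refine ⟨fun i j => finSumFinEquiv.symm (π i j),
    fun i => ⟨finSumFinEquiv.symm.injective.comp (hπ i).1, fun π' hinj => ?_⟩,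
    table hn hπP.uncurry.sum_of_finSumFinEquiv⟩
  simpa only [Function.comp_apply, Equiv.symm_apply_apply] using
    (hπ i).2 (fun j => finSumFinEquiv (π' j)) (finSumFinEquiv.injective.comp hinj)

open Classical in
theorem exists_optimal_chainCover [∀ i, IsStrictOrder (Fin (n i)) (lt i)] (hE : PolyTime x E)
    (hlt : PolyTime x lt) (hw : PolyTime x w) (hL : PolyTime x L) :
    ∃ y : ∀ i, ℤ × List (List (Fin (n i))),
      (∀ i, IsOptimalChainCover (E i) (lt i) (w i) (L i) (y i).1 (y i).2) ∧ PolyTime x y := by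
  have hn : Index x n := hw.index
  have habs := sum hn (f := fun i j => |w i j|) hw.uncurry.abs
  have hnonneg (i) : 0 ≤ ∑ j, |w i j| := Finset.sum_nonneg fun j _ => abs_nonneg (w i j)
  obtain ⟨π, hπ, hπP⟩ := exists_chainCost_minimum
    (M := fun i => ∑ j, |w i j| + ∑ j, |w i j| + 1) (fun i => by linarith [hnonneg i]) hE hlt hw hL
    ((habs.add habs).add (const_int x 1))
  have hM (i) : 2 * ∑ j, |w i j| < ∑ j, |w i j| + ∑ j, |w i j| + 1 := by linarith
  obtain ⟨p, hp, hpP⟩ := exists_isChainOf (n := fun q : Σ i, Fin (n i) => n q.1)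
    (lt := fun q => lt q.1) (hπP.weaken n) (variable_index x n) (fun q => (hπ q.1).1)
    fun q => isChainAssignment_of_forall_le (hM q.1) (hπ q.1).2
  refine ⟨fun i => (∑ j with π i j ≠ .inl j, w i j,
      ((List.finRange (n i)).filter fun s : Fin (n i) => (s : ℕ) < L i).map fun s => p ⟨i, s⟩),
    fun i => isOptimalChainCover_of_forall_le (hM i) (hπ i).1 (hπ i).2 fun s => hp ⟨i, s⟩,
    prodMk ?_ (filter_map hn ((variable_index _ _).fin_lt_nat (hL.weaken _)) hpP)⟩
  have hcovered : PolyTime (Ext x n) fun q => π q.1 q.2 ≠ .inl q.2 :=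
    (hπP.uncurry.eq (variable_index _ _).sum_inl).not
  refine (sum hn (f := fun i j => if π i j ≠ .inl j then w i j else 0)
    (ite hcovered hw.uncurry (const_int _ 0))).congr_enc fun i => ?_
  rw [Finset.sum_filter]

end PolyTime

/-! ### Paths and subproblems -/

namespace Instance

variable {D R L : Type} {I : Instance D R L} {r : R} {s : L} {i j k d d' : D} {p q : List D}

/-- The same resource can serve `i` and then `j`. -/
def Before (I : Instance D R L) (i j : D) : Prop := I.τ i + I.Δ i + I.fDem i j ≤ I.τ j

theorem TriangleInequality.before_trans (h : I.TriangleInequality) (hij : I.Before i j)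
    (hjk : I.Before j k) : I.Before i k := by
  have := h.1 i j k
  unfold Before at *
  omega

theorem TriangleInequality.start_le (h : I.TriangleInequality) (hj : (I.fStart s j : ℤ) ≤ I.τ j)
    (hjk : I.Before j k) : (I.fStart s k : ℤ) ≤ I.τ k := by
  have := h.2 s j k
  unfold Before at hjk
  omega

theorem isPath_iff (h : I.TriangleInequality) (hs : s ∈ I.S r) :
    I.IsPath r s p ↔ p.Nodup ∧ (∀ d ∈ p, r ∈ I.M d) ∧ (∀ d ∈ p, (I.fStart s d : ℤ) ≤ I.τ d) ∧
      p.Pairwise I.Before := by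
  have htrans : IsTrans D I.Before := ⟨fun _ _ _ => h.before_trans⟩
  constructor
  · rintro ⟨hnodup, hM, hhead, hchain⟩
    have hpair : p.Pairwise I.Before :=
      List.isChain_iff_pairwise.1 (hchain.imp fun _ _ hab => hab.1)
    refine ⟨hnodup, hM, fun d hd => ?_, hpair⟩
    cases p with
    | nil => exact (List.not_mem_nil hd).elim
    | cons e p =>
      have he : (I.fStart s e : ℤ) ≤ I.τ e := (hhead e rfl).1
      rcases List.mem_cons.1 hd with rfl | hd
      · exact he
      · exact h.start_le he (List.rel_of_pairwise_cons hpair hd)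
  · rintro ⟨hnodup, hM, hstart, hpair⟩
    refine ⟨hnodup, hM, fun d hd => ?_, ?_⟩
    · have hd := List.mem_of_mem_head? hd
      exact ⟨hstart d hd, r, hM d hd, hs⟩
    · exact (hpair.imp_of_mem fun ha hb hab => (⟨hab, r, hM _ ha, hM _ hb⟩ : I.A _ _)).isChain

theorem IsPath.sublist (hp : I.IsPath r s p) (h : I.TriangleInequality) (hs : s ∈ I.S r)
    (hqp : q.Sublist p) : I.IsPath r s q := by
  rw [isPath_iff h hs] at hp ⊢
  obtain ⟨hnodup, hM, hstart, hpair⟩ := hp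
  exact ⟨hqp.nodup hnodup, fun d hd => hM d (hqp.subset hd),
    fun d hd => hstart d (hqp.subset hd), hpair.sublist hqp⟩

theorem IsPath.before_or_before (hp : I.IsPath r s p) (h : I.TriangleInequality)
    (hs : s ∈ I.S r) (hd : d ∈ p) (hd' : d' ∈ p) (hne : d ≠ d') :
    I.Before d d' ∨ I.Before d' d := by
  have hsymm : Std.Symm fun a b => I.Before a b ∨ I.Before b a := ⟨fun _ _ => Or.symm⟩
  have hpair : p.Pairwise fun a b => I.Before a b ∨ I.Before b a :=
    ((isPath_iff h hs).1 hp).2.2.2.imp Or.inl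
  exact hpair.forall hd hd' hne

theorem SameStart.numRes (h : I.SameStart s) (r : R) : I.numRes r = I.l s r := by
  rw [Instance.numRes, h r, Finset.sum_singleton]

section Subproblem

variable {v : I.Node} {ps : List (List D)}

theorem mem_M_dBar (d : I.DBar v) (hr : r ∈ v.1) : r ∈ I.M d.1 := by
  rwa [d.2]

open Classical in
/-- The demands of a path whose requirement is `v`, as demands of the subproblem of `v`. -/
noncomputable def restrictPath (I : Instance D R L) (v : I.Node) (p : List D) : List (I.DBar v) :=
  p.filterMap fun d => if h : I.M d = v.1 then some ⟨d, h⟩ else none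

theorem mem_restrictPath {d : I.DBar v} : d ∈ I.restrictPath v p ↔ d.1 ∈ p := by
  simp only [restrictPath, List.mem_filterMap]
  constructor
  · rintro ⟨e, he, h⟩
    split_ifs at h
    obtain rfl := Option.some.inj h
    exact he
  · exact fun h => ⟨d.1, h, dif_pos d.2⟩

open Classical in
theorem map_restrictPath (v : I.Node) (p : List D) :
    (I.restrictPath v p).map Subtype.val = p.filter fun d => I.M d = v.1 := by
  rw [restrictPath, List.map_filterMap, ← List.filterMap_eq_filter]
  refine List.filterMap_congr fun d _ => ?_
  by_cases h : I.M d = v.1 <;> simp [h, Option.guard]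

open Classical in
/-- The solution of the subproblem of `v` given by lists of demands. -/
noncomputable def chainSolution (I : Instance D R L) (s : L) (v : I.Node) (ps : List (List D)) :
    Solution (I.DBar v) Unit L where
  paths _ s' := if s' = s then (ps.map (I.restrictPath v) : Multiset _) else 0

theorem mem_chainSolution_paths {s' : L} {p' : List (I.DBar v)} :
    p' ∈ (I.chainSolution s v ps).paths () s' ↔ s' = s ∧ ∃ p ∈ ps, I.restrictPath v p = p' := by
  by_cases hs' : s' = s <;> simp [chainSolution, hs']

variable [LinearOrder R] {σ : Solution (I.DBar v) Unit L}

theorem scarcest_spec (I : Instance D R L) (v : I.Node) : I.scarcest v ∈ v.1 ∧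
    ∀ r ∈ v.1, toLex (I.numRes (I.scarcest v), I.scarcest v) ≤ toLex (I.numRes r, r) := by
  obtain ⟨r, hr, hmin⟩ := Finset.mem_image.1
    (Finset.min'_mem (v.1.image fun r => toLex (I.numRes r, r)) (v.nonempty.image _))
  have hscarcest : I.scarcest v = r := (congrArg (fun t => (ofLex t).2) hmin).symm
  rw [hscarcest]
  exact ⟨hr, fun r' hr' => hmin.le.trans (Finset.min'_le _ _ (Finset.mem_image_of_mem _ hr'))⟩

theorem scarcest_eq (hr : r ∈ v.1)
    (hmin : ∀ r' ∈ v.1, toLex (I.numRes r, r) ≤ toLex (I.numRes r', r')) : I.scarcest v = r :=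
  congrArg (fun t => (ofLex t).2)
    (le_antisymm ((I.scarcest_spec v).2 r hr) (hmin _ (I.scarcest_spec v).1))

theorem numRes_scarcest_le (hr : r ∈ v.1) : I.numRes (I.scarcest v) ≤ I.numRes r :=
  Prod.Lex.monotone_fst _ _ ((I.scarcest_spec v).2 r hr)

theorem TriangleInequality.subproblem (h : I.TriangleInequality) (v : I.Node) :
    (I.subproblem v).TriangleInequality :=
  ⟨fun i j k => h.1 i.1 j.1 k.1, fun s j k => h.2 s j.1 k.1⟩

theorem subproblem_met {d : I.DBar v} :
    (I.subproblem v).Met σ d ↔ ∃ s, ∃ p ∈ σ.paths () s, d ∈ p :=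
  ⟨fun h => h () (Finset.mem_singleton_self _), fun h _ _ => h⟩

theorem subproblem_paths_eq_zero (hs : I.S (I.scarcest v) = {s})
    (hσ : (I.subproblem v).Feasible σ) {s' : L} (hne : s' ≠ s) : σ.paths () s' = 0 :=
  hσ.1 () s' fun hs' => hne (Finset.mem_singleton.1 (hs ▸ hs'))

open Classical in
theorem subproblem_objective [Fintype D] (X : D → Prop)
    (hX : ∀ d : I.DBar v, (I.subproblem v).Met σ d ↔ X d.1) :
    (I.subproblem v).objective σ = ∑ d with I.M d = v.1 ∧ X d, I.w d := by
  refine (Finset.sum_map _ (Function.Embedding.subtype fun d => I.M d = v.1) I.w).symm.trans ?_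
  refine Finset.sum_congr (Finset.ext fun d => ?_) fun _ _ => rfl
  simp [hX, and_comm]

theorem IsPath.restrictPath (hp : I.IsPath r s p) (h : I.TriangleInequality) (hs : s ∈ I.S r)
    (hsv : s ∈ I.S (I.scarcest v)) : (I.subproblem v).IsPath () s (I.restrictPath v p) := by
  classical
  have hsub : ((I.restrictPath v p).map Subtype.val).Sublist p := by
    rw [map_restrictPath]
    exact List.filter_sublist
  obtain ⟨hnodup, -, hstart, hpair⟩ := (isPath_iff h hs).1 hp
  have hpair' : (I.restrictPath v p).Pairwise fun a b => I.Before a.1 b.1 :=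
    List.pairwise_map.1 (hpair.sublist hsub)
  exact (isPath_iff (h.subproblem v) hsv).2 ⟨(hsub.nodup hnodup).of_map _,
    fun d _ => Finset.mem_singleton_self (), fun d hd => hstart d.1 (mem_restrictPath.1 hd), hpair'⟩

theorem IsPath.of_subproblem {p : List (I.DBar v)} (hp : (I.subproblem v).IsPath () s p)
    (h : I.TriangleInequality) (hsv : s ∈ I.S (I.scarcest v)) (hs : s ∈ I.S r) (hr : r ∈ v.1) :
    I.IsPath r s (p.map Subtype.val) := by
  obtain ⟨hnodup, -, hstart, hpair⟩ := (isPath_iff (h.subproblem v) hsv).1 hp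
  rw [isPath_iff h hs]
  simp only [List.forall_mem_map]
  exact ⟨hnodup.map Subtype.val_injective, fun d _ => mem_M_dBar d hr, hstart,
    List.pairwise_map.2 hpair⟩

theorem chainSolution_met {d : I.DBar v} :
    (I.subproblem v).Met (I.chainSolution s v ps) d ↔ ∃ p ∈ ps, d.1 ∈ p := by
  simp only [subproblem_met, mem_chainSolution_paths]
  constructor
  · rintro ⟨_, _, ⟨-, p, hp, rfl⟩, hd⟩
    exact ⟨p, hp, mem_restrictPath.1 hd⟩
  · rintro ⟨p, hp, hd⟩
    exact ⟨s, _, ⟨rfl, p, hp, rfl⟩, mem_restrictPath.2 hd⟩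

end Subproblem

/-! ### Subproblems as covering by chains -/

section Chains

/-- `Before`, with ties broken by the order of the demands: demands without duration at the same
place and time are before each other. -/
def StrictBefore [LE D] (I : Instance D R L) (i j : D) : Prop :=
  I.Before i j ∧ ¬(I.Before j i ∧ j ≤ i)

variable [LinearOrder D]

theorem TriangleInequality.isStrictOrder_strictBefore (h : I.TriangleInequality) :
    IsStrictOrder D I.StrictBefore where
  irrefl _ hi := hi.2 ⟨hi.1, le_rfl⟩
  trans i j k hij hjk := by
    refine ⟨h.before_trans hij.1 hjk.1, fun hki => ?_⟩
    have hlt_ij : i < j := not_le.1 fun hle => hij.2 ⟨h.before_trans hjk.1 hki.1, hle⟩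
    have hlt_jk : j < k := not_le.1 fun hle => hjk.2 ⟨h.before_trans hki.1 hij.1, hle⟩
    exact ((hlt_ij.trans hlt_jk).not_ge hki.2)

theorem strictBefore_or_strictBefore (hne : i ≠ j) (hij : I.Before i j ∨ I.Before j i) :
    I.StrictBefore i j ∨ I.StrictBefore j i := by
  have := hne.lt_or_gt
  simp only [StrictBefore, ← not_lt]
  tauto

/-- The demands of `v` that can be reached from `s`. -/
def Eligible (I : Instance D R L) (s : L) (v : I.Node) (d : D) : Prop :=
  I.M d = v.1 ∧ (I.fStart s d : ℤ) ≤ I.τ d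

variable [LinearOrder R] {v : I.Node} {ps : List (List D)} {V : ℤ}

theorem exists_isChainCover [Fintype D] (h : I.TriangleInequality)
    (hs : I.S (I.scarcest v) = {s}) {σ : Solution (I.DBar v) Unit L}
    (hσ : (I.subproblem v).Feasible σ) :
    ∃ X t, IsChainCover (I.Eligible s v) I.StrictBefore (· < I.l s (I.scarcest v)) X t ∧
      (I.subproblem v).objective σ = ∑ d ∈ X, I.w d := by
  classical
  have hsv : s ∈ I.S (I.scarcest v) := hs ▸ Finset.mem_singleton_self s
  have hmet (d : I.DBar v) : (I.subproblem v).Met σ d ↔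
      ∃ p ∈ σ.paths () s, d.1 ∈ p.map Subtype.val := by
    simp only [subproblem_met, List.mem_map_of_injective Subtype.val_injective]
    refine ⟨fun ⟨s', p, hp, hd⟩ => ?_, fun ⟨p, hp, hd⟩ => ⟨s, p, hp, hd⟩⟩
    obtain rfl : s' = s := by
      by_contra hne
      exact Multiset.notMem_zero p (subproblem_paths_eq_zero hs hσ hne ▸ hp)
    exact ⟨p, hp, hd⟩
  have hcover : ∃ t, IsChainCover (I.Eligible s v) I.StrictBefore (· < I.l s (I.scarcest v))
      {d | I.M d = v.1 ∧ ∃ p ∈ σ.paths () s, d ∈ p.map Subtype.val} t := by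
    refine IsChainCover.of_lists (ps := (σ.paths () s).toList.map (List.map Subtype.val))
      ?_ ?_ ?_ ?_
    · rw [List.length_map, Multiset.length_toList]
      exact hσ.2.1 () s
    · simp only [List.forall_mem_map, Multiset.mem_toList]
      exact fun p hp d hd =>
        ⟨d.2, ((isPath_iff (h.subproblem v) hsv).1 (hσ.2.2 () s p hp)).2.2.1 d hd⟩
    · simp only [List.forall_mem_map, Multiset.mem_toList]
      exact fun p hp d hd d' hd' hne => strictBefore_or_strictBefore hne <|
        (hσ.2.2 () s p hp).before_or_before (h.subproblem v) hsv hd hd' (ne_of_apply_ne _ hne)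
    · rintro d hd
      obtain ⟨-, p, hp, hdp⟩ := (Finset.mem_filter_univ d).1 hd
      exact ⟨_, List.mem_map_of_mem (Multiset.mem_toList.2 hp), hdp⟩
  obtain ⟨t, ht⟩ := hcover
  exact ⟨_, t, ht, subproblem_objective _ hmet⟩

variable [Fintype D]

theorem chainSolution_objective (hps : IsOptimalChainCover (I.Eligible s v) I.StrictBefore I.w
    (I.l s (I.scarcest v)) V ps) : (I.subproblem v).objective (I.chainSolution s v ps) = V := by
  classical
  rw [subproblem_objective (fun d => ∃ p ∈ ps, d ∈ p) fun _ => chainSolution_met, hps.value_eq]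
  refine Finset.sum_congr (Finset.ext fun d => ?_) fun _ _ => rfl
  simp only [Finset.mem_filter_univ, and_iff_right_iff_imp]
  exact fun ⟨p, hp, hd⟩ => (hps.mem p hp d hd).1

theorem chainSolution_feasible (h : I.TriangleInequality) (hs : I.S (I.scarcest v) = {s})
    (hps : IsOptimalChainCover (I.Eligible s v) I.StrictBefore I.w
      (I.l s (I.scarcest v)) V ps) : (I.subproblem v).Feasible (I.chainSolution s v ps) := by
  have hsv : s ∈ I.S (I.scarcest v) := hs ▸ Finset.mem_singleton_self s
  have horder := h.isStrictOrder_strictBefore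
  refine ⟨fun _ s' hs' => if_neg fun hss : s' = s => hs' (hss ▸ hsv), fun _ s' => ?_,
    fun _ s' p' hp' => ?_⟩
  · by_cases hs' : s' = s
    · simpa only [chainSolution, Instance.subproblem, hs', if_true, Multiset.coe_card,
        List.length_map] using
        hps.length_le
    · simp only [chainSolution, hs', if_false, Multiset.card_zero, Nat.zero_le]
  · obtain ⟨rfl, p, hp, rfl⟩ := mem_chainSolution_paths.1 hp'
    refine IsPath.restrictPath ((isPath_iff h hsv).2 ⟨(hps.pairwise p hp).nodup, fun d hd => ?_,
      fun d hd => (hps.mem p hp d hd).2, (hps.pairwise p hp).imp And.left⟩) h hsv hsv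
    rw [(hps.mem p hp d hd).1]
    exact (I.scarcest_spec v).1

theorem chainSolution_isOptimal (h : I.TriangleInequality) (hs : I.S (I.scarcest v) = {s})
    (hps : IsOptimalChainCover (I.Eligible s v) I.StrictBefore I.w
      (I.l s (I.scarcest v)) V ps) : (I.subproblem v).IsOptimal (I.chainSolution s v ps) := by
  refine ⟨chainSolution_feasible h hs hps, fun σ' hσ' => ?_⟩
  obtain ⟨X, t, hX, hobj⟩ := exists_isChainCover h hs hσ'
  rw [chainSolution_objective hps, hobj]
  exact hps.sum_le X t hX

end Chains

end Instance

/-! ### The approximation ratio of Algorithm C -/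

namespace Instance

variable {D R L : Type}

theorem feasible_empty (I : Instance D R L) : I.Feasible (Solution.empty D R L) :=
  ⟨fun _ _ _ => rfl, fun _ _ => Nat.zero_le _, fun _ _ p hp => (Multiset.notMem_zero p hp).elim⟩

variable [Fintype D]

theorem objective_empty (I : Instance D R L) : I.objective (Solution.empty D R L) = 0 := by
  classical
  refine Finset.sum_eq_zero fun d hd => ?_
  obtain ⟨r, hr⟩ := I.M_nonempty d
  obtain ⟨s, p, hp, -⟩ := (Finset.mem_filter.1 hd).2 r hr
  exact (Multiset.notMem_zero p hp).elim

theorem exists_isOptValue (I : Instance D R L) :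
    ∃ σ, I.Feasible σ ∧ I.IsOptValue (I.objective σ) := by
  classical
  have hfin : {x | ∃ σ, I.Feasible σ ∧ I.objective σ = x}.Finite := by
    refine (Set.finite_range fun X : Finset D => ∑ d ∈ X, I.w d).subset ?_
    rintro x ⟨σ, -, rfl⟩
    exact ⟨_, rfl⟩
  obtain ⟨x, ⟨σ, hσ, rfl⟩, hmax⟩ := hfin.exists_maximal ⟨_, _, I.feasible_empty, rfl⟩
  exact ⟨σ, hσ, ⟨σ, hσ, rfl⟩, fun y hy => (le_total y _).elim id (hmax hy)⟩

open Classical in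
theorem exists_restriction [LinearOrder R] {I : Instance D R L} (h : I.TriangleInequality)
    {σ : Solution D R L} (hσ : I.Feasible σ) (v : I.Node) :
    ∃ σ', (I.subproblem v).Feasible σ' ∧
      (I.subproblem v).objective σ' = ∑ d with I.M d = v.1 ∧ I.Met σ d, I.w d := by
  set r := I.scarcest v
  have hrv : r ∈ v.1 := (I.scarcest_spec v).1
  refine ⟨⟨fun _ s => (σ.paths r s).map fun p => I.restrictPath v (p.filter (I.Met σ))⟩,
    ⟨fun _ s hs => ?_, fun _ s => ?_, fun _ s p' hp' => ?_⟩, subproblem_objective _ fun d => ?_⟩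
  · simp only [hσ.1 r s hs, Multiset.map_zero]
  · exact (Multiset.card_map _ _).trans_le (hσ.2.1 r s)
  · obtain ⟨p, hp, rfl⟩ := Multiset.mem_map.1 hp'
    have hs : s ∈ I.S r := by
      by_contra hs
      exact Multiset.notMem_zero p (hσ.1 r s hs ▸ hp)
    exact ((hσ.2.2 r s p hp).sublist h hs List.filter_sublist).restrictPath h hs hs
  · simp only [subproblem_met, Multiset.mem_map]
    constructor
    · rintro ⟨s, _, ⟨p, -, rfl⟩, hd⟩
      simpa using (List.mem_filter.1 (mem_restrictPath.1 hd)).2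
    · intro hd
      obtain ⟨s, p, hp, hdp⟩ := hd r (mem_M_dBar d hrv)
      exact ⟨s, _, ⟨p, hp, rfl⟩, mem_restrictPath.2 (List.mem_filter.2 ⟨hdp, by simpa using hd⟩)⟩

variable [Fintype R] [LinearOrder R]

open Classical in
theorem objective_eq_sum_node (I : Instance D R L) (σ : Solution D R L) :
    I.objective σ = ∑ v : I.Node, ∑ d with I.M d = v.1 ∧ I.Met σ d, I.w d := by
  rw [objective, ← Finset.sum_fiberwise _ I.node]
  refine Finset.sum_congr rfl fun v _ => Finset.sum_congr (Finset.ext fun d => ?_) fun _ _ => rfl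
  rw [Finset.mem_filter, Finset.mem_filter_univ, Finset.mem_filter_univ, and_comm]
  exact and_congr_left fun _ => Subtype.ext_iff

theorem objective_le_sum_subproblem {I : Instance D R L}
    (h : I.TriangleInequality) {σ : Solution D R L} (hσ : I.Feasible σ)
    {sub : ∀ v : I.Node, Solution (I.DBar v) Unit L}
    (hsub : ∀ v, (I.subproblem v).IsOptimal (sub v)) :
    I.objective σ ≤ ∑ v, (I.subproblem v).objective (sub v) := by
  rw [objective_eq_sum_node]
  refine Finset.sum_le_sum fun v _ => ?_
  obtain ⟨σ', hσ', hobj⟩ := exists_restriction h hσ v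
  exact hobj ▸ (hsub v).2 σ' hσ'

end Instance

section AlgorithmC

variable {D R L : Type} [Fintype D] [Fintype R] [LinearOrder R] {I : Instance D R L} {a b : ℕ}
  {c : ABColoring I.conflictGraph a b} {sub : ∀ v : I.Node, Solution (I.DBar v) Unit L}
  {i : Fin a} {u v : I.Node} {r : R} {s : L}

theorem mem_colorClass : v ∈ colorClass c i ↔ i ∈ c.colors v :=
  Finset.mem_filter_univ v

theorem eq_of_mem_colorClass (hu : u ∈ colorClass c i) (hv : v ∈ colorClass c i) (hru : r ∈ u.1)
    (hrv : r ∈ v.1) : u = v := by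
  by_contra hne
  have hadj : I.conflictGraph.Adj u v := ⟨hne, fun hd => Finset.disjoint_left.1 hd hru hrv⟩
  exact Finset.disjoint_left.1 (c.disjoint_of_adj u v hadj) (mem_colorClass.1 hu)
    (mem_colorClass.1 hv)

theorem colorSolution_paths_of_mem (hv : v ∈ colorClass c i) (hr : r ∈ v.1) (s : L) :
    (colorSolution c sub i).paths r s = ((sub v).paths () s).map (List.map Subtype.val) := by
  refine Finset.sum_eq_single_of_mem v (Finset.mem_filter.2 ⟨hv, hr⟩) fun u hu hne => ?_
  obtain ⟨hu, hru⟩ := Finset.mem_filter.1 hu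
  exact (hne (eq_of_mem_colorClass hu hv hru hr)).elim

theorem colorSolution_paths_of_notMem (hr : ∀ v ∈ colorClass c i, r ∉ v.1) (s : L) :
    (colorSolution c sub i).paths r s = 0 :=
  Finset.sum_eq_zero fun v hv => (hr v (Finset.mem_filter.1 hv).1 (Finset.mem_filter.1 hv).2).elim

theorem colorSolution_paths_eq_zero_or (c : ABColoring I.conflictGraph a b)
    (sub : ∀ v : I.Node, Solution (I.DBar v) Unit L) (i : Fin a) (r : R) (s : L) :
    (colorSolution c sub i).paths r s = 0 ∨ ∃ v ∈ colorClass c i, r ∈ v.1 ∧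
      (colorSolution c sub i).paths r s = ((sub v).paths () s).map (List.map Subtype.val) := by
  by_cases h : ∃ v ∈ colorClass c i, r ∈ v.1
  · obtain ⟨v, hv, hr⟩ := h
    exact .inr ⟨v, hv, hr, colorSolution_paths_of_mem hv hr s⟩
  · exact .inl (colorSolution_paths_of_notMem (fun v hv hr => h ⟨v, hv, hr⟩) s)

theorem feasible_colorSolution (hs : I.SameStart s) (h : I.TriangleInequality)
    (hsub : ∀ v, (I.subproblem v).Feasible (sub v)) (i : Fin a) :
    I.Feasible (colorSolution c sub i) := by
  have hzero (r : R) (s' : L) (hne : s' ≠ s) : (colorSolution c sub i).paths r s' = 0 := by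
    rcases colorSolution_paths_eq_zero_or c sub i r s' with h0 | ⟨v, -, -, hv⟩
    · exact h0
    · rw [hv, Instance.subproblem_paths_eq_zero (hs _) (hsub v) hne, Multiset.map_zero]
  refine ⟨fun r s' hs' => hzero r s' fun hss => hs' ?_, fun r s' => ?_, fun r s' p hp => ?_⟩
  · rw [hs r, hss]
    exact Finset.mem_singleton_self s
  · obtain rfl | hne := eq_or_ne s' s
    · rcases colorSolution_paths_eq_zero_or c sub i r s' with h0 | ⟨v, -, hr, hv⟩
      · simp only [h0, Multiset.card_zero, Nat.zero_le]
      · calc ((colorSolution c sub i).paths r s').card = ((sub v).paths () s').card := by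
              rw [hv, Multiset.card_map]
          _ ≤ I.l s' (I.scarcest v) := (hsub v).2.1 () s'
          _ ≤ I.l s' r := by
              simpa only [hs.numRes] using Instance.numRes_scarcest_le hr
    · simp only [hzero r s' hne, Multiset.card_zero, Nat.zero_le]
  · obtain rfl | hne := eq_or_ne s' s
    · have hS (r : R) : s' ∈ I.S r := hs r ▸ Finset.mem_singleton_self s'
      rcases colorSolution_paths_eq_zero_or c sub i r s' with h0 | ⟨v, -, hr, hv⟩
      · exact (Multiset.notMem_zero p (h0 ▸ hp)).elim
      · obtain ⟨p', hp', rfl⟩ := Multiset.mem_map.1 (hv ▸ hp)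
        exact ((hsub v).2.2 () s' p' hp').of_subproblem h (hS _) (hS r) hr
    · exact (Multiset.notMem_zero p (hzero r s' hne ▸ hp)).elim

theorem met_colorSolution {d : I.DBar v} : I.Met (colorSolution c sub i) d.1 ↔
    v ∈ colorClass c i ∧ (I.subproblem v).Met (sub v) d := by
  rw [Instance.subproblem_met]
  constructor
  · intro hd
    obtain ⟨r, hr⟩ := v.nonempty
    obtain ⟨s, p, hp, hdp⟩ := hd r (Instance.mem_M_dBar d hr)
    rcases colorSolution_paths_eq_zero_or c sub i r s with h0 | ⟨u, hu, -, hpaths⟩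
    · exact (Multiset.notMem_zero p (h0 ▸ hp)).elim
    · obtain ⟨p', hp', rfl⟩ := Multiset.mem_map.1 (hpaths ▸ hp)
      obtain ⟨e, he, hed⟩ := List.mem_map.1 hdp
      obtain rfl : u = v := Subtype.ext (by rw [← d.2, ← e.2, hed])
      obtain rfl : e = d := Subtype.ext hed
      exact ⟨hu, s, p', hp', he⟩
  · rintro ⟨hv, s, p, hp, hdp⟩ r hr
    refine ⟨s, p.map Subtype.val, ?_, List.mem_map_of_mem hdp⟩
    rw [colorSolution_paths_of_mem hv (d.2 ▸ hr)]
    exact Multiset.mem_map_of_mem _ hp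

theorem objective_colorSolution (c : ABColoring I.conflictGraph a b)
    (sub : ∀ v : I.Node, Solution (I.DBar v) Unit L) (i : Fin a) :
    I.objective (colorSolution c sub i) = colorValue c sub i := by
  classical
  rw [Instance.objective_eq_sum_node, colorValue, ← Finset.sum_subset (Finset.subset_univ _)]
  · exact Finset.sum_congr rfl fun v hv => (Instance.subproblem_objective _ fun d => by
      rw [met_colorSolution, and_iff_right hv]).symm
  · refine fun v _ hv => Finset.sum_eq_zero fun d hd => ?_
    obtain ⟨hdv, hd⟩ := (Finset.mem_filter_univ d).1 hd
    exact (hv (met_colorSolution (d := ⟨d, hdv⟩).1 hd).1).elim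

theorem foldl_ite_le_eq {ι α β : Type*} [LinearOrder β] (f : ι → β) (g : ι → α) (l : List ι)
    (x : β × α) :
    (l.foldl (fun cur i => if cur.1 ≤ f i then (f i, g i) else cur) x = x ∧ ∀ i ∈ l, f i < x.1) ∨
    ∃ l₁ i l₂, l = l₁ ++ i :: l₂ ∧
      l.foldl (fun cur i => if cur.1 ≤ f i then (f i, g i) else cur) x = (f i, g i) ∧
      x.1 ≤ f i ∧ (∀ j ∈ l₁, f j ≤ f i) ∧ ∀ j ∈ l₂, f j < f i := by
  induction l generalizing x with
  | nil => exact .inl ⟨rfl, fun _ h => (List.not_mem_nil h).elim⟩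
  | cons k l ih =>
    rw [List.foldl_cons]
    split_ifs with hk
    · refine .inr ?_
      rcases ih (f k, g k) with ⟨heq, hlt⟩ | ⟨l₁, i, l₂, rfl, heq, hle, hl₁, hl₂⟩
      · exact ⟨[], k, l, rfl, heq, hk, fun _ h => (List.not_mem_nil h).elim, hlt⟩
      · exact ⟨k :: l₁, i, l₂, rfl, heq, hk.trans hle, List.forall_mem_cons.2 ⟨hle, hl₁⟩, hl₂⟩
    · have hk := not_le.1 hk
      rcases ih x with ⟨heq, hlt⟩ | ⟨l₁, i, l₂, rfl, heq, hle, hl₁, hl₂⟩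
      · exact .inl ⟨heq, List.forall_mem_cons.2 ⟨hk, hlt⟩⟩
      · exact .inr ⟨k :: l₁, i, l₂, rfl, heq, hle,
          List.forall_mem_cons.2 ⟨(hk.trans_le hle).le, hl₁⟩, hl₂⟩

/-- The color `i` whose solution Algorithm C returns: the last one of greatest value, if this value
is nonnegative. -/
def IsLastBestColor (c : ABColoring I.conflictGraph a b)
    (sub : ∀ v : I.Node, Solution (I.DBar v) Unit L) (i : Fin a) : Prop :=
  0 ≤ colorValue c sub i ∧ ∀ j, colorValue c sub j ≤ colorValue c sub i ∧
    (i < j → colorValue c sub j < colorValue c sub i)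

theorem IsLastBestColor.eq {j : Fin a} (hi : IsLastBestColor c sub i)
    (hj : IsLastBestColor c sub j) : i = j := by
  rcases lt_trichotomy i j with hlt | heq | hlt
  · exact (((hi.2 j).2 hlt).not_ge (hj.2 i).1).elim
  · exact heq
  · exact (((hj.2 i).2 hlt).not_ge (hi.2 j).1).elim

theorem algorithmC_eq (c : ABColoring I.conflictGraph a b)
    (sub : ∀ v : I.Node, Solution (I.DBar v) Unit L) :
    (algorithmC c sub = (0, Solution.empty D R L) ∧ ∀ i, colorValue c sub i < 0) ∨
    ∃ i, algorithmC c sub = (colorValue c sub i, colorSolution c sub i) ∧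
      IsLastBestColor c sub i := by
  rcases foldl_ite_le_eq (colorValue c sub) (colorSolution c sub) (List.finRange a)
    (0, Solution.empty D R L) with ⟨heq, hlt⟩ | ⟨l₁, i, l₂, hl, heq, hle, hl₁, hl₂⟩
  · exact .inl ⟨heq, fun i => hlt i (List.mem_finRange i)⟩
  · have hsorted : (l₁ ++ i :: l₂).Pairwise (· < ·) := hl ▸ List.pairwise_lt_finRange a
    refine .inr ⟨i, heq, hle, fun j => ?_⟩
    have hj : j ∈ l₁ ++ i :: l₂ := hl ▸ List.mem_finRange j
    rcases List.mem_append.1 hj with hj | hj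
    · have hji : j < i := (List.pairwise_append.1 hsorted).2.2 j hj i List.mem_cons_self
      exact ⟨hl₁ j hj, fun hij => (lt_asymm hij hji).elim⟩
    · rcases List.mem_cons.1 hj with rfl | hj
      · exact ⟨le_rfl, fun hjj => (lt_irrefl _ hjj).elim⟩
      · exact ⟨(hl₂ j hj).le, fun _ => hl₂ j hj⟩

theorem IsLastBestColor.algorithmC_eq (hi : IsLastBestColor c sub i) :
    algorithmC c sub = (colorValue c sub i, colorSolution c sub i) := by
  rcases MRMD.algorithmC_eq c sub with ⟨-, hlt⟩ | ⟨j, heq, hj⟩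
  · exact ((hlt i).not_ge hi.1).elim
  · rw [heq, hi.eq hj]

theorem algorithmC_eq_of_not_exists (h : ¬∃ i, IsLastBestColor c sub i) :
    algorithmC c sub = (0, Solution.empty D R L) := by
  rcases algorithmC_eq c sub with ⟨heq, -⟩ | ⟨i, -, hi⟩
  · exact heq
  · exact (h ⟨i, hi⟩).elim

theorem feasible_algorithmC (hs : I.SameStart s) (h : I.TriangleInequality)
    (hsub : ∀ v, (I.subproblem v).Feasible (sub v)) : I.Feasible (algorithmC c sub).2 := by
  rcases algorithmC_eq c sub with ⟨heq, -⟩ | ⟨i, heq, -⟩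
  · simpa only [heq] using I.feasible_empty
  · simpa only [heq] using feasible_colorSolution hs h hsub i

theorem objective_algorithmC (c : ABColoring I.conflictGraph a b)
    (sub : ∀ v : I.Node, Solution (I.DBar v) Unit L) :
    I.objective (algorithmC c sub).2 = (algorithmC c sub).1 := by
  rcases algorithmC_eq c sub with ⟨heq, -⟩ | ⟨i, heq, -⟩
  · simpa only [heq] using I.objective_empty
  · simpa only [heq] using objective_colorSolution c sub i

theorem colorValue_le_algorithmC (c : ABColoring I.conflictGraph a b)
    (sub : ∀ v : I.Node, Solution (I.DBar v) Unit L) (i : Fin a) :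
    colorValue c sub i ≤ (algorithmC c sub).1 := by
  rcases algorithmC_eq c sub with ⟨heq, hlt⟩ | ⟨j, heq, hj⟩
  · simpa only [heq] using (hlt i).le
  · simpa only [heq] using (hj.2 i).1

theorem sum_colorValue (c : ABColoring I.conflictGraph a b)
    (sub : ∀ v : I.Node, Solution (I.DBar v) Unit L) :
    ∑ i, colorValue c sub i = b * ∑ v, (I.subproblem v).objective (sub v) := by
  simp only [colorValue]
  rw [Finset.sum_comm' (t' := Finset.univ) (s' := fun v => c.colors v)
    (fun i v => by simp only [Finset.mem_univ, true_and, and_true, mem_colorClass]), Finset.mul_sum]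
  refine Finset.sum_congr rfl fun v _ => ?_
  rw [Finset.sum_const, c.card_colors, nsmul_eq_mul]

theorem mul_objective_le_mul_algorithmC (h : I.TriangleInequality)
    (hsub : ∀ v, (I.subproblem v).IsOptimal (sub v)) {σ : Solution D R L} (hσ : I.Feasible σ) :
    b * I.objective σ ≤ a * (algorithmC c sub).1 :=
  calc (b : ℤ) * I.objective σ ≤ b * ∑ v, (I.subproblem v).objective (sub v) :=
        mul_le_mul_of_nonneg_left (Instance.objective_le_sum_subproblem h hσ hsub)
          (Int.natCast_nonneg b)
    _ = ∑ i, colorValue c sub i := (sum_colorValue c sub).symm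
    _ ≤ ∑ _ : Fin a, (algorithmC c sub).1 :=
        Finset.sum_le_sum fun i _ => colorValue_le_algorithmC c sub i
    _ = a * (algorithmC c sub).1 := by
        rw [Finset.sum_const, Finset.card_univ, Fintype.card_fin, nsmul_eq_mul]

theorem exists_isOptValue_le_algorithmC (h : I.TriangleInequality) (hb : 0 < b)
    (hsub : ∀ v, (I.subproblem v).IsOptimal (sub v)) :
    ∃ OPT : ℤ, I.IsOptValue OPT ∧ (OPT : ℚ) ≤ (a : ℚ) / b * ((algorithmC c sub).1 : ℚ) := by
  obtain ⟨σ, hσ, hopt⟩ := I.exists_isOptValue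
  refine ⟨_, hopt, ?_⟩
  have hb' : (0 : ℚ) < b := Nat.cast_pos.2 hb
  rw [div_mul_eq_mul_div, le_div_iff₀' hb']
  exact_mod_cast mul_objective_le_mul_algorithmC (c := c) h hsub hσ

end AlgorithmC

/-! ### The running time of Algorithm C -/

namespace Instance

variable {D R L : Type} {I : Instance D R L} {v : I.Node} {s : L}

section First

variable [LinearOrder D] [WellFoundedLT D]

/-- The first of the demands of a node, which represents the node in computations. -/
noncomputable def first (I : Instance D R L) (v : I.Node) : D :=
  wellFounded_lt.min {d | I.M d = v.1} v.2

theorem M_first (v : I.Node) : I.M (I.first v) = v.1 :=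
  wellFounded_lt.min_mem {d | I.M d = v.1} v.2

theorem node_first (v : I.Node) : I.node (I.first v) = v := Subtype.ext (M_first v)

theorem first_eq_iff {d : D} : I.first v = d ↔ I.M d = v.1 ∧ ∀ e, I.M e = v.1 → d ≤ e := by
  have hle {e : D} (he : I.M e = v.1) : I.first v ≤ e :=
    not_lt.1 (wellFounded_lt.not_lt_min {d | I.M d = v.1} he)
  constructor
  · rintro rfl
    exact ⟨M_first v, fun e => hle⟩
  · exact fun ⟨hd, hmin⟩ => le_antisymm (hle hd) (hmin _ (M_first v))

open Classical in
theorem sum_node [Fintype D] {M : Type*} [AddCommMonoid M] (X : Finset I.Node) (f : I.Node → M) :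
    ∑ v ∈ X, f v = ∑ d, if I.node d ∈ X ∧ I.first (I.node d) = d then f (I.node d) else 0 := by
  rw [← Finset.sum_filter]
  refine Finset.sum_nbij' I.first I.node (fun v hv => ?_) (fun d hd => ?_)
    (fun v _ => node_first v) (fun d hd => ?_) fun v _ => by rw [node_first]
  · simpa [node_first] using hv
  · exact (Finset.mem_filter.1 hd).2.1
  · exact (Finset.mem_filter.1 hd).2.2

end First

theorem map_chainSolution {ps : List (List D)} (hps : ∀ p ∈ ps, ∀ d ∈ p, I.M d = v.1) :
    ((I.chainSolution s v ps).paths () s).map (List.map Subtype.val) = ps := by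
  classical
  have hmap (p) (hp : p ∈ ps) : (I.restrictPath v p).map Subtype.val = p := by
    rw [map_restrictPath, List.filter_eq_self.2 fun d hd => decide_eq_true (hps p hp d hd)]
  simp only [chainSolution, if_true, Multiset.map_coe, List.map_map]
  exact congrArg _ ((List.map_congr_left hmap).trans (List.map_id' ps))

theorem SameStart.scarcest_eq_iff [LinearOrder R] (hs : I.SameStart s) {r : R} :
    I.scarcest v = r ↔ r ∈ v.1 ∧ ∀ r' ∈ v.1,
      I.l s r < I.l s r' ∨ I.l s r = I.l s r' ∧ r ≤ r' := by
  have hle (r r' : R) : toLex (I.numRes r, r) ≤ toLex (I.numRes r', r') ↔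
      I.l s r < I.l s r' ∨ I.l s r = I.l s r' ∧ r ≤ r' := by
    rw [Prod.Lex.toLex_le_toLex, hs.numRes, hs.numRes]
  simp only [← hle]
  exact ⟨fun h => h ▸ I.scarcest_spec v, fun h => I.scarcest_eq h.1 h.2⟩

end Instance

/-- The inputs of Algorithm C that the theorem is about. -/
structure Input where
  n : ℕ
  k : ℕ
  q : ℕ
  I : Instance (Fin n) (Fin k) (Fin q)
  exists_sameStart : ∃ s, I.SameStart s
  triangle : I.TriangleInequality
  a : ℕ
  b : ℕ
  c : ABColoring I.conflictGraph a b

namespace Input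

/-- The code of an input, as a context in which programs work. -/
noncomputable def code (i : Input) : Datum := encodeInput i.I i.c

open PolyTime

theorem polyTime_instance : PolyTime code fun i => (i.n, i.k, i.q, (fun r s => s ∈ i.I.S r),
    (fun s r => i.I.l s r), (fun d r => r ∈ i.I.M d), (fun d => i.I.τ d), (fun d => i.I.Δ d),
    (fun d => i.I.w d), (fun s d => i.I.fStart s d), (fun d e => i.I.fDem d e), ()) :=
  (PolyTime.id _).datum_fst.congr_enc fun _ => rfl

theorem polyTime_S : PolyTime code fun i r s => s ∈ i.I.S r :=
  polyTime_instance.snd.snd.snd.fst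

theorem polyTime_l : PolyTime code fun i s r => i.I.l s r :=
  polyTime_instance.snd.snd.snd.snd.fst

theorem polyTime_M : PolyTime code fun i d r => r ∈ i.I.M d :=
  polyTime_instance.snd.snd.snd.snd.snd.fst

theorem polyTime_τ : PolyTime code fun i d => i.I.τ d :=
  polyTime_instance.snd.snd.snd.snd.snd.snd.fst

theorem polyTime_Δ : PolyTime code fun i d => i.I.Δ d :=
  polyTime_instance.snd.snd.snd.snd.snd.snd.snd.fst

theorem polyTime_w : PolyTime code fun i d => i.I.w d :=
  polyTime_instance.snd.snd.snd.snd.snd.snd.snd.snd.fst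

theorem polyTime_fStart : PolyTime code fun i s d => i.I.fStart s d :=
  polyTime_instance.snd.snd.snd.snd.snd.snd.snd.snd.snd.fst

theorem polyTime_fDem : PolyTime code fun i d e => i.I.fDem d e :=
  polyTime_instance.snd.snd.snd.snd.snd.snd.snd.snd.snd.snd.fst

theorem polyTime_colorClass : PolyTime code fun i j d => i.I.node d ∈ colorClass i.c j :=
  ((PolyTime.id _).datum_snd.datum_snd.congr_enc
    (y := fun i : Input => ((fun j d => i.I.node d ∈ colorClass i.c j), ())) fun _ => rfl).fst

theorem index_n : Index code n := polyTime_M.index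

theorem index_k : Index code k := polyTime_S.index

theorem index_q : Index code q := polyTime_l.index

theorem index_a : Index code a := polyTime_colorClass.index

theorem exists_start : ∃ s : ∀ i : Input, Fin i.q, (∀ i : Input, i.I.SameStart (s i)) ∧
    PolyTime code s := by
  obtain ⟨s, hs, hsP⟩ := exists_find index_q (p := fun (i : Input) s => ∀ r, s ∈ i.I.S r)
    (forall_index (index_k.weaken _)
      ((polyTime_S.weaken _).uncurry.apply ((variable_index _ _).weaken _)))
    fun i => i.exists_sameStart.imp fun s hs r => by rw [hs r, Finset.mem_singleton]
  refine ⟨s, fun i r => ?_, hsP⟩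
  obtain ⟨s', hs'⟩ := i.exists_sameStart
  have hmem := hs i r
  rw [hs' r, Finset.mem_singleton] at hmem
  rw [hs' r, hmem]

theorem polyTime_before : PolyTime code fun i => i.I.Before :=
  have start := polyTime_τ.uncurry.weaken _
  have duration := (polyTime_Δ.uncurry.weaken _).natCast
  have travel := polyTime_fDem.uncurry.uncurry.natCast
  table index_n (table (index_n.weaken _)
    (((start.add duration).add travel).int_le (polyTime_τ.weaken _).uncurry))

theorem polyTime_strictBefore : PolyTime code fun i => i.I.StrictBefore := by
  have before := polyTime_before.uncurry.uncurry
  have after := (polyTime_before.weaken n).uncurry.apply ((variable_index _ _).weaken _)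
  have le : PolyTime (Ext (Ext code n) fun p => p.1.n) fun p => p.2 ≤ p.1.2 :=
    ((variable_index _ _).fin_val.int_le ((variable_index _ _).weaken _).fin_val).congr_prop
      fun _ => by rw [Int.ofNat_le, Fin.val_fin_le]
  exact table index_n (table (index_n.weaken _) (before.and (after.and le).not))

theorem polyTime_M_eq : PolyTime code fun i d e => i.I.M d = i.I.M e := by
  have left := polyTime_M.uncurry.weaken (fun p => p.1.n)
  have right := (polyTime_M.weaken n).uncurry
  exact table index_n (table (index_n.weaken _) ((forall_index ((index_k.weaken _).weaken _)
    (left.uncurry.iff right.uncurry)).congr_prop fun p => Finset.ext_iff))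

theorem polyTime_first : PolyTime code fun i d => i.I.first (i.I.node d) := by
  have hM := (polyTime_M_eq.weaken n).uncurry.apply ((variable_index _ _).weaken _)
  have hmin : PolyTime (Ext (Ext code n) fun p => p.1.n)
      fun p => ∀ e, p.1.1.I.M e = p.1.1.I.M p.1.2 → (p.2 : ℤ) ≤ (e : ℤ) := by
    refine forall_index ((index_n.weaken _).weaken _) (imp ?_ ?_)
    · exact ((polyTime_M_eq.weaken _).weaken _).uncurry.apply
        (((variable_index _ _).weaken _).weaken _)
    · exact ((variable_index _ _).weaken _).fin_val.int_le (variable_index _ _).fin_val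
  refine table index_n (of_graph (index_n.weaken _) ((hM.and hmin).congr_prop fun p => ?_))
  simp only [Int.ofNat_le, Fin.val_fin_le]
  exact Instance.first_eq_iff

section Solve

variable {s : ∀ i : Input, Fin i.q}

theorem polyTime_scarcest (hs : ∀ i : Input, i.I.SameStart (s i)) (hsP : PolyTime code s) :
    PolyTime code fun i d => i.I.scarcest (i.I.node d) := by
  have hl : PolyTime code fun i => i.I.l (s i) := polyTime_l.apply hsP
  let x := Ext (Ext (Ext code n) fun p => p.1.k) fun p => p.1.1.k
  have left : PolyTime x fun p => p.1.1.1.I.l (s p.1.1.1) p.1.2 := (hl.weaken n).uncurry.weaken _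
  have right : PolyTime x fun p => p.1.1.1.I.l (s p.1.1.1) p.2 := ((hl.weaken n).weaken _).uncurry
  have hM : PolyTime x fun p => p.2 ∈ p.1.1.1.I.M p.1.1.2 := (polyTime_M.uncurry.weaken _).uncurry
  have le : PolyTime x fun p => p.1.2 ≤ p.2 :=
    (((variable_index _ _).weaken _).fin_val.int_le (variable_index _ _).fin_val).congr_prop
      fun _ => by rw [Int.ofNat_le, Fin.val_fin_le]
  have lt : PolyTime x fun p => p.1.1.1.I.l (s p.1.1.1) p.1.2 < p.1.1.1.I.l (s p.1.1.1) p.2 :=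
    (left.natCast.int_lt right.natCast).congr_prop fun _ => Int.ofNat_lt.symm
  have hmin : PolyTime (Ext (Ext code n) fun p => p.1.k) fun p => ∀ r' ∈ p.1.1.I.M p.1.2,
      p.1.1.I.l (s p.1.1) p.2 < p.1.1.I.l (s p.1.1) r' ∨
        p.1.1.I.l (s p.1.1) p.2 = p.1.1.I.l (s p.1.1) r' ∧ p.2 ≤ r' :=
    forall_index ((index_k.weaken _).weaken _) (hM.imp (lt.or ((left.eq right).and le)))
  exact table index_n (of_graph (index_k.weaken _)
    ((polyTime_M.uncurry.uncurry.and hmin).congr_prop fun p => (hs p.1.1).scarcest_eq_iff))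

theorem polyTime_eligible (hsP : PolyTime code s) :
    PolyTime code fun i d => i.I.Eligible (s i) (i.I.node d) := by
  have hM := (polyTime_M_eq.weaken n).uncurry.apply ((variable_index _ _).weaken _)
  have start := (((polyTime_fStart.apply hsP).weaken n).uncurry.natCast.int_le
    (polyTime_τ.weaken n).uncurry)
  exact table index_n (table (index_n.weaken _) (hM.and start))

/-- Optimal coverings by chains for the subproblems of all inputs: the value `(y i v).1` and the
chains `(y i v).2` for the node `v` of the input `i`. -/
def IsOptimalChains (s : ∀ i : Input, Fin i.q)
    (y : ∀ (i : Input) (_ : i.I.Node), ℤ × List (List (Fin i.n))) : Prop :=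
  ∀ i v, IsOptimalChainCover (i.I.Eligible (s i) v) i.I.StrictBefore i.I.w
    (i.I.l (s i) (i.I.scarcest v)) (y i v).1 (y i v).2

theorem exists_isOptimalChains (hs : ∀ i : Input, i.I.SameStart (s i)) (hsP : PolyTime code s) :
    ∃ y, IsOptimalChains s y ∧ PolyTime code fun i d => y i (i.I.node d) := by
  have horder (p : Σ i : Input, Fin i.n) := p.1.triangle.isStrictOrder_strictBefore
  obtain ⟨y, hy, hyP⟩ := exists_optimal_chainCover (polyTime_eligible hsP).uncurry
    (polyTime_strictBefore.weaken n) (polyTime_w.weaken n)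
    (((polyTime_l.apply hsP).weaken n).apply (polyTime_scarcest hs hsP).uncurry)
  let z (i : Input) (d : Fin i.n) : ℤ × List (List (Fin i.n)) := y ⟨i, d⟩
  have hzP : PolyTime code z := table index_n hyP
  refine ⟨fun i v => z i (i.I.first v), fun i v => ?_,
    table index_n ((hzP.weaken n).apply polyTime_first.uncurry)⟩
  simpa only [Instance.node_first] using hy ⟨i, i.I.first v⟩

/-- The solutions of the subproblems given by the chains `(y i v).2`. -/
noncomputable def solutions (s : ∀ i : Input, Fin i.q)
    (y : ∀ (i : Input) (_ : i.I.Node), ℤ × List (List (Fin i.n))) (i : Input) (v : i.I.Node) :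
    Solution (i.I.DBar v) Unit (Fin i.q) :=
  i.I.chainSolution (s i) v (y i v).2

variable {y : ∀ (i : Input) (_ : i.I.Node), ℤ × List (List (Fin i.n))}

theorem IsOptimalChains.isOptimal (hy : IsOptimalChains s y)
    (hs : ∀ i : Input, i.I.SameStart (s i)) (i : Input) (v : i.I.Node) :
    (i.I.subproblem v).IsOptimal (solutions s y i v) :=
  Instance.chainSolution_isOptimal i.triangle (hs i _) (hy i v)

theorem IsOptimalChains.colorValue_eq (hy : IsOptimalChains s y) (i : Input) (j : Fin i.a) :
    colorValue i.c (solutions s y i) j = ∑ v ∈ colorClass i.c j, (y i v).1 :=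
  Finset.sum_congr rfl fun v _ => Instance.chainSolution_objective (hy i v)

theorem polyTime_colorValue (hy : IsOptimalChains s y)
    (hyP : PolyTime code fun i d => y i (i.I.node d)) :
    PolyTime code fun i => colorValue i.c (solutions s y i) := by
  classical
  have isFirst : PolyTime code fun i d => i.I.first (i.I.node d) = d :=
    table index_n (polyTime_first.uncurry.eq (variable_index _ _))
  refine table index_a ((sum (index_n.weaken a) (f := fun p d =>
    if p.1.I.node d ∈ colorClass p.1.c p.2 ∧ p.1.I.first (p.1.I.node d) = d then
      (y p.1 (p.1.I.node d)).1 else 0) (ite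
    (polyTime_colorClass.uncurry.uncurry.and (isFirst.weaken _).uncurry)
    (hyP.weaken _).uncurry.fst (const_int _ 0))).congr_enc fun p => congrArg Enc.enc ?_)
  rw [hy.colorValue_eq, Instance.sum_node]

theorem exists_colorPaths_start (hy : IsOptimalChains s y)
    (hyP : PolyTime code fun i d => y i (i.I.node d)) :
    ∃ l : ∀ p : Σ p : (Σ i : Input, Fin i.a), Fin p.1.k, List (List (Fin p.1.1.n)),
      (∀ p, (l p : Multiset (List (Fin p.1.1.n))) =
        (colorSolution p.1.1.c (solutions s y p.1.1) p.1.2).paths p.2 (s p.1.1)) ∧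
      PolyTime (Ext (Ext code a) fun p => p.1.k) l := by
  let Q (p : Σ p : (Σ i : Input, Fin i.a), Fin p.1.k) (d : Fin p.1.1.n) : Prop :=
    p.1.1.I.node d ∈ colorClass p.1.1.c p.1.2 ∧ p.2 ∈ p.1.1.I.M d
  have hn := (index_n.weaken a).weaken fun p => p.1.k
  have hQ : PolyTime (Ext (Ext (Ext code a) fun p => p.1.k) fun p => p.1.1.n)
      fun p => Q p.1 p.2 :=
    (polyTime_colorClass.uncurry.weaken _).uncurry.and
      (((polyTime_M.weaken _).weaken _).uncurry.apply ((variable_index _ _).weaken _))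
  refine exists_cases (α := fun p => List (List (Fin p.1.1.n))) (p := fun p => ∃ d, Q p d)
    (R := fun p l => (l : Multiset (List (Fin p.1.1.n))) =
      (colorSolution p.1.1.c (solutions s y p.1.1) p.1.2).paths p.2 (s p.1.1))
    (exists_index hn hQ) ?_ ?_
  · obtain ⟨d, hd, hdP⟩ := exists_find (p := fun p : {p // ∃ d, Q p d} => Q p.1) (hn.restrict _)
      (hQ.reindex fun p : Σ p : {p // ∃ d, Q p d}, Fin p.1.1.1.n => ⟨p.1.1, p.2⟩) fun p => p.2
    refine ⟨fun p => (y _ (p.1.1.1.I.node (d p))).2, fun p => ?_,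
      ((((hyP.weaken _).weaken _).restrict _).apply hdP).snd⟩
    rw [colorSolution_paths_of_mem (hd p).1 (hd p).2]
    exact (Instance.map_chainSolution fun q hq e he => ((hy _ _).mem q hq e he).1).symm
  · refine ⟨fun _ => [], fun p => (colorSolution_paths_of_notMem (fun v hv hr =>
      p.2 ⟨p.1.1.1.I.first v, ?_, ?_⟩) _).symm, list_nil⟩
    · rwa [Instance.node_first]
    · rwa [Instance.M_first]

theorem exists_colorPaths (hs : ∀ i : Input, i.I.SameStart (s i)) (hsP : PolyTime code s)
    (hy : IsOptimalChains s y) (hyP : PolyTime code fun i d => y i (i.I.node d)) :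
    ∃ l : ∀ i : Input, Fin i.a → Fin i.k → Fin i.q → List (List (Fin i.n)),
      (∀ i j r t, (l i j r t : Multiset (List (Fin i.n))) =
        (colorSolution i.c (solutions s y i) j).paths r t) ∧ PolyTime code l := by
  obtain ⟨l, hl, hlP⟩ := exists_colorPaths_start hy hyP
  refine ⟨fun i j r t => if t = s i then l ⟨⟨i, j⟩, r⟩ else [], fun i j r t => ?_,
    table index_a (table (index_k.weaken _) (table ((index_q.weaken _).weaken _)
      (ite ((variable_index _ _).eq (((hsP.weaken _).weaken _).weaken _)) (hlP.weaken _)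
        list_nil)))⟩
  beta_reduce
  split_ifs with ht
  · exact ht ▸ hl ⟨⟨i, j⟩, r⟩
  · refine ((feasible_colorSolution (hs i) i.triangle
      (fun v => (hy.isOptimal hs i v).1) j).1 r t ?_).symm
    rwa [hs i r, Finset.mem_singleton]

theorem polyTime_isLastBestColor (hy : IsOptimalChains s y)
    (hyP : PolyTime code fun i d => y i (i.I.node d)) :
    PolyTime (Ext code a) fun p => IsLastBestColor p.1.c (solutions s y p.1) p.2 := by
  have value := polyTime_colorValue hy hyP
  have left := value.uncurry.weaken fun p => p.1.a
  have right := (value.weaken a).uncurry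
  have lt : PolyTime (Ext (Ext code a) fun p => p.1.a) fun p => p.1.2 < p.2 :=
    (((variable_index _ _).weaken _).fin_val.int_lt (variable_index _ _).fin_val).congr_prop
      fun _ => by rw [Int.ofNat_lt, Fin.val_fin_lt]
  exact ((const_int _ 0).int_le value.uncurry).and
    (forall_index (index_a.weaken _) ((right.int_le left).and (lt.imp (right.int_lt left))))

/-- The pair `out` of a value and lists of paths represents the pair of a value and a solution. -/
def Represents {n k q : ℕ} (out : ℤ × (Fin k → Fin q → List (List (Fin n))))
    (σ : ℤ × Solution (Fin n) (Fin k) (Fin q)) : Prop :=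
  out.1 = σ.1 ∧ ∀ r t, (out.2 r t : Multiset (List (Fin n))) = σ.2.paths r t

theorem exists_algorithmC (hs : ∀ i : Input, i.I.SameStart (s i)) (hsP : PolyTime code s)
    (hy : IsOptimalChains s y) (hyP : PolyTime code fun i d => y i (i.I.node d)) :
    ∃ out : ∀ i : Input, ℤ × (Fin i.k → Fin i.q → List (List (Fin i.n))),
      (∀ i, Represents (out i) (algorithmC i.c (solutions s y i))) ∧ PolyTime code out := by
  obtain ⟨l, hl, hlP⟩ := exists_colorPaths hs hsP hy hyP
  have value := polyTime_colorValue hy hyP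
  have best := polyTime_isLastBestColor hy hyP
  let p (i : Input) : Prop := ∃ j, IsLastBestColor i.c (solutions s y i) j
  refine exists_cases (α := fun i => ℤ × (Fin i.k → Fin i.q → List (List (Fin i.n)))) (p := p)
    (R := fun i out => Represents out (algorithmC i.c (solutions s y i)))
    (exists_index index_a best) ?_ ?_
  · obtain ⟨j, hj, hjP⟩ := exists_find
      (p := fun i : {i // p i} => IsLastBestColor i.1.c (solutions s y i.1)) (index_a.restrict p)
      (best.reindex fun q : Σ i : {i // p i}, Fin i.1.a => ⟨q.1.1, q.2⟩) fun i => i.2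
    refine ⟨fun i => (colorValue i.1.c (solutions s y i.1) (j i), l i.1 (j i)), fun i => ?_,
      ((value.restrict p).apply hjP).prodMk ((hlP.restrict p).apply hjP)⟩
    rw [(hj i).algorithmC_eq]
    exact ⟨rfl, hl i.1 (j i)⟩
  · have hnil : PolyTime (fun i : {i // ¬p i} => i.1.code)
        fun i (_ : Fin i.1.k) (_ : Fin i.1.q) => ([] : List (List (Fin i.1.n))) :=
      table (index_k.restrict _) (table ((index_q.restrict _).weaken _) list_nil)
    refine ⟨fun i => (0, fun _ _ => []), fun i => ?_, (const_int _ 0).prodMk hnil⟩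
    rw [algorithmC_eq_of_not_exists i.2]
    exact ⟨rfl, fun _ _ => rfl⟩

end Solve

theorem exists_polynomial_time : ∃ (P : Prog) (T : Polynomial ℕ), ∀ i : Input,
    ∃ sub : ∀ v : i.I.Node, Solution (i.I.DBar v) Unit (Fin i.q),
      (∀ v, (i.I.subproblem v).IsOptimal (sub v)) ∧
      OutputsWithin P i.code (algorithmC i.c sub) (T.eval i.code.size) := by
  obtain ⟨s, hs, hsP⟩ := exists_start
  obtain ⟨y, hy, hyP⟩ := exists_isOptimalChains hs hsP
  obtain ⟨out, hout, P, m, hP⟩ := exists_algorithmC hs hsP hy hyP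
  refine ⟨P, (Polynomial.X + 2) ^ m, fun i => ⟨solutions s y i, hy.isOptimal hs i,
    (out i).2, (hout i).2, ?_⟩⟩
  obtain ⟨t, ht, hrun⟩ := hP i
  refine ⟨t, ?_, ?_⟩
  · simpa using ht
  · have henc : Enc.enc (out i) = encodeOutput (out i).1 (out i).2 := by
      simp only [encodeOutput, Enc.enc]
      rfl
    rwa [henc, (hout i).1] at hrun

end Input

end MRMD

theorem mainTheorem8 :
    -- every run of Algorithm C yields a feasible solution whose value is at least `b / a` times OPT
    (∀ (n k q : ℕ) (I : MRMD.Instance (Fin n) (Fin k) (Fin q)) (s : Fin q),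
      I.SameStart s → I.TriangleInequality →
      ∀ (a b : ℕ), 0 < b → ∀ (c : MRMD.ABColoring I.conflictGraph a b)
        (sub : ∀ v : I.Node, MRMD.Solution (I.DBar v) Unit (Fin q)),
        (∀ v, (I.subproblem v).IsOptimal (sub v)) →
        I.Feasible (MRMD.algorithmC c sub).2 ∧
        I.objective (MRMD.algorithmC c sub).2 = (MRMD.algorithmC c sub).1 ∧
        ∃ OPT : ℤ, I.IsOptValue OPT ∧
          (OPT : ℚ) ≤ (a : ℚ) / (b : ℚ) * ((MRMD.algorithmC c sub).1 : ℚ)) ∧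
    -- Algorithm C runs in polynomial time
    (∃ (P : MRMD.Prog) (T : Polynomial ℕ),
      ∀ (n k q : ℕ) (I : MRMD.Instance (Fin n) (Fin k) (Fin q)) (s : Fin q),
      I.SameStart s → I.TriangleInequality →
      ∀ (a b : ℕ), 0 < b → ∀ (c : MRMD.ABColoring I.conflictGraph a b),
        ∃ sub : ∀ v : I.Node, MRMD.Solution (I.DBar v) Unit (Fin q),
          (∀ v, (I.subproblem v).IsOptimal (sub v)) ∧
          MRMD.OutputsWithin P (MRMD.encodeInput I c) (MRMD.algorithmC c sub)
            (T.eval (MRMD.encodeInput I c).size)) := by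
  obtain ⟨P, T, hP⟩ := MRMD.Input.exists_polynomial_time
  exact ⟨fun n k q I s hs h a b hb c sub hsub =>
    ⟨MRMD.feasible_algorithmC hs h fun v => (hsub v).1, MRMD.objective_algorithmC c sub,
      MRMD.exists_isOptValue_le_algorithmC h hb hsub⟩,
    P, T, fun n k q I s hs h a b _ c => hP ⟨n, k, q, I, ⟨s, hs⟩, h, a, b, c⟩⟩
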